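/- **Setting.** Consider the three-dimensional incompressible Navier--Stokes equations with viscosity $\nu>0$ under one of two boundary conditions. (i) *Periodic*: $\Omega=[0,L]^3$, $L>0$; $H$ and $V$ are the closures in $L^2(\Omega)^3$ and in $H^1(\Omega)^3$ of the set of $\mathbb R^3$-valued $\Omega$-periodic divergence-free trigonometric polynomials with zero average. (ii) *No-slip*: $\Omega\subset\mathbb R^3$ is open, bounded, connected, with $C^\infty$ boundary and outward normal $\mathbf n$; $H=\{u\in L^2(\Omega)^3:\nabla\cdot u=0,\ u\cdot \mathbf n|_{\partial\Omega}=0\}$ and $V=\{u\in H^1_0(\Omega)^3:\nabla\cdot u=0\}$. Let $\langle\cdot,\cdot\rangle$ be the $L^2(\Omega)^3$ inner product and, for $u,v,w\in V$, let $\langle Au,v\rangle=\int_\Omega\sum_j\partial_ju\cdot\partial_jv\,dx$ and $\langle B(u,v),w\rangle=\int_\Omega((u\cdot\nabla)v)\cdot w\,dx$. Let $(\varphi_j)_{j\ge1}$ be an orthonormal basis of $H$ consisting of eigenfunctions $\varphi_j\in V$ of $A$, with eigenvalues $0<\lambda_1\le\lambda_2\le\cdots$, and let $P_n$ be the orthogonal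 projection onto $\operatorname{span}\{\varphi_1,\dots,\varphi_n\}$. For $\alpha\ge0$ let $D(A^\alpha)=\{u=\sum c_j\varphi_j\in H:\sum\lambda_j^{2\alpha}c_j^2<\infty\}$ with norm $|A^\alpha u|=(\sum\lambda_j^{2\alpha}c_j^2)^{1/2}$. Let $T>0$, $u_0\in H$, $f\in L^2(0,T;H)$. For $n\in\mathbb N$ let $u_n:[0,T]\to P_nH$ be a solution of the Galerkin system $$\frac{du_n}{dt}+\nu Au_n+P_nB(u_n,u_n)=P_nf,\qquad u_n(0)=P_nu_0 .$$ Let $(v_n)$ be a subsequence of $(u_n)$ that converges, weakly in $L^2(0,T;V)$ and strongly in $L^2(0,T;H)$, to a weak solution $u$ of the Navier--Stokes equations, that is, $u\in L^2(0,T;V)$, $\frac{d}{dt}\langle u,w\rangle+\nu\langle Au,w\rangle+\langle B(u,u),w\rangle=\langle f,w\rangle$ on $(0,T)$ for all $w\in V$, and $u(0)=u_0$. **Time-fractional spaces.** For $\gamma\in[0,1]$ and real Hilbert spaces $X\subset Y$ with continuous embedding, $\mathcal H^\gamma(0,T;X,Y)$ is the space of $g\in L^2(0,T;X)$ such that $|\tau|^\gamma\widehat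 g(\tau)\in L^2(\mathbb R;Y_{\mathbb C})$, where $\widehat g(\tau)=\int_0^Te^{2\pi i\tau t}g(t)\,dt$ and $Y_{\mathbb C}$ is the complexification of $Y$, with norm $\big(\|g\|_{L^2(0,T;X)}^2+\||\tau|^\gamma\widehat g\|_{L^2(\mathbb R;Y_{\mathbb C})}^2\big)^{1/2}$. **Expansions.** Let $Z$ be a real normed space, $(z_n)_{n\ge1}$ a sequence in $Z$, $z\in Z$, and let $\mathcal N$ be $\emptyset$, $\{1,\dots,K\}$ with $K\ge1$, or $\mathbb N$. The sequence has a *unitary expansion* $z_n\approx z+\sum_{k\in\mathcal N}\Gamma_{k,n}w_k$ in $Z$ if either $\mathcal N=\emptyset$ and $z_n=z$ for all $n$, or $\mathcal N\neq\emptyset$ and there are numbers $\Gamma_{k,n}>0$ and vectors $w_k,w_{k,n}\in Z$ ($k\in\mathcal N$, $n\ge1$) such that $\Gamma_{1,n}\to0$; $\Gamma_{k+1,n}/\Gamma_{k,n}\to0$ as $n\to\infty$ whenever $k,k+1\in\mathcal N$; $\|w_{k,n}-w_k\|_Z\to0$ as $n\to\infty$; $z_n=z+\sum_{j=1}^{k-1}\Gamma_{j,n}w_j+\Gamma_{k,n}w_{k,n}$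 for all $n\ge 1$, $k\in\mathcal N$; $w_{K,n}=w_K$ for all $n$ if $\mathcal N=\{1,\dots,K\}$; and $\|w_k\|_Z=1$ for all $k\in\mathcal N$. It has a *degenerate expansion* if $\mathcal N=\mathbb N$ and the same holds with the last condition replaced by: there is an integer $N\ge0$ with $\|w_k\|_Z=1$ for $k\le N$ and $w_k=0$ for $k>N$. **Theorem.** Let $\alpha_*\in(0,1/2)$ and $\gamma_*\in(0,1/4)$. There are a subsequence of $(v_n)$, still denoted by $(v_n)$, and an index set $\mathcal N$ as above such that $(v_n)$ has a unitary or degenerate expansion $$v_n\approx u+\sum_{k\in\mathcal N}\Gamma_{k,n}w_k\quad\text{in }\mathcal H^{\gamma_*}(0,T;D(A^{\alpha_*}),H),$$ and also a unitary or degenerate expansion $v_n\approx u+\sum_{k\in\mathcal N}\bar\Gamma_{k,n}\bar w_k$ in $L^2(0,T;D(A^{\alpha_*}))$, and one, with the same $\mathcal N$, in $L^2(0,T;H)$. In particular $u$ and all $v_n$ belong to these spaces. -/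

import Mathlib

open MeasureTheory Set Filter Topology
open scoped ContDiff

noncomputable section

namespace NSE

/-! ### Expansions in a normed space -/

section Expansion

variable {Z : Type*} [NormedAddCommGroup Z] [NormedSpace ℝ Z]

/-- `v n ≈ a + ∑_{k < K} Γ k n • w k` is a relaxed expansion in the normed space `Z`, with
remainders `r k n`. Terms are numbered from `0`. The number of terms `K : ℕ∞` encodes the three
cases: `K = 0` (trivial expansion), `1 ≤ K < ⊤` (finite expansion), `K = ⊤` (infinite expansion). -/
structure IsRelaxedExpansion (v : ℕ → Z) (a : Z) (K : ℕ∞)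
    (Γ : ℕ → ℕ → ℝ) (w : ℕ → Z) (r : ℕ → ℕ → Z) : Prop where
  trivial_eq : K = 0 → ∀ n, v n = a
  pos : ∀ k : ℕ, (k : ℕ∞) < K → ∀ n, 0 < Γ k n
  first : 0 < K → Tendsto (Γ 0) atTop (𝓝 0)
  ratio : ∀ k : ℕ, ((k + 1 : ℕ) : ℕ∞) < K →
    Tendsto (fun n => Γ (k + 1) n / Γ k n) atTop (𝓝 0)
  lim : ∀ k : ℕ, (k : ℕ∞) < K → Tendsto (r k) atTop (𝓝 (w k))
  expand : ∀ k : ℕ, (k : ℕ∞) < K → ∀ n,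
    v n = a + ∑ j ∈ Finset.range k, Γ j n • w j + Γ k n • r k n
  last : ∀ k : ℕ, ((k + 1 : ℕ) : ℕ∞) = K → w k ≠ 0 ∧ ∀ n, r k n = w k

/-- Unitary expansion with `K` terms: all `w k` are unit vectors. -/
def HasUnitaryExpansion (v : ℕ → Z) (a : Z) (K : ℕ∞) : Prop :=
  ∃ (Γ : ℕ → ℕ → ℝ) (w : ℕ → Z) (r : ℕ → ℕ → Z),
    IsRelaxedExpansion v a K Γ w r ∧ ∀ k : ℕ, (k : ℕ∞) < K → ‖w k‖ = 1

/-- Degenerate expansion: infinite, the first `N ≥ 0` vectors `w k` are unit vectors and the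
others vanish (`N = 0` is the case in which all of them vanish). -/
def HasDegenerateExpansion (v : ℕ → Z) (a : Z) (K : ℕ∞) : Prop :=
  K = ⊤ ∧ ∃ (Γ : ℕ → ℕ → ℝ) (w : ℕ → Z) (r : ℕ → ℕ → Z),
    IsRelaxedExpansion v a K Γ w r ∧
      ∃ N : ℕ, (∀ k < N, ‖w k‖ = 1) ∧ ∀ k, N ≤ k → w k = 0

/-- `v n` has a unitary or degenerate expansion with limit `a` and index set `{k | k < K}`. -/
def HasExpansion (v : ℕ → Z) (a : Z) (K : ℕ∞) : Prop :=
  HasUnitaryExpansion v a K ∨ HasDegenerateExpansion v a K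

end Expansion

/-! ### Spaces of functions of time with a fractional derivative -/

/-- Lebesgue measure on the time interval `[0, T]`. -/
abbrev timeMeasure (T : ℝ) : Measure ℝ := volume.restrict (Icc 0 T)

/-- The Hilbert space `L²(0, T; X)`. -/
abbrev TimeL2 (T : ℝ) (X : Type*) [NormedAddCommGroup X] := Lp X 2 (timeMeasure T)

/-- The complexification of a real space `Y`: the pair `(p, q)` is `p + i q`,
with norm `(‖p‖² + ‖q‖²)^(1/2)`. -/
abbrev Cplx (Y : Type*) := WithLp 2 (Y × Y)

section TimeSobolev

variable {X Y : Type*} [NormedAddCommGroup X] [NormedSpace ℝ X]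
  [NormedAddCommGroup Y] [InnerProductSpace ℝ Y]

/-- The Fourier transform `∫ exp(2πiτt) f(t) dt`, in the complexification of `Y`, of the extension
by zero of `f ∈ L²(0, T; X)`; here `ι` is the embedding of `X` into `Y`. The extension is in
`L¹ ∩ L²`, so that the transform is given by the integral. -/
def timeFourier {T : ℝ} (ι : X →L[ℝ] Y) (f : TimeL2 T X) (τ : ℝ) : Cplx Y :=
  WithLp.toLp 2
    (∫ t, Real.cos (2 * Real.pi * τ * t) • ι (f t) ∂timeMeasure T,
     ∫ t, Real.sin (2 * Real.pi * τ * t) • ι (f t) ∂timeMeasure T)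

lemma integrable_smul_timeL2 {T : ℝ} (ι : X →L[ℝ] Y) (f : TimeL2 T X) (c : ℝ → ℝ)
    (hc : Continuous c) (hb : ∀ t, ‖c t‖ ≤ 1) :
    Integrable (fun t => c t • ι (f t)) (timeMeasure T) := by
  have h1 : Integrable (f : ℝ → X) (timeMeasure T) :=
    (Lp.memLp f).integrable (by norm_num)
  exact (ι.integrable_comp h1).bdd_smul 1 hc.aestronglyMeasurable (ae_of_all _ hb)

lemma timeFourier_add {T : ℝ} (ι : X →L[ℝ] Y) (f g : TimeL2 T X) (τ : ℝ) :
    timeFourier ι (f + g) τ = timeFourier ι f τ + timeFourier ι g τ := by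
  have key : ∀ c : ℝ → ℝ, Continuous c → (∀ t, ‖c t‖ ≤ 1) →
      ∫ t, c t • ι ((f + g : TimeL2 T X) t) ∂timeMeasure T
        = ∫ t, c t • ι (f t) ∂timeMeasure T + ∫ t, c t • ι (g t) ∂timeMeasure T := by
    intro c hc hb
    rw [← integral_add (integrable_smul_timeL2 ι f c hc hb) (integrable_smul_timeL2 ι g c hc hb)]
    refine integral_congr_ae ?_
    filter_upwards [Lp.coeFn_add f g] with t ht
    rw [ht, Pi.add_apply, map_add, smul_add]
  unfold timeFourier
  rw [key _ (by fun_prop) (fun t => Real.abs_cos_le_one _),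
    key _ (by fun_prop) (fun t => Real.abs_sin_le_one _)]
  rfl

lemma timeFourier_smul {T : ℝ} (ι : X →L[ℝ] Y) (a : ℝ) (f : TimeL2 T X) (τ : ℝ) :
    timeFourier ι (a • f) τ = a • timeFourier ι f τ := by
  have key : ∀ c : ℝ → ℝ,
      ∫ t, c t • ι ((a • f : TimeL2 T X) t) ∂timeMeasure T
        = a • ∫ t, c t • ι (f t) ∂timeMeasure T := by
    intro c
    rw [← integral_smul]
    refine integral_congr_ae ?_
    filter_upwards [Lp.coeFn_smul a f] with t ht
    rw [ht, Pi.smul_apply, map_smul, smul_comm]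
  unfold timeFourier
  rw [key, key]
  rfl

/-- The space `𝓗^γ(0, T; X, Y)`. An element is a pair `(f, g)` with `f ∈ L²(0, T; X)` and
`g(τ) = |τ|^γ f̂(τ)` in `L²(ℝ; Y_ℂ)`; thus `f` determines the element, such a `g` exists exactly
when `|τ|^γ f̂ ∈ L²(ℝ; Y_ℂ)`, and the norm is `(‖f‖²_{L²(0,T;X)} + ‖|τ|^γ f̂‖²_{L²(ℝ;Y)})^(1/2)`. -/
def HGamma (T γ : ℝ) (ι : X →L[ℝ] Y) :
    Submodule ℝ (WithLp 2 (TimeL2 T X × Lp (Cplx Y) 2 (volume : Measure ℝ))) where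
  carrier := {p | p.snd =ᵐ[volume] fun τ => |τ| ^ γ • timeFourier ι p.fst τ}
  add_mem' := by
    intro p q hp hq
    simp only [mem_ofPred_eq, WithLp.add_fst, WithLp.add_snd] at *
    filter_upwards [hp, hq, Lp.coeFn_add p.snd q.snd] with τ h1 h2 h3
    rw [h3, Pi.add_apply, h1, h2, timeFourier_add, smul_add]
  zero_mem' := by
    simp only [mem_ofPred_eq, WithLp.zero_fst, WithLp.zero_snd]
    filter_upwards [Lp.coeFn_zero (Cplx Y) 2 (volume : Measure ℝ)] with τ h
    have := timeFourier_smul ι 0 (0 : TimeL2 T X) τ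
    rw [zero_smul, zero_smul] at this
    rw [h, this]; simp
  smul_mem' := by
    intro c p hp
    simp only [mem_ofPred_eq, WithLp.smul_fst, WithLp.smul_snd] at *
    filter_upwards [hp, Lp.coeFn_smul c p.snd] with τ h1 h2
    rw [h2, Pi.smul_apply, h1, timeFourier_smul, smul_comm]

instance (T γ : ℝ) (ι : X →L[ℝ] Y) : NormedAddCommGroup (HGamma T γ ι) := inferInstance

instance (T γ : ℝ) (ι : X →L[ℝ] Y) : NormedSpace ℝ (HGamma T γ ι) := inferInstance

/-- The function of time underlying an element of `𝓗^γ(0, T; X, Y)`. -/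
def HGamma.toFun {T γ : ℝ} {ι : X →L[ℝ] Y} (p : HGamma T γ ι) : TimeL2 T X := p.1.fst

end TimeSobolev

/-! ### Fractional powers of a positive diagonal operator -/

/-- An orthonormal basis of `H` with a nondecreasing sequence of positive numbers `λ_j`; these are
the eigenvectors and eigenvalues of the operator `A` with `A φ_j = λ_j φ_j`. -/
structure Spectral (H : Type*) [NormedAddCommGroup H] [InnerProductSpace ℝ H] where
  basis : HilbertBasis ℕ ℝ H
  lam : ℕ → ℝ
  lam_pos : ∀ j, 0 < lam j
  lam_mono : Monotone lam

namespace Spectral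

variable {H : Type*} [NormedAddCommGroup H] [InnerProductSpace ℝ H] (b : Spectral H)

/-- The domain of `A^α`: those `u = ∑ c_j φ_j` in `H` with `∑ λ_j^{2α} c_j² < ∞`. -/
def domPow (α : ℝ) : Submodule ℝ H where
  carrier := {u | Memℓp (fun j => b.lam j ^ α * b.basis.repr u j) 2}
  add_mem' := by
    intro u v hu hv
    have : (fun j => b.lam j ^ α * b.basis.repr (u + v) j)
        = (fun j => b.lam j ^ α * b.basis.repr u j) + fun j => b.lam j ^ α * b.basis.repr v j := by
      ext j; simp [mul_add]
    rw [mem_ofPred_eq, this]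
    exact hu.add hv
  zero_mem' := by
    have : (fun j => b.lam j ^ α * b.basis.repr (0 : H) j) = (0 : ℕ → ℝ) := by
      ext j; simp
    rw [mem_ofPred_eq, this]
    exact zero_memℓp
  smul_mem' := by
    intro c u hu
    have : (fun j => b.lam j ^ α * b.basis.repr (c • u) j)
        = c • fun j => b.lam j ^ α * b.basis.repr u j := by
      ext j; simp [mul_left_comm]
    rw [mem_ofPred_eq, this]
    exact hu.const_smul c

/-- The space `D(A^α)`, which carries the norm `|A^α u|` (and not the norm of `H`). -/
def DPow (α : ℝ) : Type _ := b.domPow α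

instance (α : ℝ) : AddCommGroup (b.DPow α) := inferInstanceAs (AddCommGroup (b.domPow α))

instance (α : ℝ) : Module ℝ (b.DPow α) := inferInstanceAs (Module ℝ (b.domPow α))

/-- The operator `A^α u = ∑ λ_j^α c_j φ_j` from `D(A^α)` to `H`. -/
def powA (α : ℝ) : b.DPow α →ₗ[ℝ] H where
  toFun u := b.basis.repr.symm ⟨fun j => b.lam j ^ α * b.basis.repr u.1 j, u.2⟩
  map_add' u v := by
    rw [← map_add]
    congr 1
    ext j
    change b.lam j ^ α * b.basis.repr (u.1 + v.1) j =
      b.lam j ^ α * b.basis.repr u.1 j + b.lam j ^ α * b.basis.repr v.1 j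
    simp [mul_add]
  map_smul' c u := by
    rw [RingHom.id_apply, ← map_smul]
    congr 1
    ext j
    change b.lam j ^ α * b.basis.repr (c • u.1) j = c * (b.lam j ^ α * b.basis.repr u.1 j)
    simp [mul_left_comm]

lemma repr_powA (α : ℝ) (u : b.DPow α) (j : ℕ) :
    b.basis.repr (b.powA α u) j = b.lam j ^ α * b.basis.repr u.1 j := by
  change b.basis.repr (b.basis.repr.symm _) j = _
  rw [LinearIsometryEquiv.apply_symm_apply]

lemma powA_injective (α : ℝ) : Function.Injective (b.powA α) := by
  rw [← LinearMap.ker_eq_bot, LinearMap.ker_eq_bot']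
  intro u hu
  have h : b.basis.repr u.1 = 0 := by
    ext j
    have := b.repr_powA α u j
    rw [hu, map_zero] at this
    have hl := (Real.rpow_pos_of_pos (b.lam_pos j) α).ne'
    simpa [hl] using this.symm
  exact Subtype.ext ((LinearIsometryEquiv.map_eq_zero_iff _).1 h)

instance (α : ℝ) : NormedAddCommGroup (b.DPow α) :=
  NormedAddCommGroup.induced _ _ (b.powA α) (b.powA_injective α)

instance (α : ℝ) : NormedSpace ℝ (b.DPow α) := NormedSpace.induced ℝ _ _ (b.powA α)

lemma norm_DPow (α : ℝ) (u : b.DPow α) : ‖u‖ = ‖b.powA α u‖ := rfl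

/-- The continuous embedding of `D(A^α)` into `H`, for `α ≥ 0`. -/
def incl {α : ℝ} (hα : 0 ≤ α) : b.DPow α →L[ℝ] H :=
  LinearMap.mkContinuous
    ({ toFun := fun u => u.1, map_add' := fun _ _ => rfl, map_smul' := fun _ _ => rfl } :
      b.DPow α →ₗ[ℝ] H)
    ((b.lam 0 ^ α)⁻¹) <| by
    intro u
    have h0 : 0 < b.lam 0 ^ α := Real.rpow_pos_of_pos (b.lam_pos 0) α
    rw [inv_mul_eq_div, le_div_iff₀ h0, mul_comm, norm_DPow]
    change b.lam 0 ^ α * ‖u.1‖ ≤ _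
    rw [← b.basis.repr.norm_map, ← b.basis.repr.norm_map (b.powA α u),
      ← abs_of_pos h0, ← Real.norm_eq_abs, ← norm_smul]
    refine lp.norm_mono (by simp) fun j => ?_
    rw [b.repr_powA, lp.coeFn_smul, Pi.smul_apply, smul_eq_mul, norm_mul, norm_mul]
    refine mul_le_mul_of_nonneg_right ?_ (norm_nonneg _)
    rw [Real.norm_of_nonneg h0.le,
      Real.norm_of_nonneg (Real.rpow_pos_of_pos (b.lam_pos j) α).le]
    exact Real.rpow_le_rpow (b.lam_pos 0).le (b.lam_mono (Nat.zero_le j)) hα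

end Spectral

/-! ### Spaces of vector fields -/

/-- Physical space. -/
abbrev E3 := EuclideanSpace ℝ (Fin 3)

/-- The space `L²(Ω)³`. -/
abbrev L2 (Ω : Set E3) := Lp E3 2 (volume.restrict Ω)

/-- Pairs `(u, (G₀, G₁, G₂))` with `u` and all `G j` in `L²(Ω)³`. A vector field `u ∈ H¹(Ω)³` is
recorded as the pair of `u` and its weak partial derivatives `G j = ∂u/∂x_j`, which `u`
determines; the norm is then the `H¹` norm. -/
abbrev H1Pair (Ω : Set E3) := WithLp 2 (L2 Ω × PiLp 2 (fun _ : Fin 3 => L2 Ω))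

/-- The `j`-th unit vector. -/
abbrev e (j : Fin 3) : E3 := EuclideanSpace.single j 1

/-- The pair `w` is the class of the differentiable field `p` with its partial derivatives. -/
def IsClassicalPair {Ω : Set E3} (w : H1Pair Ω) (p : E3 → E3) : Prop :=
  w.fst =ᵐ[volume.restrict Ω] p ∧
    ∀ j, w.snd j =ᵐ[volume.restrict Ω] fun x => fderiv ℝ p x (e j)

/-- The spaces `H` and `V` of a boundary value problem in `Ω`. The only instances used are
`periodicSpaces` and `noSlipSpaces` below. -/
structure FlowSpaces where
  Ω : Set E3
  H : Submodule ℝ (L2 Ω)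
  V : Submodule ℝ (H1Pair Ω)
  V_le_H : ∀ w ∈ V, w.fst ∈ H

/-! #### Periodic boundary conditions -/

/-- The cube `[0, L]³`. -/
def cube (L : ℝ) : Set E3 := {x | ∀ i, x i ∈ Icc 0 L}

/-- The phase `2π k·x / L`. -/
def phase (L : ℝ) (k : Fin 3 → ℤ) (x : E3) : ℝ := 2 * Real.pi / L * ∑ i, (k i : ℝ) * x i

/-- Real vector valued trigonometric polynomials of period `L`. -/
def trigPoly (L : ℝ) : Submodule ℝ (E3 → E3) :=
  Submodule.span ℝ
    {p | ∃ (k : Fin 3 → ℤ) (a : E3),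
      p = (fun x => Real.cos (phase L k x) • a) ∨ p = (fun x => Real.sin (phase L k x) • a)}

/-- Divergence-free trigonometric polynomials with zero average. -/
def periodicFields (L : ℝ) : Set (E3 → E3) :=
  {p | p ∈ trigPoly L ∧ (∀ x, ∑ j, (fderiv ℝ p x (e j)) j = 0) ∧ ∫ x in cube L, p x = 0}

/-- Closure of the divergence-free trigonometric polynomials with zero average in `L²`. -/
def periodicH (L : ℝ) : Submodule ℝ (L2 (cube L)) :=
  (Submodule.span ℝ {u : L2 (cube L) | ∃ p ∈ periodicFields L,
    u =ᵐ[volume.restrict (cube L)] p}).topologicalClosure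

/-- Closure of the divergence-free trigonometric polynomials with zero average in `H¹`. -/
def periodicV (L : ℝ) : Submodule ℝ (H1Pair (cube L)) :=
  (Submodule.span ℝ {w : H1Pair _ | ∃ p ∈ periodicFields L, IsClassicalPair w p}).topologicalClosure

lemma periodicV_le (L : ℝ) : ∀ w ∈ periodicV L, w.fst ∈ periodicH L := by
  have hcl : IsClosed {w : H1Pair (cube L) | w.fst ∈ periodicH L} :=
    (Submodule.isClosed_topologicalClosure _).preimage
      (WithLp.prod_continuous_ofLp 2 (L2 (cube L)) (PiLp 2 (fun _ : Fin 3 => L2 (cube L)))).fst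
  let M : Submodule ℝ (H1Pair (cube L)) :=
    { carrier := {w | w.fst ∈ periodicH L}
      add_mem' := fun ha hb => (periodicH L).add_mem ha hb
      zero_mem' := (periodicH L).zero_mem
      smul_mem' := fun c _ h => (periodicH L).smul_mem c h }
  have : periodicV L ≤ M := by
    refine Submodule.topologicalClosure_minimal _ ?_ hcl
    rw [Submodule.span_le]
    rintro w ⟨p, hp, hw⟩
    exact Submodule.le_topologicalClosure _ (Submodule.subset_span ⟨p, hp, hw.1⟩)
  exact fun w hw => this hw

/-- The spaces of the problem that is periodic in the cube `[0, L]³`. -/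
def periodicSpaces (L : ℝ) : FlowSpaces := ⟨cube L, periodicH L, periodicV L, periodicV_le L⟩

/-! #### No-slip boundary conditions -/

/-- The boundary of `Ω` is of class `C^∞`: near each of its points `Ω` is the set where a smooth
function with nonzero differential is negative. -/
def HasSmoothBoundary (Ω : Set E3) : Prop :=
  ∀ x ∈ frontier Ω, ∃ (U : Set E3) (ρ : E3 → ℝ), IsOpen U ∧ x ∈ U ∧ ContDiff ℝ ∞ ρ ∧
    fderiv ℝ ρ x ≠ 0 ∧ Ω ∩ U = {y ∈ U | ρ y < 0}

/-- The fields `u ∈ L²(Ω)³` with `∇·u = 0` in `Ω` and `u·n = 0` on the boundary. As usual for square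
integrable fields, both conditions are understood through Green's formula:
`∫_Ω u·∇p = 0` for all `p` smooth up to the boundary. -/
def noSlipH (Ω : Set E3) : Submodule ℝ (L2 Ω) :=
  (Submodule.span ℝ {g : L2 Ω | ∃ p : E3 → ℝ, ContDiff ℝ ∞ p ∧ HasCompactSupport p ∧
    g =ᵐ[volume.restrict Ω] gradient p})ᗮ

/-- The space `H¹₀(Ω)³`: closure in `H¹` of the smooth fields with compact support in `Ω`. -/
def sobolevZero (Ω : Set E3) : Submodule ℝ (H1Pair Ω) :=
  (Submodule.span ℝ {w : H1Pair _ | ∃ p : E3 → E3, ContDiff ℝ ∞ p ∧ HasCompactSupport p ∧ tsupport p ⊆ Ω ∧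
    IsClassicalPair w p}).topologicalClosure

/-- The fields in `H¹₀(Ω)³` with divergence zero. -/
def noSlipV (Ω : Set E3) : Submodule ℝ (H1Pair Ω) where
  carrier := {w | w ∈ sobolevZero Ω ∧ ∀ᵐ x ∂volume.restrict Ω, ∑ j, (w.snd j x) j = 0}
  add_mem' := by
    rintro w z ⟨hw, hw'⟩ ⟨hz, hz'⟩
    refine ⟨add_mem hw hz, ?_⟩
    filter_upwards [hw', hz', ae_all_iff.2 fun j => Lp.coeFn_add (w.snd j) (z.snd j)]
      with x h1 h2 h3
    have : ∀ j, ((w + z).snd j : E3 → E3) x = w.snd j x + z.snd j x := h3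
    simp only [this, PiLp.add_apply, Finset.sum_add_distrib, h1, h2, add_zero]
  zero_mem' := by
    refine ⟨zero_mem _, ?_⟩
    filter_upwards [Lp.coeFn_zero E3 2 (volume.restrict Ω)] with x h
    have : ∀ j, ((0 : H1Pair Ω).snd j : E3 → E3) x = 0 := fun _ => h
    simp only [this, PiLp.zero_apply, Finset.sum_const_zero]
  smul_mem' := by
    rintro c w ⟨hw, hw'⟩
    refine ⟨Submodule.smul_mem _ c hw, ?_⟩
    filter_upwards [hw', ae_all_iff.2 fun j => Lp.coeFn_smul c (w.snd j)] with x h1 h3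
    have : ∀ j, ((c • w).snd j : E3 → E3) x = c • w.snd j x := h3
    simp only [this, PiLp.smul_apply, ← Finset.smul_sum, h1, smul_zero]

lemma noSlipV_le (Ω : Set E3) : ∀ w ∈ noSlipV Ω, w.fst ∈ noSlipH Ω := by
  rintro w ⟨hw, hdiv⟩
  refine (Submodule.mem_orthogonal _ _).2 fun g hg => ?_
  induction hg using Submodule.span_induction with
  | zero => simp
  | add x y _ _ hx hy => rw [inner_add_left, hx, hy, add_zero]
  | smul c x _ hx => rw [inner_smul_left, hx, mul_zero]
  | mem g hg =>
    obtain ⟨p, hp, hpc, hgp⟩ := hg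
    have hpd : Differentiable ℝ p := hp.differentiable (by simp)
    have hdp : Continuous (fderiv ℝ p) := hp.continuous_fderiv (by simp)
    have hq : ∀ j, MemLp (fun x => p x • e j) 2 (volume.restrict Ω) := fun j =>
      ((hp.continuous.smul continuous_const).memLp_of_hasCompactSupport
        (hpc.smul_right)).restrict Ω
    let Q : H1Pair Ω := WithLp.toLp 2 (g, WithLp.toLp 2 fun j => (hq j).toLp _)
    have hQ : ∀ z : H1Pair Ω, inner ℝ Q z =
        inner ℝ g z.fst + ∑ j, inner ℝ ((hq j).toLp _) (z.snd j) := fun z => by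
      rw [WithLp.prod_inner_apply, PiLp.inner_apply]; rfl
    have hz : ∀ (z : L2 Ω) (j : Fin 3), inner ℝ ((hq j).toLp _) z = ∫ x in Ω, p x * z x j := by
      intro z j
      rw [L2.inner_def]
      refine integral_congr_ae ?_
      filter_upwards [(hq j).coeFn_toLp] with x hx
      rw [hx, inner_smul_left, EuclideanSpace.inner_single_left]
      simp
    have hgen : sobolevZero Ω ≤ (Submodule.span ℝ {Q})ᗮ := by
      refine Submodule.topologicalClosure_minimal _ ?_ (Submodule.isClosed_orthogonal _)
      rw [Submodule.span_le]
      rintro z ⟨φ, hφ, hφc, hφs, hz1, hz2⟩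
      refine Submodule.mem_orthogonal_singleton_iff_inner_right.2 ?_
      have hφd : Differentiable ℝ φ := hφ.differentiable (by simp)
      have hdφ : Continuous (fderiv ℝ φ) := hφ.continuous_fderiv (by simp)
      have hout : ∀ x, x ∉ Ω → φ x = 0 := fun x hx => image_eq_zero_of_notMem_tsupport
        fun h => hx (hφs h)
      have hout' : ∀ x, x ∉ Ω → fderiv ℝ φ x = 0 := fun x hx =>
        image_eq_zero_of_notMem_tsupport
          fun h => hx (hφs (tsupport_fderiv_subset ℝ h))
      have hcoord : ∀ j : Fin 3, ContDiff ℝ ∞ (fun x => φ x j) := fun j => by fun_prop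
      have hcd : ∀ (j : Fin 3) x v, fderiv ℝ (fun x => φ x j) x v = (fderiv ℝ φ x v) j := by
        intro j x v
        have := ((EuclideanSpace.proj (𝕜 := ℝ) j).hasFDerivAt.comp x
          (hφd x).hasFDerivAt).fderiv
        have h2 : (⇑(EuclideanSpace.proj (𝕜 := ℝ) (ι := Fin 3) j) ∘ φ)
          = fun x => φ x j := rfl
        rw [h2] at this
        rw [this]; rfl
      have hcc : ∀ j : Fin 3, HasCompactSupport (fun x => φ x j) := fun j =>
        hφc.comp_left (g := fun y : E3 => y j) rfl
      have hcont : ∀ j : Fin 3, Continuous fun x => (fderiv ℝ φ x (e j)) j := fun j => by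
        fun_prop
      have hcont' : ∀ j : Fin 3, Continuous fun x => fderiv ℝ p x (e j) := fun j => by fun_prop
      have i1 : ∀ j : Fin 3, Integrable fun x => φ x j * fderiv ℝ p x (e j) := fun j =>
        ((hcoord j).continuous.mul (hcont' j)).integrable_of_hasCompactSupport (hcc j).mul_right
      have i2 : ∀ j : Fin 3, Integrable fun x => (fderiv ℝ φ x (e j)) j * p x := fun j =>
        ((hcont j).mul hp.continuous).integrable_of_hasCompactSupport hpc.mul_left
      have i3 : ∀ j : Fin 3, Integrable fun x => φ x j * p x := fun j =>
        ((hcoord j).continuous.mul hp.continuous).integrable_of_hasCompactSupport hpc.mul_left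
      have ibp : ∀ j : Fin 3, ∫ x, φ x j * fderiv ℝ p x (e j)
          = -∫ x, (fderiv ℝ φ x (e j)) j * p x := by
        intro j
        have := integral_mul_fderiv_eq_neg_fderiv_mul_of_integrable (μ := (volume : Measure E3))
          (f := fun x => φ x j) (g := p) (v := e j) (by simpa only [hcd] using i2 j) (i1 j) (i3 j)
          (fun x _ => (hcoord j).differentiable (by simp) x) (fun x _ => hpd x)
        simpa only [hcd] using this
      have t1 : inner ℝ g z.fst = ∑ j, ∫ x, φ x j * fderiv ℝ p x (e j) := by
        rw [← integral_finsetSum _ fun j _ => i1 j, L2.inner_def,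
          ← setIntegral_eq_integral_of_forall_compl_eq_zero (s := Ω) (μ := volume)
            (f := fun x => ∑ j, φ x j * fderiv ℝ p x (e j))
            (fun x hx => by simp [hout x hx])]
        refine integral_congr_ae ?_
        filter_upwards [hgp, hz1] with x h1 h2
        rw [h1, h2, inner_gradient_left]
        have hsum : φ x = ∑ j, φ x j • e j := by
          ext i; simp [Finset.sum_apply, Pi.single_apply]
        conv_lhs => rw [hsum, map_sum]
        simp
      have t2 : ∀ j, inner ℝ ((hq j).toLp _) (z.snd j)
          = ∫ x, (fderiv ℝ φ x (e j)) j * p x := by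
        intro j
        rw [hz, ← setIntegral_eq_integral_of_forall_compl_eq_zero (s := Ω) (μ := volume)
            (f := fun x => (fderiv ℝ φ x (e j)) j * p x)
            (fun x hx => by simp [hout' x hx])]
        refine integral_congr_ae ?_
        filter_upwards [hz2 j] with x h1
        rw [h1, mul_comm]
      rw [hQ, t1, Finset.sum_congr rfl fun j _ => ibp j, Finset.sum_congr rfl fun j _ => t2 j]
      simp
    have h0 : inner ℝ Q w = 0 := Submodule.mem_orthogonal_singleton_iff_inner_right.1 (hgen hw)
    have h1 : ∑ j, inner ℝ ((hq j).toLp _) (w.snd j) = 0 := by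
      simp only [hz]
      rw [← integral_finsetSum]
      · refine integral_eq_zero_of_ae ?_
        filter_upwards [hdiv] with x hx
        rw [← Finset.mul_sum, hx, mul_zero]; rfl
      · intro j _
        have := L2.integrable_inner (𝕜 := ℝ) ((hq j).toLp _) (w.snd j)
        refine this.congr ?_
        filter_upwards [(hq j).coeFn_toLp] with x hx
        rw [hx, inner_smul_left, EuclideanSpace.inner_single_left]
        simp
    rwa [hQ, h1, add_zero] at h0

/-- The spaces of the no-slip problem in `Ω`. -/
def noSlipSpaces (Ω : Set E3) : FlowSpaces := ⟨Ω, noSlipH Ω, noSlipV Ω, noSlipV_le Ω⟩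

/-- The two boundary value problems: periodic in a cube, or no-slip in a bounded connected open set
with smooth boundary. -/
def FlowSpaces.IsPeriodicOrNoSlip (S : FlowSpaces) : Prop :=
  (∃ L : ℝ, 0 < L ∧ S = periodicSpaces L) ∨
  ∃ Ω : Set E3, IsOpen Ω ∧ IsConnected Ω ∧ Bornology.IsBounded Ω ∧ HasSmoothBoundary Ω ∧
    S = noSlipSpaces Ω

/-! ### Stokes operator and bilinear operator -/

namespace FlowSpaces

variable (S : FlowSpaces)

/-- The embedding of `V` into `H`. -/
def toH : S.V →L[ℝ] S.H :=
  ((WithLp.fstL 2 ℝ (L2 S.Ω) (PiLp 2 (fun _ : Fin 3 => L2 S.Ω))).comp S.V.subtypeL).codRestrict S.H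
    fun w => S.V_le_H w.1 w.2

variable {S}

/-- The form `⟨⟨u, v⟩⟩ = ∫_Ω ∑_j ∂_j u · ∂_j v = ⟨Au, v⟩`. -/
def dirichlet (u v : S.V) : ℝ := ∑ j, inner ℝ (u.1.snd j) (v.1.snd j)

/-- The form `⟨B(u, v), w⟩ = ∫_Ω ((u·∇)v)·w`. -/
def trilinear (u v w : S.V) : ℝ :=
  ∫ x in S.Ω, ∑ j, u.1.fst x j * inner ℝ (v.1.snd j x) (w.1.fst x)

end FlowSpaces

/-- An orthonormal basis `φ_j` of `H` of eigenfunctions of the Stokes operator, with eigenvalues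
`0 < λ_0 ≤ λ_1 ≤ …`. The relation `A φ_j = λ_j φ_j` is understood in the dual of `V`. -/
structure StokesBasis (S : FlowSpaces) extends Spectral S.H where
  /-- `φ_j` as an element of `V` -/
  vec : ℕ → S.V
  toH_vec : ∀ j, S.toH (vec j) = basis j
  eigen : ∀ j (v : S.V),
    FlowSpaces.dirichlet (vec j) v = lam j * inner ℝ (basis j) (S.toH v)


/-! ### Galerkin approximations and weak solutions -/

/-- `U : [0, T] → P_n H` solves the Galerkin system of order `n`,
`dU/dt + ν A U + P_n B(U, U) = P_n f`, `U(0) = P_n u₀`. As `f` is only square integrable in time,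
the differential equation is understood in its integrated form (equivalently, `U` is absolutely
continuous and the equation holds almost everywhere). The case `t = 0` is the initial condition. -/
structure IsGalerkinSolution {S : FlowSpaces} (b : StokesBasis S) (ν T : ℝ) (u₀ : S.H)
    (f : TimeL2 T S.H) (n : ℕ) (U : ℝ → S.V) : Prop where
  mem : ∀ t ∈ Icc 0 T, U t ∈ Submodule.span ℝ (b.vec '' Iio n)
  cont : ContinuousOn U (Icc 0 T)
  eqn : ∀ t ∈ Icc 0 T, ∀ j < n,
    inner ℝ (S.toH (U t)) (b.basis j) = inner ℝ u₀ (b.basis j) +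
      ∫ s in 0..t, (inner ℝ (f s) (b.basis j) - ν * FlowSpaces.dirichlet (U s) (b.vec j)
        - FlowSpaces.trilinear (U s) (U s) (b.vec j))

/-- `u ∈ L²(0, T; V)` is a weak solution: `d/dt ⟨u, w⟩ + ν ⟨⟨u, w⟩⟩ + ⟨B(u, u), w⟩ = ⟨f, w⟩`
on `(0, T)` in the sense of distributions for all `w ∈ V`, and `u(0) = u₀`; both in
integrated form. -/
def IsWeakSolution (S : FlowSpaces) (ν T : ℝ) (u₀ : S.H) (f : TimeL2 T S.H)
    (u : TimeL2 T S.V) : Prop :=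
  ∀ w : S.V, ∀ᵐ t ∂timeMeasure T,
    inner ℝ (S.toH (u t)) (S.toH w) = inner ℝ u₀ (S.toH w) +
      ∫ s in 0..t, (inner ℝ (f s) (S.toH w) - ν * FlowSpaces.dirichlet (u s) w
        - FlowSpaces.trilinear (u s) (u s) w)

end NSE

end

set_option linter.unusedSectionVars false

noncomputable section

namespace NSE

section

section Expansion

variable {Z Y : Type*} [NormedAddCommGroup Z] [NormedSpace ℝ Z]
  [NormedAddCommGroup Y] [NormedSpace ℝ Y]
  {v : ℕ → Z} {a : Z} {K : ℕ∞} {Γ : ℕ → ℕ → ℝ} {w : ℕ → Z} {r : ℕ → ℕ → Z}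

/-- An injective continuous linear map carries relaxed expansions to relaxed expansions. -/
theorem IsRelaxedExpansion.map (h : IsRelaxedExpansion v a K Γ w r) (R : Z →L[ℝ] Y)
    (hR : Function.Injective R) :
    IsRelaxedExpansion (fun n => R (v n)) (R a) K Γ (fun k => R (w k)) (fun k n => R (r k n)) where
  trivial_eq hK n := by rw [h.trivial_eq hK]
  pos := h.pos
  first := h.first
  ratio := h.ratio
  lim k hk := (R.continuous.tendsto _).comp (h.lim k hk)
  expand k hk n := by rw [h.expand k hk n]; simp
  last k hk := by
    obtain ⟨h1, h2⟩ := h.last k hk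
    exact ⟨fun h0 => h1 (hR (by simpa using h0)), fun n => by rw [h2]⟩

theorem IsRelaxedExpansion.ratio_of_lt (h : IsRelaxedExpansion v a K Γ w r) {k m : ℕ}
    (hkm : k < m) (hm : (m : ℕ∞) < K) : Tendsto (fun n => Γ m n / Γ k n) atTop (𝓝 0) := by
  induction m, hkm using Nat.le_induction with
  | base => exact h.ratio k hm
  | succ m hkm ih =>
    have hm' : (m : ℕ∞) < K := lt_of_le_of_lt (by exact_mod_cast Nat.le_succ m) hm
    have := (h.ratio m hm).mul (ih hm')
    rw [zero_mul] at this
    refine this.congr fun n => ?_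
    rw [div_mul_div_cancel₀ (h.pos m hm' n).ne']

theorem IsRelaxedExpansion.tendsto_zero (h : IsRelaxedExpansion v a K Γ w r) {k : ℕ}
    (hk : (k : ℕ∞) < K) : Tendsto (Γ k) atTop (𝓝 0) := by
  have h0 : (0 : ℕ∞) < K := lt_of_le_of_lt zero_le hk
  rcases Nat.eq_zero_or_pos k with rfl | hk0
  · exact h.first h0
  · have := (h.ratio_of_lt hk0 hk).mul (h.first h0)
    rw [zero_mul] at this
    refine this.congr fun n => ?_
    rw [div_mul_cancel₀ _ (h.pos 0 h0 n).ne']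

/-- Omission of vanishing terms, along the increasing enumeration `κ` of the remaining ones,
and rescaling. -/
theorem IsRelaxedExpansion.reindex (h : IsRelaxedExpansion v a K Γ w r) {K' : ℕ∞} (κ : ℕ → ℕ)
    (c : ℕ → ℝ) (hc : ∀ i, 0 < c i) (hK : ∀ i : ℕ, (i : ℕ∞) < K' → (κ i : ℕ∞) < K)
    (hmono : ∀ i j : ℕ, i < j → (j : ℕ∞) < K' → κ i < κ j)
    (hmem : ∀ i : ℕ, (i : ℕ∞) < K' → ∀ k < κ i, w k ≠ 0 → ∃ j < i, κ j = k)
    (hlast : ∀ i : ℕ, ((i + 1 : ℕ) : ℕ∞) = K' → ((κ i + 1 : ℕ) : ℕ∞) = K)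
    (hzero : K' = 0 → K = 0) :
    IsRelaxedExpansion v a K' (fun i n => c i * Γ (κ i) n) (fun i => (c i)⁻¹ • w (κ i))
      (fun i n => (c i)⁻¹ • r (κ i) n) where
  trivial_eq hK' := h.trivial_eq (hzero hK')
  pos i hi n := mul_pos (hc i) (h.pos _ (hK i hi) n)
  first hi := by simpa using (h.tendsto_zero (hK 0 hi)).const_mul (c 0)
  ratio i hi := by
    have := (h.ratio_of_lt (hmono i (i + 1) (Nat.lt_succ_self i) hi) (hK _ hi)).const_mul
      (c (i + 1) / c i)
    rw [mul_zero] at this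
    exact this.congr fun n => by rw [div_mul_div_comm]
  lim i hi := (h.lim _ (hK i hi)).const_smul _
  expand i hi n := by
    rw [h.expand _ (hK i hi) n]
    congr 1
    · congr 1
      have hinj : Set.InjOn κ (Finset.range i) := by
        intro j hj k hk hjk
        simp only [Finset.coe_range, mem_Iio] at hj hk
        have lt' : ∀ m : ℕ, m < i → (m : ℕ∞) < K' := fun m hm =>
          lt_trans (by exact_mod_cast hm) hi
        rcases lt_trichotomy j k with hlt | heq | hlt
        · exact absurd hjk (hmono j k hlt (lt' k hk)).ne
        · exact heq
        · exact absurd hjk (hmono k j hlt (lt' j hj)).ne'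
      have : ∑ j ∈ Finset.range i, (c j * Γ (κ j) n) • (c j)⁻¹ • w (κ j)
          = ∑ k ∈ (Finset.range i).image κ, Γ k n • w k := by
        rw [Finset.sum_image hinj]
        refine Finset.sum_congr rfl fun j _ => ?_
        rw [smul_smul, mul_comm (c j), mul_assoc, mul_inv_cancel₀ (hc j).ne', mul_one]
      rw [this]
      symm
      refine Finset.sum_subset ?_ ?_
      · intro k hk
        obtain ⟨j, hj, rfl⟩ := Finset.mem_image.1 hk
        exact Finset.mem_range.2 (hmono j i (Finset.mem_range.1 hj) hi)
      · intro k hk hk'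
        by_cases hw : w k = 0
        · rw [hw, smul_zero]
        · obtain ⟨j, hj, rfl⟩ := hmem i hi k (Finset.mem_range.1 hk) hw
          exact absurd (Finset.mem_image_of_mem κ (Finset.mem_range.2 hj)) hk'
    · rw [smul_smul, mul_comm (c i), mul_assoc, mul_inv_cancel₀ (hc i).ne', mul_one]
  last i hi := by
    obtain ⟨h1, h2⟩ := h.last _ (hlast i hi)
    exact ⟨smul_ne_zero (inv_ne_zero (hc i).ne') h1, fun n => by rw [h2]⟩

/-- Number of terms that are left when the vanishing terms of an expansion of length `K` are
omitted; `p` is the set of the indices of the others. If finitely many terms do not vanish in an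
infinite expansion, it becomes a degenerate one, which is again infinite. -/
def reducedLength (K : ℕ∞) (p : ℕ → Prop) : ℕ∞ := by
  classical exact if K = ⊤ then ⊤ else (Nat.count p K.toNat : ℕ)

theorem exists_lt_nth_eq {p : ℕ → Prop} {i k : ℕ} (hk : k < Nat.nth p i) (hp : p k) :
    ∃ j < i, Nat.nth p j = k := by
  obtain ⟨j, hj, hjk⟩ := Nat.exists_lt_card_nth_eq hp
  refine ⟨j, ?_, hjk⟩
  by_contra! hij
  have := Nat.nth_le_nth' hij hj
  omega

/-- The factor by which a nonzero vector is divided when it is normalized. -/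
def normOrOne (z : Z) : ℝ := by classical exact if z = 0 then 1 else ‖z‖

theorem normOrOne_pos {Z : Type*} [NormedAddCommGroup Z] (z : Z) : 0 < normOrOne z := by
  by_cases hz : z = 0 <;> simp [normOrOne, hz]

theorem norm_inv_normOrOne_smul {z : Z} (hz : z ≠ 0) : ‖(normOrOne z)⁻¹ • z‖ = 1 := by
  have : normOrOne z = ‖z‖ := by simp [normOrOne, hz]
  rw [norm_smul, norm_inv, this, norm_norm, inv_mul_cancel₀ (norm_ne_zero_iff.2 hz)]

theorem IsRelaxedExpansion.hasExpansion_top (h : IsRelaxedExpansion v a ⊤ Γ w r) (p : ℕ → Prop)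
    (hp : ∀ k, p k ↔ w k ≠ 0) : HasExpansion v a (reducedLength ⊤ p) := by
  classical
  rw [reducedLength, if_pos rfl]
  by_cases hinf : {k | p k}.Infinite
  · left
    refine ⟨_, _, _, h.reindex (Nat.nth p)
      (fun i => normOrOne (w (Nat.nth p i))) (fun i => normOrOne_pos _)
      (fun _ _ => ENat.natCast_lt_top _) (fun i j hij _ => Nat.nth_strictMono hinf hij)
      (fun i _ k hk hw => exists_lt_nth_eq hk ((hp k).2 hw)) (fun i hi => absurd hi (ENat.natCast_ne_top _))
      (fun h0 => h0), fun i _ => ?_⟩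
    exact norm_inv_normOrOne_smul ((hp _).1 (Nat.nth_mem_of_infinite hinf i))
  · right
    have hex : ∃ M, ∀ m, M ≤ m → w m = 0 := by
      obtain ⟨M, hM⟩ := (Set.not_infinite.1 hinf).bddAbove
      refine ⟨M + 1, fun m hm => ?_⟩
      by_contra hw
      have : m ≤ M := hM ((hp m).2 hw)
      omega
    obtain ⟨M, hM⟩ := hex
    let q : ℕ → Prop := fun k => w k ≠ 0 ∨ M ≤ k
    have hq : {k | q k}.Infinite :=
      (Set.infinite_of_not_bddAbove (by simp [not_bddAbove_Ici])).mono
        (fun k (hk : k ∈ Set.Ici M) => Or.inr hk)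
    refine ⟨rfl, _, _, _, h.reindex (Nat.nth q) (fun i => normOrOne (w (Nat.nth q i))) (fun i => normOrOne_pos _)
      (fun _ _ => ENat.natCast_lt_top _) (fun i j hij _ => Nat.nth_strictMono hq hij)
      (fun i _ k hk hw => exists_lt_nth_eq hk (Or.inl hw))
      (fun i hi => absurd hi (ENat.natCast_ne_top _)) (fun h0 => h0),
      Nat.count q M, fun i hi => ?_, fun i hi => ?_⟩
    · refine norm_inv_normOrOne_smul ?_
      have h1 : Nat.nth q i < M := Nat.nth_lt_of_lt_count hi
      change w (Nat.nth q i) ≠ 0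
      rcases Nat.nth_mem_of_infinite hq i with h2 | h2
      · exact h2
      · exact absurd h2 (not_le.2 h1)
    · rw [hM _ ?_, smul_zero]
      rw [← Nat.nth_count (p := q) (n := M) (Or.inr le_rfl)]
      exact (Nat.nth_strictMono hq).monotone hi

theorem IsRelaxedExpansion.hasExpansion_natCast {m : ℕ} (h : IsRelaxedExpansion v a m Γ w r)
    (p : ℕ → Prop) (hp : ∀ k, p k ↔ w k ≠ 0) : HasExpansion v a (reducedLength m p) := by
  classical
  left
  have hlast : m ≠ 0 → p (m - 1) := fun hm => (hp _).2
    (h.last (m - 1) (by rw [Nat.sub_add_cancel (Nat.pos_of_ne_zero hm)])).1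
  have hcount : m ≠ 0 → Nat.count p m = Nat.count p (m - 1) + 1 := fun hm => by
    conv_lhs => rw [← Nat.sub_add_cancel (Nat.pos_of_ne_zero hm)]
    rw [Nat.count_succ, if_pos (hlast hm)]
  rw [reducedLength, if_neg (ENat.natCast_ne_top m), ENat.toNat_natCast]
  have hcard : ∀ i, i < Nat.count p m → ∀ hf : (Set.ofPred p).Finite, i < hf.toFinset.card :=
    fun i hi hf => lt_of_lt_of_le hi (Nat.count_le_card hf m)
  refine ⟨_, _, _, h.reindex (Nat.nth p) (fun i => normOrOne (w (Nat.nth p i))) (fun i => normOrOne_pos _)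
    ?_ ?_ (fun i _ k hk hw => exists_lt_nth_eq hk ((hp k).2 hw)) ?_ ?_, ?_⟩
  · intro i hi
    exact_mod_cast Nat.nth_lt_of_lt_count (by exact_mod_cast hi)
  · intro i j hij hj
    exact Nat.nth_lt_nth' hij (hcard j (by exact_mod_cast hj))
  · intro i hi
    have hi : i + 1 = Nat.count p m := by exact_mod_cast hi
    have hm0 : m ≠ 0 := by rintro rfl; simp at hi
    have hi' := hcount hm0
    have : i = Nat.count p (m - 1) := by omega
    rw [this, Nat.nth_count (hlast hm0), Nat.sub_add_cancel (Nat.pos_of_ne_zero hm0)]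
  · intro h0
    by_contra hm
    have hi' := hcount fun h => hm (by rw [h]; rfl)
    have := Nat.cast_eq_zero.1 h0
    omega
  · intro i hi
    exact norm_inv_normOrOne_smul ((hp _).1 <| Nat.nth_mem i (hcard i (by exact_mod_cast hi)))

/-- A relaxed expansion becomes unitary or degenerate when its vanishing terms are omitted and the
other ones normalized. -/
theorem IsRelaxedExpansion.hasExpansion (h : IsRelaxedExpansion v a K Γ w r) (p : ℕ → Prop)
    (hp : ∀ k, p k ↔ w k ≠ 0) : HasExpansion v a (reducedLength K p) := by
  by_cases hK : K = ⊤
  · rw [hK] at h ⊢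
    exact h.hasExpansion_top p hp
  · rw [← ENat.natCast_toNat hK] at h ⊢
    exact h.hasExpansion_natCast p hp

end Expansion

section Tower

variable {Z : ℕ → Type*} [∀ k, NormedAddCommGroup (Z k)] [∀ k, NormedSpace ℝ (Z k)]
  {Y : Type*} [NormedAddCommGroup Y] [NormedSpace ℝ Y]

/-- The remainders of the expansion of a null sequence `x` in a tower of spaces. The `k`-th term is
the limit in `Z (k + 1)`, along an ultrafilter, of the remainders normalized in `Z k`. -/
def towerRem (I : ∀ k, Z k →L[ℝ] Z (k + 1)) (x : ℕ → Z 0) : ∀ k, ℕ → Z k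
  | 0 => x
  | k + 1 => fun n => I k (towerRem I x k n) - ‖towerRem I x k n‖ •
      limUnder (hyperfilter ℕ : Filter ℕ)
        (fun n => I k (‖towerRem I x k n‖⁻¹ • towerRem I x k n))

/-- A null sequence in the first space of a tower of compactly embedded spaces has a subsequence
with a relaxed expansion in any space that contains the whole tower. -/
theorem exists_relaxedExpansion (I : ∀ k, Z k →L[ℝ] Z (k + 1)) (hI : ∀ k, IsCompactOperator (I k))
    (Q : ∀ k, Z k →L[ℝ] Y) (hQI : ∀ k z, Q (k + 1) (I k z) = Q k z)
    (hQ : ∀ k, Function.Injective (Q k)) (x : ℕ → Z 0) (a : Z 0) (hx : Tendsto x atTop (𝓝 a)) :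
    ∃ s : ℕ → ℕ, StrictMono s ∧ ∃ K Γ w r,
      IsRelaxedExpansion (fun n => Q 0 (x (s n))) (Q 0 a) K Γ w r := by
  classical
  set 𝒰 : Ultrafilter ℕ := hyperfilter ℕ with h𝒰
  have h𝒰top : (𝒰 : Filter ℕ) ≤ atTop := Nat.hyperfilter_le_atTop
  set ρ := towerRem I (fun n => x n - a) with hρ
  set un : ∀ k, ℕ → Z k := fun k n => ‖ρ k n‖⁻¹ • ρ k n with hun
  set θ : ∀ k, Z (k + 1) := fun k => limUnder (𝒰 : Filter ℕ) (fun n => I k (un k n)) with hθ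
  have hun_norm : ∀ k n, ‖un k n‖ ≤ 1 := fun k n => by
    rw [hun, norm_smul, norm_inv, norm_norm]
    exact inv_mul_le_one
  have hun_smul : ∀ k n, ‖ρ k n‖ • un k n = ρ k n := fun k n => by
    by_cases h : ρ k n = 0
    · simp [h]
    · rw [hun, smul_smul, mul_inv_cancel₀ (norm_ne_zero_iff.2 h), one_smul]
  have hlim : ∀ k, Tendsto (fun n => I k (un k n)) 𝒰 (𝓝 (θ k)) := by
    intro k
    refine tendsto_nhds_limUnder ?_
    obtain ⟨C, hC, hCs⟩ :=
      IsCompactOperator.image_closedBall_subset_compact (f := (I k : Z k →ₗ[ℝ] Z (k + 1))) (hI k) 1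
    obtain ⟨y, -, hy⟩ := hC.ultrafilter_le_nhds (𝒰.map fun n => I k (un k n)) (by
      rw [Filter.le_principal_iff]
      refine Filter.mem_map.2 (Filter.univ_mem' fun n => hCs ?_)
      exact ⟨un k n, by simpa using hun_norm k n, rfl⟩)
    exact ⟨y, hy⟩
  have hsucc : ∀ k n, ρ (k + 1) n = ‖ρ k n‖ • (I k (un k n) - θ k) := by
    intro k n
    rw [smul_sub, ← map_smul, hun_smul]
    rfl
  set r' : ℕ → ℕ → Y := fun k n => Q k (un k n) with hr'
  set w : ℕ → Y := fun k => Q (k + 1) (θ k) with hw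
  have hQρ : ∀ k n, Q k (ρ k n) = ‖ρ k n‖ • r' k n := fun k n => by
    rw [hr', ← map_smul, hun_smul]
  have hQsucc : ∀ k n, Q (k + 1) (ρ (k + 1) n) = Q k (ρ k n) - ‖ρ k n‖ • w k := fun k n => by
    rw [hsucc, map_smul, map_sub, hQI, smul_sub, hQρ]
  have hexp : ∀ k n, Q 0 (x n) = Q 0 a + ∑ j ∈ Finset.range k, ‖ρ j n‖ • w j + Q k (ρ k n) := by
    intro k n
    induction k with
    | zero =>
      have : ρ 0 n = x n - a := rfl
      rw [this, map_sub]; simp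
    | succ k ih =>
      rw [ih, hQsucc, Finset.sum_range_succ]; abel
  have hr'lim : ∀ k, Tendsto (fun n => ‖r' k n - w k‖) 𝒰 (𝓝 0) := by
    intro k
    have h1 := ((Q (k + 1)).continuous.tendsto _).comp (hlim k)
    have h2 : (⇑(Q (k + 1)) ∘ fun n => I k (un k n)) = r' k := by
      ext n; simp [hQI, hr']
    rw [h2] at h1
    exact tendsto_iff_norm_sub_tendsto_zero.1 h1
  have hratio : ∀ k, Tendsto (fun n => ‖ρ (k + 1) n‖ / ‖ρ k n‖) 𝒰 (𝓝 0) := by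
    intro k
    refine squeeze_zero (fun n => by positivity) (fun n => ?_)
      (tendsto_iff_norm_sub_tendsto_zero.1 (hlim k))
    rw [hsucc, norm_smul, norm_norm]
    by_cases h : ‖ρ k n‖ = 0
    · simp [h]
    · rw [mul_div_cancel_left₀ _ h]
  -- the length of the expansion
  obtain ⟨K, hK1, hK2⟩ : ∃ K : ℕ∞, (∀ k : ℕ, (k : ℕ∞) < K → ∀ᶠ n in 𝒰, ρ k n ≠ 0) ∧
      ∀ k : ℕ, (k : ℕ∞) = K → ∀ᶠ n in 𝒰, ρ k n = 0 := by
    by_cases h : ∃ k, ∀ᶠ n in 𝒰, ρ k n = 0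
    · refine ⟨(Nat.find h : ℕ), fun k hk => ?_, fun k hk => ?_⟩
      · exact Ultrafilter.eventually_not.2 (Nat.find_min h (by exact_mod_cast hk))
      · have : k = Nat.find h := by exact_mod_cast hk
        rw [this]; exact Nat.find_spec h
    · refine ⟨⊤, fun k _ => ?_, fun k hk => absurd hk (ENat.natCast_ne_top _)⟩
      exact Ultrafilter.eventually_not.2 fun h' => h ⟨k, h'⟩
  set M := K.toNat with hM
  have hMK : ∀ k : ℕ, ∀ n, K ≠ ⊤ → (k : ℕ∞) ≤ K → k ≤ n + M := by
    intro k n hKt hk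
    rw [← ENat.natCast_toNat hKt] at hk
    have : k ≤ M := by exact_mod_cast hk
    omega
  have hev : ∀ l : ℕ, ∃ᶠ n in atTop, (∀ k ≤ l + M, (k : ℕ∞) < K → ρ k n ≠ 0) ∧
      (∀ k ≤ l + M, (k : ℕ∞) = K → ρ k n = 0) ∧
      (∀ k ≤ l + M, ‖ρ (k + 1) n‖ / ‖ρ k n‖ < 1 / ((l : ℝ) + 1)) ∧
      ∀ k ≤ l + M, ‖r' k n - w k‖ < 1 / ((l : ℝ) + 1) := by
    intro l
    refine Frequently.filter_mono (f := (𝒰 : Filter ℕ)) (Eventually.frequently ?_) h𝒰top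
    have hl : (0 : ℝ) < 1 / ((l : ℝ) + 1) := by positivity
    refine Eventually.and ?_ (Eventually.and ?_ (Eventually.and ?_ ?_))
    · refine (Set.finite_Iic (l + M)).eventually_all.2 fun k _ => ?_
      by_cases hk : (k : ℕ∞) < K
      · exact (hK1 k hk).mono fun n hn _ => hn
      · exact Eventually.of_forall fun n h => absurd h hk
    · refine (Set.finite_Iic (l + M)).eventually_all.2 fun k _ => ?_
      by_cases hk : (k : ℕ∞) = K
      · exact (hK2 k hk).mono fun n hn _ => hn
      · exact Eventually.of_forall fun n h => absurd h hk
    · exact (Set.finite_Iic (l + M)).eventually_all.2 fun k _ => (hratio k).eventually_lt_const hl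
    · exact (Set.finite_Iic (l + M)).eventually_all.2 fun k _ => (hr'lim k).eventually_lt_const hl
  obtain ⟨s, hs, hP⟩ := extraction_forall_of_frequently hev
  set Γ : ℕ → ℕ → ℝ := fun k n => if k ≤ n + M then ‖ρ k (s n)‖ else 1 with hΓ
  have hΓeq : ∀ k n, k ≤ n + M → Γ k n = ‖ρ k (s n)‖ := fun k n h => if_pos h
  have hΓpos : ∀ k : ℕ, (k : ℕ∞) < K → ∀ n, 0 < Γ k n := by
    intro k hk n
    by_cases h : k ≤ n + M
    · rw [hΓeq k n h]; exact norm_pos_iff.2 ((hP n).1 k h hk)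
    · simp [hΓ, h]
  set r : ℕ → ℕ → Y := fun k n =>
    (Γ k n)⁻¹ • (Q 0 (x (s n)) - Q 0 a - ∑ j ∈ Finset.range k, Γ j n • w j) with hr
  have hreq : ∀ k n : ℕ, (k : ℕ∞) < K → k ≤ n + M → r k n = r' k (s n) := by
    intro k n hk h
    have h1 : ∑ j ∈ Finset.range k, Γ j n • w j
        = ∑ j ∈ Finset.range k, ‖ρ j (s n)‖ • w j := by
      refine Finset.sum_congr rfl fun j hj => ?_
      rw [hΓeq j n (by have := Finset.mem_range.1 hj; omega)]
    have h2 : ‖ρ k (s n)‖ ≠ 0 := norm_ne_zero_iff.2 ((hP n).1 k h hk)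
    simp only [hr]
    rw [h1, hΓeq k n h, hexp k (s n), hQρ]
    rw [show ∀ p q t : Y, p + q + t - p - q = t from fun p q t => by abel, smul_smul,
      inv_mul_cancel₀ h2, one_smul]
  have hsmall : ∀ u : ℕ → ℝ, (∀ n, 0 ≤ u n) → (∃ k : ℕ, ∀ n ≥ k, u n < 1 / ((n : ℝ) + 1)) →
      Tendsto u atTop (𝓝 0) := by
    rintro u hu ⟨k, hk⟩
    refine squeeze_zero' (Eventually.of_forall hu) ?_ tendsto_one_div_add_atTop_nhds_zero_nat
    filter_upwards [eventually_ge_atTop k] with n hn using (hk n hn).le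
  refine ⟨s, hs, K, Γ, w, r, ?_, hΓpos, ?_, ?_, ?_, ?_, ?_⟩
  · intro hK0 n
    have h0 := (hP n).2.1 0 (Nat.zero_le _) (by rw [hK0]; rfl)
    have : x (s n) - a = 0 := h0
    rw [sub_eq_zero.1 this]
  · intro _
    have h1 : Tendsto (fun n => ‖x (s n) - a‖) atTop (𝓝 0) :=
      (tendsto_iff_norm_sub_tendsto_zero.1 hx).comp hs.tendsto_atTop
    exact h1.congr fun n => (hΓeq 0 n (Nat.zero_le _)).symm
  · intro k hk
    refine hsmall _ (fun n => ?_) ⟨k + 1, fun n hn => ?_⟩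
    · exact div_nonneg (hΓpos _ hk n).le
        (hΓpos k (lt_of_le_of_lt (by exact_mod_cast Nat.le_succ k) hk) n).le
    · rw [hΓeq k n (by omega), hΓeq (k + 1) n (by omega)]
      exact (hP n).2.2.1 k (by omega)
  · intro k hk
    refine tendsto_iff_norm_sub_tendsto_zero.2
      (hsmall _ (fun n => norm_nonneg _) ⟨k, fun n hn => ?_⟩)
    rw [hreq k n hk (by omega)]
    exact (hP n).2.2.2 k (by omega)
  · intro k hk n
    simp only [hr]
    rw [smul_smul, mul_inv_cancel₀ (hΓpos k hk n).ne', one_smul]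
    abel
  · intro k hk
    have hKt : K ≠ ⊤ := by rw [← hk]; exact ENat.natCast_ne_top _
    have hkK : (k : ℕ∞) < K := by rw [← hk]; exact_mod_cast Nat.lt_succ_self k
    have hkM : ∀ n, k ≤ n + M := fun n => hMK k n hKt hkK.le
    have hkM' : ∀ n, k + 1 ≤ n + M := fun n => hMK (k + 1) n hKt hk.le
    have hrw : ∀ n, r' k (s n) = w k := by
      intro n
      have h0 := (hP n).2.1 (k + 1) (hkM' n) hk
      have h1 := hQsucc k (s n)
      rw [h0, map_zero, hQρ, ← smul_sub] at h1
      have h2 : ‖ρ k (s n)‖ ≠ 0 := norm_ne_zero_iff.2 ((hP n).1 k (hkM n) hkK)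
      exact sub_eq_zero.1 ((smul_eq_zero.1 h1.symm).resolve_left h2)
    refine ⟨fun h0 => ?_, fun n => by rw [hreq k n hkK (hkM n), hrw]⟩
    have h1 := hQρ k (s 0)
    rw [hrw, h0, smul_zero] at h1
    exact (hP 0).1 k (hkM 0) hkK (hQ k (by rw [h1, map_zero]))

end Tower

end

section

/-! ### The Fourier transform on a bounded interval -/

section Plancherel

variable {Y : Type*} [NormedAddCommGroup Y] [NormedSpace ℝ Y]

/-- Real part of the Fourier transform. -/
def cosT (T : ℝ) (g : ℝ → Y) (τ : ℝ) : Y := ∫ t, Real.cos (2 * Real.pi * τ * t) • g t ∂timeMeasure T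

/-- Imaginary part of the Fourier transform. -/
def sinT (T : ℝ) (g : ℝ → Y) (τ : ℝ) : Y := ∫ t, Real.sin (2 * Real.pi * τ * t) • g t ∂timeMeasure T

theorem lintegral_eq_lintegral_tsum_add_zsmul {p : ℝ} (hp : 0 < p) (g : ℝ → ENNReal)
    (hg : Measurable g) : ∫⁻ x, g x = ∫⁻ x in Ioc 0 p, ∑' n : ℤ, g (x + n * p) := by
  have hm : ∀ n : ℤ, AEMeasurable (fun x => g (x + n * p)) (volume.restrict (Ioc 0 p)) :=
    fun n => (hg.comp (measurable_id.add_const _)).aemeasurable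
  rw [lintegral_tsum hm, ← setLIntegral_univ, ← iUnion_Ioc_add_zsmul hp 0,
    lintegral_iUnion (fun _ => measurableSet_Ioc) (pairwise_disjoint_Ioc_add_zsmul 0 p)]
  congr 1
  ext n
  have h := (measurePreserving_add_right (volume : Measure ℝ) ((n : ℝ) * p)).setLIntegral_comp_preimage
    (s := Ioc (0 + n • p) (0 + (n + 1) • p)) measurableSet_Ioc hg
  rw [← h]
  congr 2
  ext x
  simp only [zsmul_eq_mul, mem_preimage, mem_Ioc]
  push_cast
  constructor <;> rintro ⟨h1, h2⟩ <;> constructor <;> nlinarith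

theorem memLp_complex_exp_mul {T : ℝ} {c : ℝ → ℝ} (hc : MemLp c 2 (timeMeasure T)) (θ : ℝ) :
    MemLp (fun t : ℝ => Complex.exp (2 * Real.pi * θ * t * Complex.I) * (c t : ℂ)) 2
      (timeMeasure T) := by
  refine MemLp.of_le (hc.ofReal (K := ℂ)) ?_ (ae_of_all _ fun t => ?_)
  · exact (Continuous.aestronglyMeasurable (by fun_prop)).mul
      (hc.ofReal (K := ℂ)).aestronglyMeasurable
  · rw [norm_mul, show (2 * (Real.pi : ℂ) * θ * t * Complex.I)
      = ((2 * Real.pi * θ * t : ℝ) : ℂ) * Complex.I by push_cast; ring,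
      Complex.norm_exp_ofReal_mul_I, one_mul]
    rfl

theorem norm_integral_exp_sq {T : ℝ} {c : ℝ → ℝ} (hc : MemLp c 2 (timeMeasure T)) (θ : ℝ) :
    ‖∫ t, Complex.exp (2 * Real.pi * θ * t * Complex.I) * (c t : ℂ) ∂timeMeasure T‖ ^ 2
      = cosT T c θ ^ 2 + sinT T c θ ^ 2 := by
  have hi : Integrable c (timeMeasure T) := hc.integrable (by norm_num)
  have h1 : Integrable (fun t => Real.cos (2 * Real.pi * θ * t) • c t) (timeMeasure T) :=
    hi.bdd_smul 1 (Continuous.aestronglyMeasurable (f := fun t : ℝ =>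
      Real.cos (2 * Real.pi * θ * t)) (by fun_prop)) (ae_of_all _ fun t => Real.abs_cos_le_one _)
  have h2 : Integrable (fun t => Real.sin (2 * Real.pi * θ * t) • c t) (timeMeasure T) :=
    hi.bdd_smul 1 (Continuous.aestronglyMeasurable (f := fun t : ℝ =>
      Real.sin (2 * Real.pi * θ * t)) (by fun_prop)) (ae_of_all _ fun t => Real.abs_sin_le_one _)
  have key : ∫ t, Complex.exp (2 * Real.pi * θ * t * Complex.I) * (c t : ℂ) ∂timeMeasure T
      = ((cosT T c θ : ℝ) : ℂ) + ((sinT T c θ : ℝ) : ℂ) * Complex.I := by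
    unfold cosT sinT
    rw [← integral_complex_ofReal, ← integral_complex_ofReal, ← integral_mul_const, ← integral_add h1.ofReal
      (h2.ofReal.mul_const _)]
    refine integral_congr_ae (ae_of_all _ fun t => ?_)
    simp only [smul_eq_mul]
    rw [show (2 * (Real.pi : ℂ) * θ * t * Complex.I)
      = ((2 * Real.pi * θ * t : ℝ) : ℂ) * Complex.I by push_cast; ring, Complex.exp_mul_I,
      ← Complex.ofReal_cos, ← Complex.ofReal_sin]
    simp
    ring
  rw [key, ← Complex.normSq_eq_norm_sq, Complex.normSq_add_mul_I]

theorem hasSum_fourier_sq {T : ℝ} (hT : 0 < T) {c : ℝ → ℝ} (hc : MemLp c 2 (timeMeasure T))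
    (θ : ℝ) :
    HasSum (fun n : ℤ => cosT T c (θ + n * T⁻¹) ^ 2 + sinT T c (θ + n * T⁻¹) ^ 2)
      (T * ∫ t, c t ^ 2 ∂timeMeasure T) := by
  set f : ℝ → ℂ := fun t => Complex.exp (2 * Real.pi * θ * t * Complex.I) * (c t : ℂ) with hf
  have hfm : MemLp f 2 (volume.restrict (Ioc 0 T)) := by
    rw [Measure.restrict_congr_set Ioc_ae_eq_Icc]; exact memLp_complex_exp_mul hc θ
  have h := (hasSum_sq_fourierCoeffOn hT hfm)
  have h2 := ((Equiv.neg ℤ).hasSum_iff.2 h).mul_left (T ^ 2)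
  have hval : T ^ 2 * ((T - 0)⁻¹ • ∫ x in (0 : ℝ)..T, ‖f x‖ ^ 2)
      = T * ∫ t, c t ^ 2 ∂timeMeasure T := by
    rw [intervalIntegral.integral_of_le hT.le, ← integral_Icc_eq_integral_Ioc]
    have : ∀ t, ‖f t‖ ^ 2 = c t ^ 2 := fun t => by
      rw [hf]
      dsimp only
      rw [norm_mul, show (2 * (Real.pi : ℂ) * θ * t * Complex.I)
        = ((2 * Real.pi * θ * t : ℝ) : ℂ) * Complex.I by push_cast; ring,
        Complex.norm_exp_ofReal_mul_I, one_mul, Complex.norm_real, Real.norm_eq_abs, sq_abs]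
    simp only [this, sub_zero, smul_eq_mul]
    field_simp
  rw [hval] at h2
  have e : (fun n : ℤ => cosT T c (θ + n * T⁻¹) ^ 2 + sinT T c (θ + n * T⁻¹) ^ 2)
      = fun n => T ^ 2 * ((fun i => ‖fourierCoeffOn hT f i‖ ^ 2) ∘ ⇑(Equiv.neg ℤ)) n := by
    ext n
    rw [← norm_integral_exp_sq hc, Function.comp_apply, Equiv.neg_apply,
      fourierCoeffOn_eq_integral, neg_neg, intervalIntegral.integral_of_le hT.le,
      ← integral_Icc_eq_integral_Ioc, norm_smul, mul_pow, ← mul_assoc]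
    have h1 : T ^ 2 * ‖1 / (T - 0)‖ ^ 2 = 1 := by
      rw [sub_zero, norm_div, norm_one, Real.norm_of_nonneg hT.le]
      field_simp
    rw [h1, one_mul]
    congr 2
    refine integral_congr_ae (ae_of_all _ fun t => ?_)
    simp only [hf, smul_eq_mul]
    rw [fourier_coe_apply, ← mul_assoc, ← Complex.exp_add]
    congr 2
    push_cast
    have : (T : ℂ) ≠ 0 := by exact_mod_cast hT.ne'
    field_simp
    ring
  rw [e]
  exact h2

/-- A bound of the integral over `[0, T]` by the `L²` norm. -/
theorem integral_norm_le_sqrt_mul {Y : Type*} [NormedAddCommGroup Y] {T : ℝ} (hT : 0 < T) (g : TimeL2 T Y) :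
    ∫ t, ‖g t‖ ∂timeMeasure T ≤ √T * ‖g‖ := by
  have h := eLpNorm_le_eLpNorm_mul_rpow_measure_univ (p := 1) (q := 2) (μ := timeMeasure T)
    (by norm_num) (Lp.aestronglyMeasurable g)
  rw [Measure.restrict_apply_univ, Real.volume_Icc, sub_zero] at h
  have h1 : ∫ t, ‖g t‖ ∂timeMeasure T = (eLpNorm g 1 (timeMeasure T)).toReal := by
    rw [integral_norm_eq_lintegral_enorm (Lp.aestronglyMeasurable g), eLpNorm_one_eq_lintegral_enorm]
  rw [h1, Lp.norm_def, mul_comm]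
  refine (ENNReal.toReal_mono ?_ h).trans_eq ?_
  · exact ENNReal.mul_ne_top (Lp.eLpNorm_ne_top g)
      (ENNReal.rpow_ne_top_of_nonneg (by norm_num) ENNReal.ofReal_ne_top)
  · rw [ENNReal.toReal_mul, ← ENNReal.toReal_rpow, ENNReal.toReal_ofReal hT.le, Real.sqrt_eq_rpow]
    norm_num

theorem norm_integral_smul_le {T : ℝ} (hT : 0 < T) (g : TimeL2 T Y) (k : ℝ → ℝ) {M : ℝ}
    (hM : ∀ t ∈ Icc 0 T, |k t| ≤ M) :
    ‖∫ t, k t • g t ∂timeMeasure T‖ ≤ M * (√T * ‖g‖) := by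
  have hM0 : 0 ≤ M := (abs_nonneg _).trans (hM 0 ⟨le_rfl, hT.le⟩)
  have hi : Integrable g (timeMeasure T) := (Lp.memLp g).integrable (by norm_num)
  refine (norm_integral_le_of_norm_le (g := fun t => M * ‖g t‖) (hi.norm.const_mul M) ?_).trans ?_
  · filter_upwards [ae_restrict_mem measurableSet_Icc] with t ht
    rw [norm_smul]
    exact mul_le_mul_of_nonneg_right (hM t ht) (norm_nonneg _)
  · rw [integral_const_mul]
    exact mul_le_mul_of_nonneg_left (integral_norm_le_sqrt_mul hT g) hM0

theorem norm_cosT_le {T : ℝ} (hT : 0 < T) (g : TimeL2 T Y) (τ : ℝ) :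
    ‖cosT T g τ‖ ≤ √T * ‖g‖ := by
  simpa [cosT] using norm_integral_smul_le hT g _ (fun t _ => Real.abs_cos_le_one (2 * Real.pi * τ * t))

theorem norm_sinT_le {T : ℝ} (hT : 0 < T) (g : TimeL2 T Y) (τ : ℝ) :
    ‖sinT T g τ‖ ≤ √T * ‖g‖ := by
  simpa [sinT] using norm_integral_smul_le hT g _ (fun t _ => Real.abs_sin_le_one (2 * Real.pi * τ * t))

theorem integrable_cos_smul {T : ℝ} {g : ℝ → Y} (hg : Integrable g (timeMeasure T)) (τ : ℝ) :
    Integrable (fun t => Real.cos (2 * Real.pi * τ * t) • g t) (timeMeasure T) :=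
  hg.bdd_smul 1 (Continuous.aestronglyMeasurable (f := fun t : ℝ =>
      Real.cos (2 * Real.pi * τ * t)) (by fun_prop)) (ae_of_all _ fun t => Real.abs_cos_le_one _)

theorem integrable_sin_smul {T : ℝ} {g : ℝ → Y} (hg : Integrable g (timeMeasure T)) (τ : ℝ) :
    Integrable (fun t => Real.sin (2 * Real.pi * τ * t) • g t) (timeMeasure T) :=
  hg.bdd_smul 1 (Continuous.aestronglyMeasurable (f := fun t : ℝ =>
      Real.sin (2 * Real.pi * τ * t)) (by fun_prop)) (ae_of_all _ fun t => Real.abs_sin_le_one _)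

theorem abs_phase_sub_le {T : ℝ} (τ τ' : ℝ) {t : ℝ} (ht : t ∈ Icc 0 T) :
    |2 * Real.pi * τ * t - 2 * Real.pi * τ' * t| ≤ 2 * Real.pi * T * |τ - τ'| := by
  rw [← sub_mul, ← mul_sub, abs_mul, abs_mul, abs_of_pos Real.two_pi_pos, abs_of_nonneg ht.1,
    mul_right_comm]
  exact mul_le_mul_of_nonneg_right
    (mul_le_mul_of_nonneg_left ht.2 Real.two_pi_pos.le) (abs_nonneg _)

theorem norm_cosT_sub_le {T : ℝ} (hT : 0 < T) (g : TimeL2 T Y) (τ τ' : ℝ) :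
    ‖cosT T g τ - cosT T g τ'‖ ≤ 2 * Real.pi * T * |τ - τ'| * (√T * ‖g‖) := by
  have hi : Integrable g (timeMeasure T) := (Lp.memLp g).integrable (by norm_num)
  rw [cosT, cosT, ← integral_sub (integrable_cos_smul hi τ) (integrable_cos_smul hi τ')]
  simp_rw [← sub_smul]
  refine norm_integral_smul_le hT g _ fun t ht => ?_
  exact (Real.abs_cos_sub_cos_le _ _).trans (abs_phase_sub_le τ τ' ht)

theorem norm_sinT_sub_le {T : ℝ} (hT : 0 < T) (g : TimeL2 T Y) (τ τ' : ℝ) :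
    ‖sinT T g τ - sinT T g τ'‖ ≤ 2 * Real.pi * T * |τ - τ'| * (√T * ‖g‖) := by
  have hi : Integrable g (timeMeasure T) := (Lp.memLp g).integrable (by norm_num)
  rw [sinT, sinT, ← integral_sub (integrable_sin_smul hi τ) (integrable_sin_smul hi τ')]
  simp_rw [← sub_smul]
  refine norm_integral_smul_le hT g _ fun t ht => ?_
  exact (Real.abs_sin_sub_sin_le _ _).trans (abs_phase_sub_le τ τ' ht)

theorem continuous_of_norm_sub_le {Y : Type*} [NormedAddCommGroup Y] {F : ℝ → Y} {C : ℝ}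
    (h : ∀ τ τ', ‖F τ - F τ'‖ ≤ C * |τ - τ'|) : Continuous F :=
  (LipschitzWith.of_dist_le_mul (K := C.toNNReal) fun τ τ' => by
    rw [dist_eq_norm, Real.dist_eq]
    exact (h τ τ').trans (mul_le_mul_of_nonneg_right (Real.le_coe_toNNReal C)
      (abs_nonneg _))).continuous

theorem continuous_cosT {T : ℝ} (hT : 0 < T) (g : TimeL2 T Y) : Continuous (cosT T g) :=
  continuous_of_norm_sub_le (C := 2 * Real.pi * T * (√T * ‖g‖)) fun τ τ' =>
    (norm_cosT_sub_le hT g τ τ').trans_eq (by ring)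

theorem continuous_sinT {T : ℝ} (hT : 0 < T) (g : TimeL2 T Y) : Continuous (sinT T g) :=
  continuous_of_norm_sub_le (C := 2 * Real.pi * T * (√T * ‖g‖)) fun τ τ' =>
    (norm_sinT_sub_le hT g τ τ').trans_eq (by ring)

theorem cosT_congr {T : ℝ} {g h : ℝ → Y} (hgh : g =ᵐ[timeMeasure T] h) : cosT T g = cosT T h := by
  ext τ
  exact integral_congr_ae (hgh.mono fun t ht => by simp only [ht])

theorem sinT_congr {T : ℝ} {g h : ℝ → Y} (hgh : g =ᵐ[timeMeasure T] h) : sinT T g = sinT T h := by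
  ext τ
  exact integral_congr_ae (hgh.mono fun t ht => by simp only [ht])

/-- **Plancherel's identity** for a real function on a bounded interval. -/
theorem lintegral_fourier_sq {T : ℝ} (hT : 0 < T) {c : ℝ → ℝ} (hc : MemLp c 2 (timeMeasure T)) :
    ∫⁻ τ, ENNReal.ofReal (cosT T c τ ^ 2 + sinT T c τ ^ 2)
      = ENNReal.ofReal (∫ t, c t ^ 2 ∂timeMeasure T) := by
  have e1 : cosT T c = cosT T (hc.toLp c) := cosT_congr hc.coeFn_toLp.symm
  have e2 : sinT T c = sinT T (hc.toLp c) := sinT_congr hc.coeFn_toLp.symm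
  have hcont : Continuous fun τ => cosT T c τ ^ 2 + sinT T c τ ^ 2 := by
    rw [e1, e2]
    exact ((continuous_cosT hT _).pow 2).add ((continuous_sinT hT _).pow 2)
  rw [lintegral_eq_lintegral_tsum_add_zsmul (inv_pos.2 hT)
    (fun τ => ENNReal.ofReal (cosT T c τ ^ 2 + sinT T c τ ^ 2))
    (ENNReal.measurable_ofReal.comp hcont.measurable)]
  have h : ∀ θ, ∑' n : ℤ, ENNReal.ofReal
      (cosT T c (θ + n * T⁻¹) ^ 2 + sinT T c (θ + n * T⁻¹) ^ 2)
      = ENNReal.ofReal (T * ∫ t, c t ^ 2 ∂timeMeasure T) := fun θ => by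
    rw [← (hasSum_fourier_sq hT hc θ).tsum_eq]
    exact (ENNReal.ofReal_tsum_of_nonneg (fun n => by positivity)
      (hasSum_fourier_sq hT hc θ).summable).symm
  simp_rw [h]
  rw [setLIntegral_const, Real.volume_Ioc, sub_zero, ← ENNReal.ofReal_mul (by positivity)]
  congr 1
  field_simp

end Plancherel

end

section

/-! ### Precompact forms -/

section PrecompactForm

variable {E F : Type*} [NormedAddCommGroup E] [NormedSpace ℝ E]
  [NormedAddCommGroup F] [NormedSpace ℝ F]

/-- A nonnegative form `q` (the square of a seminorm) for which the unit ball is precompact. -/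
def PrecompactForm (q : E → ℝ) : Prop :=
  ∀ 𝒰 : Ultrafilter E, Metric.closedBall (0 : E) 1 ∈ 𝒰 →
    Tendsto (fun x : E × E => q (x.1 - x.2)) ((𝒰 : Filter E) ×ˢ (𝒰 : Filter E)) (𝓝 0)

theorem eventually_norm_sub_le {𝒰 : Ultrafilter E} (h : Metric.closedBall (0 : E) 1 ∈ 𝒰) :
    ∀ᶠ x : E × E in (𝒰 : Filter E) ×ˢ (𝒰 : Filter E), ‖x.1 - x.2‖ ≤ 2 := by
  filter_upwards [prod_mem_prod h h] with x hx
  have h1 : ‖x.1‖ ≤ 1 := by simpa using hx.1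
  have h2 : ‖x.2‖ ≤ 1 := by simpa using hx.2
  linarith [norm_sub_le x.1 x.2]

theorem tendsto_functional_sub (ℓ : StrongDual ℝ E) {𝒰 : Ultrafilter E}
    (h : Metric.closedBall (0 : E) 1 ∈ 𝒰) :
    Tendsto (fun x : E × E => ℓ (x.1 - x.2)) ((𝒰 : Filter E) ×ˢ (𝒰 : Filter E)) (𝓝 0) := by
  obtain ⟨a, -, ha⟩ := (isCompact_closedBall (0 : ℝ) ‖ℓ‖).ultrafilter_le_nhds (𝒰.map ℓ) (by
    rw [Filter.le_principal_iff]
    refine Filter.mem_map.2 (Filter.mem_of_superset h fun x hx => ?_)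
    have hx1 : ‖x‖ ≤ 1 := by simpa using hx
    simpa using (ℓ.le_opNorm x).trans (mul_le_of_le_one_right (norm_nonneg _) hx1))
  have ha' : Tendsto ℓ 𝒰 (𝓝 a) := ha
  simpa using (ha'.comp tendsto_fst).sub (ha'.comp tendsto_snd)

theorem PrecompactForm.functional_sq (ℓ : StrongDual ℝ E) :
    PrecompactForm fun x => ℓ x ^ 2 := fun 𝒰 h => by
  simpa using (tendsto_functional_sub ℓ h).pow 2

theorem PrecompactForm.add {q₁ q₂ : E → ℝ} (h₁ : PrecompactForm q₁) (h₂ : PrecompactForm q₂) :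
    PrecompactForm fun x => q₁ x + q₂ x := fun 𝒰 h => by
  simpa using (h₁ 𝒰 h).add (h₂ 𝒰 h)

theorem PrecompactForm.const_mul {q : E → ℝ} (h : PrecompactForm q) (c : ℝ) :
    PrecompactForm fun x => c * q x := fun 𝒰 h𝒰 => by
  simpa using (h 𝒰 h𝒰).const_mul c

theorem PrecompactForm.sum {ι : Type*} (s : Finset ι) {q : ι → E → ℝ}
    (h : ∀ i ∈ s, PrecompactForm (q i)) : PrecompactForm fun x => ∑ i ∈ s, q i x := fun 𝒰 h𝒰 => by
  simpa using tendsto_finsetSum s fun i hi => h i hi 𝒰 h𝒰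

theorem PrecompactForm.of_forall_le {q : E → ℝ} (h0 : ∀ x, 0 ≤ q x)
    (h : ∀ ε > 0, ∃ q' : E → ℝ, PrecompactForm q' ∧ ∀ x, q x ≤ ε * ‖x‖ ^ 2 + q' x) :
    PrecompactForm q := by
  intro 𝒰 h𝒰
  rw [Metric.tendsto_nhds]
  intro ε hε
  obtain ⟨q', hq', hle⟩ := h (ε / 8) (by positivity)
  filter_upwards [(hq' 𝒰 h𝒰).eventually_lt_const (show (0 : ℝ) < ε / 2 by positivity),
    eventually_norm_sub_le h𝒰] with x hx hx2
  rw [Real.dist_eq, sub_zero, abs_of_nonneg (h0 _)]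
  have h1 := hle (x.1 - x.2)
  have h2 : ‖x.1 - x.2‖ ^ 2 ≤ 2 ^ 2 := pow_le_pow_left₀ (norm_nonneg _) hx2 2
  nlinarith

theorem PrecompactForm.of_le {q q' : E → ℝ} (h : PrecompactForm q') (h0 : ∀ x, 0 ≤ q x)
    (hle : ∀ x, q x ≤ q' x) : PrecompactForm q :=
  .of_forall_le h0 fun ε hε => ⟨q', h, fun x => (hle x).trans
    (le_add_of_nonneg_left (by positivity))⟩

/-- A norm continuous family of functionals on a compact interval gives a precompact form. -/
theorem PrecompactForm.setIntegral_sq {ℓ : ℝ → StrongDual ℝ E} (hℓ : Continuous ℓ) (R : ℝ) :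
    PrecompactForm fun x => ∫ τ in Icc (-R) R, ℓ τ x ^ 2 := by
  intro 𝒰 h𝒰
  have key : ∀ ε > 0, ∀ᶠ x : E × E in (𝒰 : Filter E) ×ˢ (𝒰 : Filter E),
      ∀ τ ∈ Icc (-R) R, ‖ℓ τ (x.1 - x.2)‖ ≤ ε := by
    intro ε hε
    refine isCompact_Icc.induction_on (p := fun s => ∀ᶠ x : E × E in
      (𝒰 : Filter E) ×ˢ (𝒰 : Filter E), ∀ τ ∈ s, ‖ℓ τ (x.1 - x.2)‖ ≤ ε) ?_ ?_ ?_ ?_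
    · simp
    · exact fun s t hst h => h.mono fun x hx τ hτ => hx τ (hst hτ)
    · intro s t hs ht
      filter_upwards [hs, ht] with x h1 h2 τ hτ
      exact hτ.elim (h1 τ) (h2 τ)
    · intro τ₀ _
      refine ⟨{τ | ‖ℓ τ - ℓ τ₀‖ < ε / 4}, mem_nhdsWithin_of_mem_nhds ?_, ?_⟩
      · have : Continuous fun τ => ‖ℓ τ - ℓ τ₀‖ := by fun_prop
        exact this.continuousAt.eventually_lt continuousAt_const (by simpa using by positivity)
      · filter_upwards [eventually_norm_sub_le h𝒰,
          (tendsto_functional_sub (ℓ τ₀) h𝒰).norm.eventually_lt_const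
            (show ‖(0 : ℝ)‖ < ε / 2 by simpa using by positivity)] with x h1 h2 τ hτ
        have h3 := (ℓ τ - ℓ τ₀).le_opNorm (x.1 - x.2)
        have h4 : ‖ℓ τ - ℓ τ₀‖ * ‖x.1 - x.2‖ ≤ ε / 4 * 2 :=
          mul_le_mul (le_of_lt hτ) h1 (norm_nonneg _) (by positivity)
        have h5 : ℓ τ (x.1 - x.2) = (ℓ τ - ℓ τ₀) (x.1 - x.2) + ℓ τ₀ (x.1 - x.2) := by simp
        rw [h5]
        linarith [norm_add_le ((ℓ τ - ℓ τ₀) (x.1 - x.2)) (ℓ τ₀ (x.1 - x.2))]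
  rw [Metric.tendsto_nhds]
  intro ε hε
  obtain ⟨δ, hδ, hδε⟩ : ∃ δ > 0, δ ^ 2 * (volume.real (Icc (-R) R)) < ε := by
    have : Tendsto (fun δ : ℝ => δ ^ 2 * (volume.real (Icc (-R) R))) (𝓝[>] 0) (𝓝 0) := by
      have hc : Continuous fun δ : ℝ => δ ^ 2 * (volume.real (Icc (-R) R)) := by fun_prop
      have := hc.tendsto 0
      simp only [ne_eq, OfNat.ofNat_ne_zero, not_false_eq_true, zero_pow, zero_mul] at this
      exact this.mono_left nhdsWithin_le_nhds
    obtain ⟨δ, h1, h2⟩ := ((this.eventually_lt_const hε).and self_mem_nhdsWithin).exists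
    exact ⟨δ, h2, h1⟩
  filter_upwards [key δ hδ] with x hx
  rw [Real.dist_eq, sub_zero]
  refine lt_of_le_of_lt ?_ hδε
  have hbd : ∀ τ ∈ Icc (-R) R, ‖ℓ τ (x.1 - x.2) ^ 2‖ ≤ δ ^ 2 := fun τ hτ => by
    rw [norm_pow]
    exact pow_le_pow_left₀ (norm_nonneg _) (hx τ hτ) 2
  exact norm_setIntegral_le_of_norm_le_const (μ := volume) isCompact_Icc.measure_lt_top hbd

theorem PrecompactForm.isCompactOperator [CompleteSpace F] (I : E →L[ℝ] F)
    (h : PrecompactForm fun x => ‖I x‖ ^ 2) : IsCompactOperator I := by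
  have htb : TotallyBounded (I '' Metric.closedBall 0 1) := by
    rw [totallyBounded_iff_ultrafilter]
    intro 𝒱 h𝒱
    have hm : I '' Metric.closedBall 0 1 ∈ 𝒱 := Filter.le_principal_iff.1 h𝒱
    have hmap := Ultrafilter.ofComapInfPrincipal_eq_of_map hm
    have h1 := h _ (Ultrafilter.ofComapInfPrincipal_mem hm)
    rw [← hmap]
    refine ⟨inferInstance, ?_⟩
    rw [Ultrafilter.coe_map, prod_map_map_eq, Metric.uniformity_eq_comap_nhds_zero,
      ← tendsto_iff_comap]
    refine tendsto_map'_iff.2 ?_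
    have h2 := h1.sqrt
    rw [Real.sqrt_zero] at h2
    refine h2.congr fun x => ?_
    rw [Real.sqrt_sq (norm_nonneg _), map_sub, ← dist_eq_norm]
    rfl
  refine (isCompactOperator_iff_isCompact_closure_image_closedBall (I : E →ₗ[ℝ] F) one_pos).2 ?_
  exact htb.closure.isCompact_of_isClosed isClosed_closure

end PrecompactForm

end

section

/-! ### The scale of spaces `D(A^α)` -/

theorem memℓp_two_iff {f : ℕ → ℝ} : Memℓp f 2 ↔ Summable fun j => f j ^ 2 := by
  rw [memℓp_gen_iff (by norm_num)]
  simp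

namespace Spectral

variable {H : Type*} [NormedAddCommGroup H] [InnerProductSpace ℝ H] (b : Spectral H)

theorem completeSpace {H : Type*} [NormedAddCommGroup H] [InnerProductSpace ℝ H]
    (b : Spectral H) : CompleteSpace H :=
  (IsometryEquiv.completeSpace_iff b.basis.repr.toIsometryEquiv).2 inferInstance

theorem hasSum_repr_sq (u : H) : HasSum (fun j => b.basis.repr u j ^ 2) (‖u‖ ^ 2) := by
  have := lp.hasSum_norm (p := 2) (by norm_num) (b.basis.repr u)
  simpa using this

theorem hasSum_norm_sq {α : ℝ} (u : b.DPow α) :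
    HasSum (fun j => (b.lam j ^ α) ^ 2 * b.basis.repr u.1 j ^ 2) (‖u‖ ^ 2) := by
  have := b.hasSum_repr_sq (b.powA α u)
  simp_rw [b.repr_powA, mul_pow] at this
  exact this

theorem incl_apply {α : ℝ} (hα : 0 ≤ α) (u : b.DPow α) : b.incl hα u = u.1 := rfl

theorem incl_injective {α : ℝ} (hα : 0 ≤ α) : Function.Injective (b.incl hα) :=
  fun _ _ h => Subtype.ext h

theorem powA_surjective {α : ℝ} (hα : 0 ≤ α) : Function.Surjective (b.powA α) := by
  intro y
  have hpos : ∀ j, 0 < b.lam j ^ α := fun j => Real.rpow_pos_of_pos (b.lam_pos j) α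
  have hmem : Memℓp (fun j => (b.lam j ^ α)⁻¹ * b.basis.repr y j) 2 := by
    rw [memℓp_two_iff]
    refine Summable.of_nonneg_of_le (fun j => by positivity) (fun j => ?_)
      ((b.hasSum_repr_sq y).summable.mul_left (((b.lam 0 ^ α)⁻¹) ^ 2))
    rw [mul_pow]
    refine mul_le_mul_of_nonneg_right ?_ (sq_nonneg _)
    refine pow_le_pow_left₀ (by have := hpos j; positivity) ?_ 2
    exact inv_anti₀ (hpos 0)
      (Real.rpow_le_rpow (b.lam_pos 0).le (b.lam_mono (Nat.zero_le j)) hα)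
  set x : H := b.basis.repr.symm ⟨_, hmem⟩ with hx
  have hxr : ∀ j, b.basis.repr x j = (b.lam j ^ α)⁻¹ * b.basis.repr y j := fun j => by
    rw [hx, LinearIsometryEquiv.apply_symm_apply]
  have hxy : ∀ j, b.lam j ^ α * b.basis.repr x j = b.basis.repr y j := fun j => by
    rw [hxr, mul_inv_cancel_left₀ (hpos j).ne']
  have hxm : x ∈ b.domPow α := by
    change Memℓp _ 2
    simp_rw [hxy]
    exact lp.memℓp _
  refine ⟨⟨x, hxm⟩, b.basis.repr.injective ?_⟩
  ext j
  exact (b.repr_powA α ⟨x, hxm⟩ j).trans (hxy j)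

theorem completeSpace_DPow {α : ℝ} (hα : 0 ≤ α) : CompleteSpace (b.DPow α) := by
  have := b.completeSpace
  let e : b.DPow α ≃ₗᵢ[ℝ] H :=
    LinearIsometryEquiv.ofSurjective ⟨b.powA α, fun u => (b.norm_DPow α u).symm⟩
      (b.powA_surjective hα)
  exact e.toIsometryEquiv.completeSpace_iff.2 this

theorem lam_rpow_le {α β : ℝ} (h : α ≤ β) {J j : ℕ} (hJ : J ≤ j) :
    b.lam j ^ α ≤ b.lam J ^ (α - β) * b.lam j ^ β := by
  have h1 : b.lam j ^ α = b.lam j ^ (α - β) * b.lam j ^ β := by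
    rw [← Real.rpow_add (b.lam_pos j)]; congr 1; ring
  rw [h1]
  exact mul_le_mul_of_nonneg_right
    (Real.rpow_le_rpow_of_nonpos (b.lam_pos J) (b.lam_mono hJ) (by linarith))
    (Real.rpow_nonneg (b.lam_pos j).le _)

theorem sq_lam_rpow_mul_le {α β : ℝ} (h : α ≤ β) {J j : ℕ} (hJ : J ≤ j) (c : ℝ) :
    (b.lam j ^ α) ^ 2 * c ^ 2 ≤ (b.lam J ^ (α - β)) ^ 2 * ((b.lam j ^ β) ^ 2 * c ^ 2) := by
  rw [← mul_assoc, ← mul_pow (b.lam J ^ (α - β))]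
  exact mul_le_mul_of_nonneg_right
    (pow_le_pow_left₀ (Real.rpow_nonneg (b.lam_pos j).le _) (b.lam_rpow_le h hJ) 2) (sq_nonneg _)

theorem mem_domPow_iff {α : ℝ} {u : H} :
    u ∈ b.domPow α ↔ Summable fun j => (b.lam j ^ α) ^ 2 * b.basis.repr u j ^ 2 := by
  change Memℓp _ 2 ↔ _
  rw [memℓp_two_iff]
  simp_rw [mul_pow]

theorem domPow_mono {α β : ℝ} (h : α ≤ β) : b.domPow β ≤ b.domPow α := by
  intro u hu
  rw [mem_domPow_iff] at hu ⊢
  exact Summable.of_nonneg_of_le (fun j => by positivity)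
    (fun j => b.sq_lam_rpow_mul_le h (Nat.zero_le j) _) (hu.mul_left _)

theorem norm_mono_sq_le {α β : ℝ} (h : α ≤ β) (u : b.DPow β) (v : b.DPow α) (huv : v.1 = u.1) :
    ‖v‖ ^ 2 ≤ (b.lam 0 ^ (α - β)) ^ 2 * ‖u‖ ^ 2 := by
  have h1 := b.hasSum_norm_sq v
  rw [huv] at h1
  exact hasSum_le (fun j => b.sq_lam_rpow_mul_le h (Nat.zero_le j) _) h1
    ((b.hasSum_norm_sq u).mul_left _)

/-- An element of `D(A^α)`. -/
def DPow.mk {α : ℝ} (u : H) (hu : u ∈ b.domPow α) : b.DPow α := ⟨u, hu⟩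

theorem DPow.mk_congr {α : ℝ} {u v : H} (h : u = v) (hu : u ∈ b.domPow α)
    (hv : v ∈ b.domPow α) : DPow.mk b u hu = DPow.mk b v hv := by
  subst h; rfl

theorem DPow.mk_add {α : ℝ} (u v : H) (hu : u ∈ b.domPow α) (hv : v ∈ b.domPow α)
    (huv : u + v ∈ b.domPow α) : DPow.mk b (u + v) huv = DPow.mk b u hu + DPow.mk b v hv := rfl

theorem DPow.mk_smul {α : ℝ} (c : ℝ) (u : H) (hu : u ∈ b.domPow α) (hcu : c • u ∈ b.domPow α) :
    DPow.mk b (c • u) hcu = c • DPow.mk b u hu := rfl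

theorem DPow.coe_add {α : ℝ} (u v : b.DPow α) : (u + v).1 = u.1 + v.1 := rfl

theorem DPow.coe_smul {α : ℝ} (c : ℝ) (u : b.DPow α) : (c • u).1 = c • u.1 := rfl

/-- A linear map into `H` whose values are in `D(A^α)`, as a map into `D(A^α)`. -/
def liftₗ {α : ℝ} {E : Type*} [AddCommGroup E] [Module ℝ E] (L : E →ₗ[ℝ] H)
    (hL : ∀ x, L x ∈ b.domPow α) : E →ₗ[ℝ] b.DPow α where
  toFun x := DPow.mk b (L x) (hL x)
  map_add' x y := (DPow.mk_congr b (map_add L x y) _ (add_mem (hL x) (hL y))).trans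
    (DPow.mk_add b _ _ _ _ _)
  map_smul' c x := (DPow.mk_congr b (map_smul L c x) _ (Submodule.smul_mem _ c (hL x))).trans
    (DPow.mk_smul b _ _ _ _)

theorem coe_liftₗ {α : ℝ} {E : Type*} [AddCommGroup E] [Module ℝ E] (L : E →ₗ[ℝ] H)
    (hL : ∀ x, L x ∈ b.domPow α) (x : E) : (b.liftₗ L hL x).1 = L x := rfl

/-- The linear map underlying the embedding of `D(A^α)` into `H`. -/
def coeₗ (α : ℝ) : b.DPow α →ₗ[ℝ] H where
  toFun u := u.1
  map_add' := DPow.coe_add b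
  map_smul' := DPow.coe_smul b

theorem coeₗ_apply {α : ℝ} (u : b.DPow α) : b.coeₗ α u = u.1 := rfl

/-- The embedding of `D(A^β)` into `D(A^α)` for `α ≤ β`, as a linear map. -/
def inclPowₗ {α β : ℝ} (h : α ≤ β) : b.DPow β →ₗ[ℝ] b.DPow α :=
  b.liftₗ (b.coeₗ β) fun u => b.domPow_mono h u.2

theorem coe_inclPowₗ {α β : ℝ} (h : α ≤ β) (u : b.DPow β) : (b.inclPowₗ h u).1 = u.1 :=
  (b.coe_liftₗ (b.coeₗ β) (fun u => b.domPow_mono h u.2) u).trans (b.coeₗ_apply u)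

theorem norm_inclPowₗ_le {α β : ℝ} (h : α ≤ β) (u : b.DPow β) :
    ‖b.inclPowₗ h u‖ ≤ b.lam 0 ^ (α - β) * ‖u‖ := by
  refine abs_le_of_sq_le_sq' ?_ (mul_nonneg (Real.rpow_nonneg (b.lam_pos 0).le _)
    (norm_nonneg _)) |>.2
  rw [mul_pow]
  exact b.norm_mono_sq_le h u _ (b.coe_inclPowₗ h u)

/-- The embedding of `D(A^β)` into `D(A^α)` for `α ≤ β`. -/
def inclPow {α β : ℝ} (h : α ≤ β) : b.DPow β →L[ℝ] b.DPow α :=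
  (b.inclPowₗ h).mkContinuous _ (b.norm_inclPowₗ_le h)

theorem coe_inclPow {α β : ℝ} (h : α ≤ β) (u : b.DPow β) : (b.inclPow h u).1 = u.1 :=
  b.coe_inclPowₗ h u

theorem incl_inclPow {α β : ℝ} (hα : 0 ≤ α) (h : α ≤ β) (u : b.DPow β) :
    b.incl hα (b.inclPow h u) = b.incl (hα.trans h) u :=
  (b.incl_apply hα _).trans ((b.coe_inclPow h u).trans (b.incl_apply (hα.trans h) u).symm)

/-- Splitting of the norm of `D(A^α)` into low modes and a remainder that is controlled by the norm
of `D(A^β)`. -/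
theorem norm_inclPow_sq_le {α β : ℝ} (h : α ≤ β) (J : ℕ) (u : b.DPow β) :
    ‖b.inclPow h u‖ ^ 2 ≤ (b.lam J ^ (α - β)) ^ 2 * ‖u‖ ^ 2 +
      ∑ j ∈ Finset.range J, (b.lam j ^ α) ^ 2 * b.basis.repr u.1 j ^ 2 := by
  have h1 : HasSum (fun j => if j ∈ Finset.range J then
      (b.lam j ^ α) ^ 2 * b.basis.repr u.1 j ^ 2 else 0)
      (∑ j ∈ Finset.range J, (b.lam j ^ α) ^ 2 * b.basis.repr u.1 j ^ 2) := by
    have := hasSum_sum_of_ne_finset_zero (L := .unconditional ℕ)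
      (f := fun j => if j ∈ Finset.range J then
        (b.lam j ^ α) ^ 2 * b.basis.repr u.1 j ^ 2 else 0) (s := Finset.range J)
      (fun j hj => if_neg hj)
    rwa [Finset.sum_congr rfl fun j hj => if_pos hj] at this
  have h2 : HasSum (fun j => (b.lam j ^ α) ^ 2 * b.basis.repr u.1 j ^ 2) (‖b.inclPow h u‖ ^ 2) := by
    have := b.hasSum_norm_sq (b.inclPow h u)
    rwa [b.coe_inclPow h u] at this
  refine hasSum_le (fun j => ?_) h2
    (((b.hasSum_norm_sq u).mul_left ((b.lam J ^ (α - β)) ^ 2)).add h1)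
  by_cases hj : j ∈ Finset.range J
  · rw [if_pos hj]
    exact le_add_of_nonneg_left (by positivity)
  · rw [if_neg hj, add_zero]
    exact b.sq_lam_rpow_mul_le h (by simpa using hj) _

end Spectral

/-! ### Square integrable functions -/

section L2

variable {X Y : Type*} [MeasurableSpace X] {μ : Measure X} [NormedAddCommGroup Y]

theorem integrable_norm_sq (f : Lp Y 2 μ) : Integrable (fun x => ‖f x‖ ^ 2) μ :=
  (memLp_two_iff_integrable_sq_norm (Lp.aestronglyMeasurable f)).1 (Lp.memLp f)

theorem norm_sq_eq_integral (f : Lp Y 2 μ) : ‖f‖ ^ 2 = ∫ x, ‖f x‖ ^ 2 ∂μ := by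
  rw [Lp.norm_def, (Lp.memLp f).eLpNorm_eq_integral_rpow_norm (by norm_num) (by norm_num),
    ENNReal.toReal_ofReal (by positivity)]
  simp only [ENNReal.toReal_ofNat, Real.rpow_ofNat]
  rw [← one_div, ← Real.sqrt_eq_rpow, Real.sq_sqrt (by positivity)]

theorem ofReal_norm_sq_eq_lintegral (f : Lp Y 2 μ) :
    ENNReal.ofReal (‖f‖ ^ 2) = ∫⁻ x, ENNReal.ofReal (‖f x‖ ^ 2) ∂μ := by
  rw [norm_sq_eq_integral, ofReal_integral_eq_lintegral_ofReal (integrable_norm_sq f)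
    (ae_of_all _ fun x => by positivity)]

end L2

end

section

/-! ### The spaces `𝓗^γ` -/

section Fourier

variable {X Y : Type*} [NormedAddCommGroup X] [NormedSpace ℝ X]
  [NormedAddCommGroup Y] [InnerProductSpace ℝ Y] {T γ δ : ℝ}

/-- The Fourier transform of the extension by zero of a function on `[0, T]`. -/
def fhat (T : ℝ) (g : ℝ → Y) (τ : ℝ) : Cplx Y := WithLp.toLp 2 (cosT T g τ, sinT T g τ)

theorem norm_fhat_sq (g : ℝ → Y) (τ : ℝ) :
    ‖fhat T g τ‖ ^ 2 = ‖cosT T g τ‖ ^ 2 + ‖sinT T g τ‖ ^ 2 :=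
  WithLp.prod_norm_sq_eq_of_L2 _

theorem fhat_congr {g h : ℝ → Y} (hgh : g =ᵐ[timeMeasure T] h) : fhat T g = fhat T h := by
  ext τ : 1
  rw [fhat, fhat, cosT_congr hgh, sinT_congr hgh]

theorem timeFourier_eq_fhat (ι : X →L[ℝ] Y) (f : TimeL2 T X) :
    timeFourier ι f = fhat T (ι.compLp f) := by
  rw [fhat_congr (ι.coeFn_compLp f)]
  rfl

theorem norm_fhat_sq_le (hT : 0 < T) (g : TimeL2 T Y) (τ : ℝ) :
    ‖fhat T g τ‖ ^ 2 ≤ 2 * T * ‖g‖ ^ 2 := by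
  rw [norm_fhat_sq]
  have h1 := pow_le_pow_left₀ (norm_nonneg _) (norm_cosT_le hT g τ) 2
  have h2 := pow_le_pow_left₀ (norm_nonneg _) (norm_sinT_le hT g τ) 2
  rw [mul_pow, Real.sq_sqrt hT.le] at h1 h2
  linarith

theorem continuous_fhat (hT : 0 < T) (g : TimeL2 T Y) : Continuous (fhat T g) :=
  (WithLp.prod_continuous_toLp 2 Y Y).comp ((continuous_cosT hT g).prodMk (continuous_sinT hT g))

/-- The cosine transform at `τ` as a continuous linear map. -/
def cosL (hT : 0 < T) (τ : ℝ) : TimeL2 T Y →L[ℝ] Y :=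
  LinearMap.mkContinuous
    { toFun := fun g => cosT T g τ
      map_add' := fun g h => congrArg WithLp.fst (timeFourier_add (ContinuousLinearMap.id ℝ Y) g h τ)
      map_smul' := fun c g =>
        congrArg WithLp.fst (timeFourier_smul (ContinuousLinearMap.id ℝ Y) c g τ) }
    (√T) fun g => norm_cosT_le hT g τ

/-- The sine transform at `τ` as a continuous linear map. -/
def sinL (hT : 0 < T) (τ : ℝ) : TimeL2 T Y →L[ℝ] Y :=
  LinearMap.mkContinuous
    { toFun := fun g => sinT T g τ
      map_add' := fun g h => congrArg WithLp.snd (timeFourier_add (ContinuousLinearMap.id ℝ Y) g h τ)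
      map_smul' := fun c g =>
        congrArg WithLp.snd (timeFourier_smul (ContinuousLinearMap.id ℝ Y) c g τ) }
    (√T) fun g => norm_sinT_le hT g τ

theorem cosL_apply (hT : 0 < T) (τ : ℝ) (g : TimeL2 T Y) : cosL hT τ g = cosT T g τ := rfl

theorem sinL_apply (hT : 0 < T) (τ : ℝ) (g : TimeL2 T Y) : sinL hT τ g = sinT T g τ := rfl

theorem continuous_cosL (hT : 0 < T) : Continuous (cosL (Y := Y) hT) :=
  continuous_of_norm_sub_le (F := cosL (Y := Y) hT) (C := 2 * Real.pi * T * √T) fun τ τ' => by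
    refine ContinuousLinearMap.opNorm_le_bound _ (by have := Real.pi_pos; positivity) fun g => ?_
    have h := norm_cosT_sub_le hT g τ τ'
    rw [sub_apply, cosL_apply, cosL_apply]
    linarith

theorem continuous_sinL (hT : 0 < T) : Continuous (sinL (Y := Y) hT) :=
  continuous_of_norm_sub_le (F := sinL (Y := Y) hT) (C := 2 * Real.pi * T * √T) fun τ τ' => by
    refine ContinuousLinearMap.opNorm_le_bound _ (by have := Real.pi_pos; positivity) fun g => ?_
    have h := norm_sinT_sub_le hT g τ τ'
    rw [sub_apply, sinL_apply, sinL_apply]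
    linarith

theorem tendsto_fhat (hT : 0 < T) {g : ℕ → TimeL2 T Y} {g₀ : TimeL2 T Y}
    (hg : Tendsto g atTop (𝓝 g₀)) (τ : ℝ) :
    Tendsto (fun n => fhat T (g n) τ) atTop (𝓝 (fhat T g₀ τ)) :=
  ((WithLp.prod_continuous_toLp 2 Y Y).tendsto _).comp
    ((((cosL hT τ).continuous.tendsto g₀).comp hg).prodMk_nhds
      (((sinL hT τ).continuous.tendsto g₀).comp hg))

/-- The square of the seminorm of `𝓗^γ`. -/
def fourierWeight (T γ : ℝ) (g : ℝ → Y) : ENNReal :=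
  ∫⁻ τ, ENNReal.ofReal ((|τ| ^ γ) ^ 2 * ‖fhat T g τ‖ ^ 2)

theorem fourierWeight_congr {g h : ℝ → Y} (hgh : g =ᵐ[timeMeasure T] h) :
    fourierWeight T γ g = fourierWeight T γ h := by
  rw [fourierWeight, fourierWeight, fhat_congr hgh]

theorem weight_sq_le (hγ : 0 ≤ γ) (h : γ ≤ δ) {R : ℝ} (hR : 0 < R) (τ : ℝ) :
    (|τ| ^ γ) ^ 2 ≤ (R ^ (γ - δ)) ^ 2 * (|τ| ^ δ) ^ 2 +
      (Icc (-R) R).indicator (fun _ => (R ^ γ) ^ 2) τ := by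
  by_cases hτ : |τ| ≤ R
  · rw [indicator_of_mem (show τ ∈ Icc (-R) R from abs_le.1 hτ)]
    have := pow_le_pow_left₀ (by positivity) (Real.rpow_le_rpow (abs_nonneg τ) hτ hγ) 2
    have h2 : 0 ≤ (R ^ (γ - δ)) ^ 2 * (|τ| ^ δ) ^ 2 := by positivity
    linarith
  · push Not at hτ
    rw [indicator_of_notMem (show τ ∉ Icc (-R) R from fun hm => absurd (abs_le.2 hm) (not_le.2 hτ)),
      add_zero, ← mul_pow]
    refine pow_le_pow_left₀ (by positivity) ?_ 2
    have h1 : |τ| ^ γ = |τ| ^ (γ - δ) * |τ| ^ δ := by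
      rw [← Real.rpow_add (hR.trans hτ)]; congr 1; ring
    rw [h1]
    exact mul_le_mul_of_nonneg_right
      (Real.rpow_le_rpow_of_nonpos hR hτ.le (by linarith)) (by positivity)

theorem lintegral_weight_le (hγ : 0 ≤ γ) (h : γ ≤ δ) {R : ℝ} (hR : 0 < R) {F : ℝ → ℝ}
    (hF : Continuous F) (hF0 : ∀ τ, 0 ≤ F τ) :
    ∫⁻ τ, ENNReal.ofReal ((|τ| ^ γ) ^ 2 * F τ) ≤
      ENNReal.ofReal ((R ^ (γ - δ)) ^ 2) * (∫⁻ τ, ENNReal.ofReal ((|τ| ^ δ) ^ 2 * F τ)) +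
      ENNReal.ofReal ((R ^ γ) ^ 2 * ∫ τ in Icc (-R) R, F τ) := by
  have hm : Measurable fun τ : ℝ => ENNReal.ofReal ((|τ| ^ δ) ^ 2 * F τ) :=
    ENNReal.measurable_ofReal.comp
      (((measurable_norm.pow_const δ).pow_const 2).mul hF.measurable)
  rw [ENNReal.ofReal_mul (by positivity), ofReal_integral_eq_lintegral_ofReal
    (hF.integrableOn_Icc) (ae_of_all _ fun τ => hF0 τ), ← lintegral_const_mul _ hm,
    ← lintegral_const_mul' _ _ ENNReal.ofReal_ne_top,
    ← lintegral_indicator measurableSet_Icc, ← lintegral_add_left (hm.const_mul _)]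
  refine lintegral_mono fun τ => ?_
  dsimp only
  have h1 := mul_le_mul_of_nonneg_right (weight_sq_le hγ h hR τ) (hF0 τ)
  refine (ENNReal.ofReal_le_ofReal h1).trans ?_
  rw [add_mul, ENNReal.ofReal_add (by have := hF0 τ; positivity)
    (mul_nonneg (indicator_nonneg (fun _ _ => by positivity) _) (hF0 τ)), mul_assoc,
    ENNReal.ofReal_mul (by positivity)]
  gcongr
  by_cases hτ : τ ∈ Icc (-R) R
  · rw [indicator_of_mem hτ, indicator_of_mem hτ, ENNReal.ofReal_mul (by positivity)]
  · rw [indicator_of_notMem hτ, indicator_of_notMem hτ, zero_mul, ENNReal.ofReal_zero]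

theorem fourierWeight_le (hT : 0 < T) (hγ : 0 ≤ γ) (h : γ ≤ δ) {R : ℝ} (hR : 0 < R)
    (g : TimeL2 T Y) :
    fourierWeight T γ g ≤ ENNReal.ofReal ((R ^ (γ - δ)) ^ 2) * fourierWeight T δ g +
      ENNReal.ofReal ((R ^ γ) ^ 2 * (2 * R * (2 * T * ‖g‖ ^ 2))) := by
  refine (lintegral_weight_le hγ h hR (F := fun τ => ‖fhat T g τ‖ ^ 2)
    ((continuous_fhat hT g).norm.pow 2) (fun τ => by positivity)).trans ?_
  unfold fourierWeight
  gcongr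
  have h1 : ∀ τ ∈ Icc (-R) R, ‖‖fhat T g τ‖ ^ 2‖ ≤ 2 * T * ‖g‖ ^ 2 := fun τ _ => by
    rw [Real.norm_of_nonneg (by positivity)]
    exact norm_fhat_sq_le hT g τ
  have h2 := norm_setIntegral_le_of_norm_le_const (μ := volume) isCompact_Icc.measure_lt_top h1
  rw [Measure.real, Real.volume_Icc, ENNReal.toReal_ofReal (by linarith)] at h2
  calc ∫ τ in Icc (-R) R, ‖fhat T g τ‖ ^ 2 ≤ 2 * T * ‖g‖ ^ 2 * (R - -R) :=
      (Real.le_norm_self _).trans h2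
    _ = 2 * R * (2 * T * ‖g‖ ^ 2) := by ring

end Fourier

section HGammaTheory

variable {X Y : Type*} [NormedAddCommGroup X] [NormedSpace ℝ X]
  [NormedAddCommGroup Y] [InnerProductSpace ℝ Y] {T γ : ℝ} {ι : X →L[ℝ] Y}

theorem HGamma.snd_ae (p : HGamma T γ ι) :
    p.1.snd =ᵐ[volume] fun τ => |τ| ^ γ • fhat T (ι.compLp (HGamma.toFun p)) τ := by
  have := p.2
  rw [← timeFourier_eq_fhat]
  exact this

theorem HGamma.ofReal_norm_snd_sq (p : HGamma T γ ι) :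
    ENNReal.ofReal (‖p.1.snd‖ ^ 2) = fourierWeight T γ (ι.compLp (HGamma.toFun p)) := by
  rw [ofReal_norm_sq_eq_lintegral, fourierWeight]
  refine lintegral_congr_ae ?_
  filter_upwards [HGamma.snd_ae p] with τ hτ
  rw [hτ, norm_smul, mul_pow, Real.norm_of_nonneg (by positivity)]

theorem HGamma.fourierWeight_ne_top (p : HGamma T γ ι) :
    fourierWeight T γ (ι.compLp (HGamma.toFun p)) ≠ ⊤ := by
  rw [← HGamma.ofReal_norm_snd_sq p]; exact ENNReal.ofReal_ne_top

theorem HGamma.norm_sq (p : HGamma T γ ι) :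
    ‖p‖ ^ 2 = ‖HGamma.toFun p‖ ^ 2 + (fourierWeight T γ (ι.compLp (HGamma.toFun p))).toReal := by
  rw [← HGamma.ofReal_norm_snd_sq p, ENNReal.toReal_ofReal (by positivity)]
  exact WithLp.prod_norm_sq_eq_of_L2 p.1

/-- The function of time underlying an element of `𝓗^γ(0, T; X, Y)`, as a continuous linear map. -/
def HGamma.toFunL : HGamma T γ ι →L[ℝ] TimeL2 T X :=
  (WithLp.fstL 2 ℝ (TimeL2 T X) (Lp (Cplx Y) 2 (volume : Measure ℝ))).comp
    (HGamma T γ ι).subtypeL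

theorem HGamma.toFunL_apply (p : HGamma T γ ι) : HGamma.toFunL p = HGamma.toFun p := rfl

theorem HGamma.toFun_injective : Function.Injective (HGamma.toFun (T := T) (γ := γ) (ι := ι)) := by
  intro p q h
  have h0 : HGamma.toFun (p - q) = 0 := by
    rw [← HGamma.toFunL_apply, map_sub, HGamma.toFunL_apply, HGamma.toFunL_apply, h, sub_self]
  have h1 := HGamma.norm_sq (p - q)
  have h2 : fourierWeight T γ (ι.compLp (HGamma.toFun (p - q))) = 0 := by
    rw [h0, fourierWeight_congr (h := fun _ => 0)]
    · simp [fourierWeight, norm_fhat_sq, cosT, sinT]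
    · filter_upwards [ι.coeFn_compLp (0 : TimeL2 T X), Lp.coeFn_zero X 2 (timeMeasure T)]
        with t h1 h2
      rw [h1, h2]; simp
  rw [h2, h0] at h1
  simp only [norm_zero, ENNReal.toReal_zero] at h1
  exact sub_eq_zero.1 (norm_eq_zero.1 (by nlinarith))

theorem HGamma.exists_toFun_eq (hT : 0 < T) (f : TimeL2 T X)
    (h : fourierWeight T γ (ι.compLp f) ≠ ⊤) : ∃ p : HGamma T γ ι, HGamma.toFun p = f := by
  have hm : AEStronglyMeasurable (fun τ => |τ| ^ γ • fhat T (ι.compLp f) τ)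
      (volume : Measure ℝ) :=
    (measurable_norm.pow_const γ).aestronglyMeasurable.smul
      (continuous_fhat hT _).aestronglyMeasurable
  have hL : MemLp (fun τ => |τ| ^ γ • fhat T (ι.compLp f) τ) 2 (volume : Measure ℝ) := by
    rw [memLp_two_iff_integrable_sq_norm hm]
    refine (lintegral_ofReal_ne_top_iff_integrable (hm.norm.pow 2)
      (ae_of_all _ fun τ => sq_nonneg _)).1 ?_
    convert h using 1
    unfold fourierWeight
    congr 1
    ext τ
    rw [Pi.pow_apply, norm_smul, mul_pow, Real.norm_of_nonneg (by positivity)]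
  refine ⟨⟨WithLp.toLp 2 (f, hL.toLp _), ?_⟩, rfl⟩
  change hL.toLp _ =ᵐ[volume] fun τ => |τ| ^ γ • timeFourier ι f τ
  rw [timeFourier_eq_fhat]
  exact hL.coeFn_toLp

theorem HGamma.completeSpace (hT : 0 < T) [CompleteSpace X] [CompleteSpace Y] :
    CompleteSpace (HGamma T γ ι) := by
  refine IsClosed.completeSpace_coe (hs := IsSeqClosed.isClosed ?_)
  intro p q hp hpq
  have h1 : Tendsto (fun n => (p n).fst) atTop (𝓝 q.fst) :=
    ((WithLp.fstL 2 ℝ (TimeL2 T X) (Lp (Cplx Y) 2 (volume : Measure ℝ))).continuous.tendsto q).comp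
      hpq
  have h2 : Tendsto (fun n => (p n).snd) atTop (𝓝 q.snd) :=
    ((WithLp.sndL 2 ℝ (TimeL2 T X) (Lp (Cplx Y) 2 (volume : Measure ℝ))).continuous.tendsto q).comp
      hpq
  have h3 : Tendsto (fun n => ι.compLp (p n).fst) atTop (𝓝 (ι.compLp q.fst)) :=
    ((ι.compLpL 2 (timeMeasure T)).continuous.tendsto q.fst).comp h1
  obtain ⟨ns, hns, hae⟩ := (tendstoInMeasure_of_tendsto_Lp h2).exists_seq_tendsto_ae
  have hp' : ∀ n, (p n).snd =ᵐ[volume] fun τ => |τ| ^ γ • timeFourier ι (p n).fst τ := hp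
  change q.snd =ᵐ[volume] fun τ => |τ| ^ γ • timeFourier ι q.fst τ
  filter_upwards [hae, ae_all_iff.2 hp'] with τ hτ hpτ
  refine tendsto_nhds_unique hτ ?_
  simp_rw [hpτ, timeFourier_eq_fhat]
  exact ((tendsto_fhat hT h3 τ).comp hns.tendsto_atTop).const_smul _

end HGammaTheory

end

section

/-! ### Compactness of embeddings of the spaces `𝓗^γ(0, T; D(A^α), H)` -/

section

variable {X Y : Type*} [NormedAddCommGroup X] [NormedSpace ℝ X]
  [NormedAddCommGroup Y] [InnerProductSpace ℝ Y] {T γ δ : ℝ} {ι : X →L[ℝ] Y}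

theorem HGamma.norm_toFun_sq_le (p : HGamma T γ ι) : ‖HGamma.toFun p‖ ^ 2 ≤ ‖p‖ ^ 2 := by
  rw [HGamma.norm_sq p]
  exact le_add_of_nonneg_right ENNReal.toReal_nonneg

theorem HGamma.fourierWeight_toReal_le_norm_sq (p : HGamma T γ ι) :
    (fourierWeight T γ (ι.compLp (HGamma.toFun p))).toReal ≤ ‖p‖ ^ 2 := by
  rw [HGamma.norm_sq p]
  exact le_add_of_nonneg_left (by positivity)

theorem fourierWeight_toReal_le (hT : 0 < T) (hγ : 0 ≤ γ) (h : γ ≤ δ) {R : ℝ} (hR : 0 < R)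
    (g : TimeL2 T Y) (hg : fourierWeight T δ g ≠ ⊤) :
    (fourierWeight T γ g).toReal ≤ (R ^ (γ - δ)) ^ 2 * (fourierWeight T δ g).toReal +
      (R ^ γ) ^ 2 * (2 * R * (2 * T * ‖g‖ ^ 2)) := by
  have h1 := fourierWeight_le hT hγ h hR g
  refine (ENNReal.toReal_mono ?_ h1).trans_eq ?_
  · exact ENNReal.add_ne_top.2 ⟨ENNReal.mul_ne_top ENNReal.ofReal_ne_top hg, ENNReal.ofReal_ne_top⟩
  · rw [ENNReal.toReal_add (ENNReal.mul_ne_top ENNReal.ofReal_ne_top hg) ENNReal.ofReal_ne_top,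
      ENNReal.toReal_mul, ENNReal.toReal_ofReal (by positivity),
      ENNReal.toReal_ofReal (by positivity)]

theorem fourierWeight_ne_top_of_le (hT : 0 < T) (hγ : 0 ≤ γ) (h : γ ≤ δ)
    (g : TimeL2 T Y) (hg : fourierWeight T δ g ≠ ⊤) : fourierWeight T γ g ≠ ⊤ :=
  ne_top_of_le_ne_top (ENNReal.add_ne_top.2
    ⟨ENNReal.mul_ne_top ENNReal.ofReal_ne_top hg, ENNReal.ofReal_ne_top⟩)
    (fourierWeight_le hT hγ h one_pos g)

theorem exists_pos_rpow_sq_le {s : ℝ} (hs : s < 0) {ε : ℝ} (hε : 0 < ε) :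
    ∃ R : ℝ, 0 < R ∧ (R ^ s) ^ 2 ≤ ε := by
  have h1 : Tendsto (fun R : ℝ => (R ^ s) ^ 2) atTop (𝓝 0) := by
    have := (tendsto_rpow_neg_atTop (neg_pos.2 hs)).pow 2
    simpa using this
  obtain ⟨R, h2, h3⟩ := ((h1.eventually_lt_const hε).and (eventually_gt_atTop 0)).exists
  exact ⟨R, h3, h2.le⟩

end

namespace Spectral

variable {H : Type*} [NormedAddCommGroup H] [InnerProductSpace ℝ H] (b : Spectral H)
  {T α β γ δ : ℝ}

theorem compLp_incl_inclPow (hα : 0 ≤ α) (h : α ≤ β) (f : TimeL2 T (b.DPow β)) :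
    (b.incl hα).compLp ((b.inclPow h).compLp f) = (b.incl (hα.trans h)).compLp f := by
  refine Lp.ext ?_
  filter_upwards [(b.incl hα).coeFn_compLp ((b.inclPow h).compLp f),
    (b.inclPow h).coeFn_compLp f, (b.incl (hα.trans h)).coeFn_compLp f] with t h1 h2 h3
  rw [h1, h2, h3, b.incl_inclPow hα h]

/-- The `j`-th coefficient of a function of time. -/
def mode (j : ℕ) : TimeL2 T H →L[ℝ] TimeL2 T ℝ := (innerSL ℝ (b.basis j)).compLpL 2 _

theorem coeFn_mode (j : ℕ) (g : TimeL2 T H) :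
    b.mode j g =ᵐ[timeMeasure T] fun t => inner ℝ (b.basis j) (g t) :=
  (innerSL ℝ (b.basis j)).coeFn_compLp g

theorem norm_compLp_inclPow_sq_le (hβ : 0 ≤ β) (h : α ≤ β) (J : ℕ) (f : TimeL2 T (b.DPow β)) :
    ‖(b.inclPow h).compLp f‖ ^ 2 ≤ (b.lam J ^ (α - β)) ^ 2 * ‖f‖ ^ 2 +
      ∑ j ∈ Finset.range J, (b.lam j ^ α) ^ 2 * ‖b.mode j ((b.incl hβ).compLp f)‖ ^ 2 := by
  simp_rw [norm_sq_eq_integral]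
  simp_rw [← integral_const_mul]
  rw [← integral_finsetSum _ fun j _ => (integrable_norm_sq _).const_mul _,
    ← integral_add ((integrable_norm_sq _).const_mul _)
      (integrable_finsetSum _ fun j _ => (integrable_norm_sq _).const_mul _)]
  refine integral_mono_ae (integrable_norm_sq _) (((integrable_norm_sq _).const_mul _).add
      (integrable_finsetSum _ fun j _ => (integrable_norm_sq _).const_mul _)) ?_
  filter_upwards [(b.inclPow h).coeFn_compLp f, (b.incl hβ).coeFn_compLp f,
    ae_all_iff.2 fun j => b.coeFn_mode j ((b.incl hβ).compLp f)] with t h1 h2 h3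
  rw [h1]
  refine (b.norm_inclPow_sq_le h J (f t)).trans_eq ?_
  congr 1
  refine Finset.sum_congr rfl fun j _ => ?_
  rw [h3 j, h2, Real.norm_eq_abs, sq_abs, HilbertBasis.repr_apply_apply, b.incl_apply]

theorem cosT_mode (j : ℕ) (g : TimeL2 T H) (τ : ℝ) :
    cosT T (b.mode j g) τ = inner ℝ (b.basis j) (cosT T g τ) := by
  have := b.completeSpace
  have hi : Integrable g (timeMeasure T) := (Lp.memLp g).integrable (by norm_num)
  rw [cosT_congr (b.coeFn_mode j g)]
  have h := (innerSL ℝ (b.basis j)).integral_comp_comm (integrable_cos_smul hi τ)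
  simp only [innerSL_apply_apply] at h
  rw [cosT, cosT, ← h]
  simp_rw [inner_smul_right, smul_eq_mul]

theorem sinT_mode (j : ℕ) (g : TimeL2 T H) (τ : ℝ) :
    sinT T (b.mode j g) τ = inner ℝ (b.basis j) (sinT T g τ) := by
  have := b.completeSpace
  have hi : Integrable g (timeMeasure T) := (Lp.memLp g).integrable (by norm_num)
  rw [sinT_congr (b.coeFn_mode j g)]
  have h := (innerSL ℝ (b.basis j)).integral_comp_comm (integrable_sin_smul hi τ)
  simp only [innerSL_apply_apply] at h
  rw [sinT, sinT, ← h]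
  simp_rw [inner_smul_right, smul_eq_mul]

theorem inner_basis_sq_le (j : ℕ) (y : H) : inner ℝ (b.basis j) y ^ 2 ≤ ‖y‖ ^ 2 := by
  have h := abs_real_inner_le_norm (b.basis j) y
  rw [b.basis.orthonormal.1 j, one_mul] at h
  rw [← sq_abs]
  exact pow_le_pow_left₀ (abs_nonneg _) h 2

theorem norm_mode_sq_le (hT : 0 < T) (hδ : 0 ≤ δ) (j : ℕ) {R : ℝ} (hR : 0 < R) (g : TimeL2 T H)
    (hg : fourierWeight T δ g ≠ ⊤) :
    ‖b.mode j g‖ ^ 2 ≤ (R ^ (-δ)) ^ 2 * (fourierWeight T δ g).toReal +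
      ∫ τ in Icc (-R) R, (inner ℝ (b.basis j) (cosT T g τ) ^ 2 +
        inner ℝ (b.basis j) (sinT T g τ) ^ 2) := by
  set F : ℝ → ℝ := fun τ => inner ℝ (b.basis j) (cosT T g τ) ^ 2 +
        inner ℝ (b.basis j) (sinT T g τ) ^ 2 with hF
  have hFc : Continuous F := by
    have h1 := continuous_cosT hT g
    have h2 := continuous_sinT hT g
    fun_prop
  have hF0 : ∀ τ, 0 ≤ F τ := fun τ => by positivity
  have h1 := lintegral_fourier_sq hT (Lp.memLp (b.mode j g))
  simp_rw [b.cosT_mode, b.sinT_mode] at h1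
  have h2 := lintegral_weight_le le_rfl hδ hR hFc hF0
  simp only [Real.rpow_zero, one_pow, one_mul, zero_sub] at h2
  have h3 : ∫⁻ τ, ENNReal.ofReal ((|τ| ^ δ) ^ 2 * F τ) ≤ fourierWeight T δ g := by
    refine lintegral_mono fun τ => ENNReal.ofReal_le_ofReal ?_
    refine mul_le_mul_of_nonneg_left ?_ (by positivity)
    rw [norm_fhat_sq]
    exact add_le_add (b.inner_basis_sq_le j _) (b.inner_basis_sq_le j _)
  have h4 : ENNReal.ofReal (‖b.mode j g‖ ^ 2) ≤
      ENNReal.ofReal ((R ^ (-δ)) ^ 2) * fourierWeight T δ g +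
        ENNReal.ofReal (∫ τ in Icc (-R) R, F τ) := by
    have h5 : ‖b.mode j g‖ ^ 2 = ∫ t, b.mode j g t ^ 2 ∂timeMeasure T := by
      rw [norm_sq_eq_integral]
      simp
    rw [h5, ← h1]
    refine h2.trans ?_
    gcongr
  have hint : 0 ≤ ∫ τ in Icc (-R) R, F τ := integral_nonneg hF0
  have h6 := ENNReal.toReal_mono (ENNReal.add_ne_top.2
    ⟨ENNReal.mul_ne_top ENNReal.ofReal_ne_top hg, ENNReal.ofReal_ne_top⟩) h4
  rwa [ENNReal.toReal_add (ENNReal.mul_ne_top ENNReal.ofReal_ne_top hg) ENNReal.ofReal_ne_top,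
    ENNReal.toReal_mul, ENNReal.toReal_ofReal (by positivity),
    ENNReal.toReal_ofReal (by positivity), ENNReal.toReal_ofReal hint] at h6

/-- The embedding of `𝓗^γ(0, T; D(A^α), H)` into `L²(0, T; H)`. -/
def toL2 (hα : 0 ≤ α) : HGamma T γ (b.incl hα) →L[ℝ] TimeL2 T H :=
  ((b.incl hα).compLpL 2 (timeMeasure T)).comp HGamma.toFunL

theorem toL2_apply (hα : 0 ≤ α) (p : HGamma T γ (b.incl hα)) :
    b.toL2 hα p = (b.incl hα).compLp (HGamma.toFun p) := rfl

theorem exists_embed (hT : 0 < T) (hα : 0 ≤ α) (h : α ≤ β) (hγ : 0 ≤ γ) (hγδ : γ ≤ δ)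
    (p : HGamma T δ (b.incl (hα.trans h))) : ∃ q : HGamma T γ (b.incl hα),
      HGamma.toFun q = (b.inclPow h).compLp (HGamma.toFun p) := by
  refine HGamma.exists_toFun_eq hT _ ?_
  rw [b.compLp_incl_inclPow]
  exact fourierWeight_ne_top_of_le hT hγ hγδ _ (HGamma.fourierWeight_ne_top p)

/-- The embedding of `𝓗^δ(0, T; D(A^β), H)` into `𝓗^γ(0, T; D(A^α), H)`, as a linear map. -/
def embedₗ (hT : 0 < T) (hα : 0 ≤ α) (h : α ≤ β) (hγ : 0 ≤ γ) (hγδ : γ ≤ δ) :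
    HGamma T δ (b.incl (hα.trans h)) →ₗ[ℝ] HGamma T γ (b.incl hα) where
  toFun p := (b.exists_embed hT hα h hγ hγδ p).choose
  map_add' p q := HGamma.toFun_injective <| by
    rw [(b.exists_embed hT hα h hγ hγδ (p + q)).choose_spec, ← HGamma.toFunL_apply,
      ← HGamma.toFunL_apply, map_add, map_add, HGamma.toFunL_apply, HGamma.toFunL_apply,
      HGamma.toFunL_apply, HGamma.toFunL_apply, (b.exists_embed hT hα h hγ hγδ p).choose_spec,
      (b.exists_embed hT hα h hγ hγδ q).choose_spec]
    exact map_add ((b.inclPow h).compLpL 2 (timeMeasure T)) _ _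
  map_smul' c p := HGamma.toFun_injective <| by
    rw [(b.exists_embed hT hα h hγ hγδ (c • p)).choose_spec, ← HGamma.toFunL_apply,
      ← HGamma.toFunL_apply, map_smul, map_smul, HGamma.toFunL_apply, HGamma.toFunL_apply,
      (b.exists_embed hT hα h hγ hγδ p).choose_spec]
    exact map_smul ((b.inclPow h).compLpL 2 (timeMeasure T)) _ _

theorem toFun_embedₗ (hT : 0 < T) (hα : 0 ≤ α) (h : α ≤ β) (hγ : 0 ≤ γ) (hγδ : γ ≤ δ)
    (p : HGamma T δ (b.incl (hα.trans h))) :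
    HGamma.toFun (b.embedₗ hT hα h hγ hγδ p) = (b.inclPow h).compLp (HGamma.toFun p) :=
  (b.exists_embed hT hα h hγ hγδ p).choose_spec

theorem norm_embedₗ_sq (hT : 0 < T) (hα : 0 ≤ α) (h : α ≤ β) (hγ : 0 ≤ γ) (hγδ : γ ≤ δ)
    (p : HGamma T δ (b.incl (hα.trans h))) :
    ‖b.embedₗ hT hα h hγ hγδ p‖ ^ 2 = ‖(b.inclPow h).compLp (HGamma.toFun p)‖ ^ 2 +
      (fourierWeight T γ (b.toL2 (hα.trans h) p)).toReal := by
  rw [HGamma.norm_sq, b.toFun_embedₗ, b.compLp_incl_inclPow, b.toL2_apply]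

theorem norm_embedₗ_le (hT : 0 < T) (hα : 0 ≤ α) (h : α ≤ β) (hγ : 0 ≤ γ) (hγδ : γ ≤ δ) :
    ∃ C, ∀ p : HGamma T δ (b.incl (hα.trans h)),
      ‖b.embedₗ hT hα h hγ hγδ p‖ ≤ C * ‖p‖ := by
  refine ⟨√(‖b.inclPow h‖ ^ 2 + 1 + 4 * T *
    ‖b.toL2 (T := T) (γ := δ) (hα.trans h)‖ ^ 2), fun p => ?_⟩
  have h1 := (b.inclPow h).norm_compLp_le (HGamma.toFun p)
  have h2 := pow_le_pow_left₀ (norm_nonneg _) h1 2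
  have h3 := pow_le_pow_left₀ (norm_nonneg _) ((b.toL2 (hα.trans h)).le_opNorm p) 2
  have h4 := fourierWeight_toReal_le hT hγ hγδ one_pos (b.toL2 (hα.trans h) p)
    (HGamma.fourierWeight_ne_top p)
  simp only [Real.one_rpow, one_pow, one_mul, mul_one] at h4
  have h5 := HGamma.fourierWeight_toReal_le_norm_sq p
  rw [← b.toL2_apply (hα.trans h) p] at h5
  have h6 := HGamma.norm_toFun_sq_le p
  rw [mul_pow] at h2 h3
  refine abs_le_of_sq_le_sq' ?_ (by positivity) |>.2
  rw [mul_pow, Real.sq_sqrt (by positivity), b.norm_embedₗ_sq]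
  have h7 := mul_le_mul_of_nonneg_left h6 (sq_nonneg ‖b.inclPow h‖)
  have h8 := mul_le_mul_of_nonneg_left h3 (show 0 ≤ 4 * T by positivity)
  nlinarith

/-- The embedding of `𝓗^δ(0, T; D(A^β), H)` into `𝓗^γ(0, T; D(A^α), H)`. -/
def embed (hT : 0 < T) (hα : 0 ≤ α) (h : α ≤ β) (hγ : 0 ≤ γ) (hγδ : γ ≤ δ) :
    HGamma T δ (b.incl (hα.trans h)) →L[ℝ] HGamma T γ (b.incl hα) :=
  (b.embedₗ hT hα h hγ hγδ).mkContinuousOfExistsBound (b.norm_embedₗ_le hT hα h hγ hγδ)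

theorem toFun_embed (hT : 0 < T) (hα : 0 ≤ α) (h : α ≤ β) (hγ : 0 ≤ γ) (hγδ : γ ≤ δ)
    (p : HGamma T δ (b.incl (hα.trans h))) :
    HGamma.toFun (b.embed hT hα h hγ hγδ p) = (b.inclPow h).compLp (HGamma.toFun p) :=
  b.toFun_embedₗ hT hα h hγ hγδ p

theorem toL2_embed (hT : 0 < T) (hα : 0 ≤ α) (h : α ≤ β) (hγ : 0 ≤ γ) (hγδ : γ ≤ δ)
    (p : HGamma T δ (b.incl (hα.trans h))) :
    b.toL2 hα (b.embed hT hα h hγ hγδ p) = b.toL2 (hα.trans h) p := by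
  rw [b.toL2_apply, b.toFun_embed, b.compLp_incl_inclPow, b.toL2_apply]

theorem compLp_incl_injective (hα : 0 ≤ α) :
    Function.Injective fun f : TimeL2 T (b.DPow α) => (b.incl hα).compLp f := by
  intro f g hfg
  refine Lp.ext ?_
  filter_upwards [(b.incl hα).coeFn_compLp f, (b.incl hα).coeFn_compLp g] with t h1 h2
  refine b.incl_injective hα ?_
  rw [← h1, ← h2]
  exact congrArg (fun F : TimeL2 T H => F t) hfg

theorem toL2_injective (hα : 0 ≤ α) :
    Function.Injective (b.toL2 (T := T) (γ := γ) hα) := fun _ _ hpq =>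
  HGamma.toFun_injective (b.compLp_incl_injective hα hpq)

theorem precompactForm_mode (hT : 0 < T) (hα : 0 ≤ α) (hδ : 0 < δ) (j : ℕ) :
    PrecompactForm fun p : HGamma T δ (b.incl hα) => ‖b.mode j (b.toL2 hα p)‖ ^ 2 := by
  refine .of_forall_le (fun p => by positivity) fun ε hε => ?_
  obtain ⟨R, hR, hRε⟩ := exists_pos_rpow_sq_le (neg_lt_zero.2 hδ) hε
  let ℓc : ℝ → StrongDual ℝ (HGamma T δ (b.incl hα)) := fun τ =>
    (innerSL ℝ (b.basis j)).comp ((cosL hT τ).comp (b.toL2 hα))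
  let ℓs : ℝ → StrongDual ℝ (HGamma T δ (b.incl hα)) := fun τ =>
    (innerSL ℝ (b.basis j)).comp ((sinL hT τ).comp (b.toL2 hα))
  have hc : Continuous ℓc :=
    continuous_const.clm_comp ((continuous_cosL hT).clm_comp continuous_const)
  have hs : Continuous ℓs :=
    continuous_const.clm_comp ((continuous_sinL hT).clm_comp continuous_const)
  refine ⟨_, (PrecompactForm.setIntegral_sq hc R).add (PrecompactForm.setIntegral_sq hs R),
    fun p => ?_⟩
  have h1 := b.norm_mode_sq_le hT hδ.le j hR (b.toL2 hα p) (HGamma.fourierWeight_ne_top p)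
  have h2 := HGamma.fourierWeight_toReal_le_norm_sq p
  rw [← b.toL2_apply hα p] at h2
  have hci : Continuous fun τ => ℓc τ p ^ 2 := by fun_prop
  have hsi : Continuous fun τ => ℓs τ p ^ 2 := by fun_prop
  have h3 : ∫ τ in Icc (-R) R, (inner ℝ (b.basis j) (cosT T (b.toL2 hα p) τ) ^ 2 +
        inner ℝ (b.basis j) (sinT T (b.toL2 hα p) τ) ^ 2)
      = (∫ τ in Icc (-R) R, ℓc τ p ^ 2) + ∫ τ in Icc (-R) R, ℓs τ p ^ 2 :=
    integral_add hci.integrableOn_Icc hsi.integrableOn_Icc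
  rw [h3] at h1
  have h4 : (R ^ (-δ)) ^ 2 * (fourierWeight T δ (b.toL2 hα p)).toReal ≤ ε * ‖p‖ ^ 2 :=
    mul_le_mul hRε h2 ENNReal.toReal_nonneg hε.le
  linarith

/-- Compactness of the embedding of `𝓗^δ(0, T; D(A^β), H)` into `𝓗^γ(0, T; D(A^α), H)`. -/
theorem isCompactOperator_embed (hlam : Tendsto b.lam atTop atTop) (hT : 0 < T) (hα : 0 ≤ α)
    (h : α < β) (hγ : 0 ≤ γ) (hγδ : γ < δ) :
    IsCompactOperator (b.embed hT hα h.le hγ hγδ.le) := by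
  have := b.completeSpace
  have := b.completeSpace_DPow hα
  have hβ := hα.trans h.le
  have := HGamma.completeSpace (γ := γ) (ι := b.incl hα) hT
  have h1 : PrecompactForm fun p : HGamma T δ (b.incl hβ) =>
      ‖(b.inclPow h.le).compLp (HGamma.toFun p)‖ ^ 2 := by
    refine .of_forall_le (fun p => by positivity) fun ε hε => ?_
    obtain ⟨J, hJ⟩ : ∃ J, (b.lam J ^ (α - β)) ^ 2 ≤ ε := by
      have h2 : Tendsto (fun J => (b.lam J ^ (α - β)) ^ 2) atTop (𝓝 0) := by
        have := ((tendsto_rpow_neg_atTop (show 0 < β - α by linarith)).comp hlam).pow 2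
        simpa [Function.comp_def] using this
      obtain ⟨J, hJ⟩ := (h2.eventually_lt_const hε).exists
      exact ⟨J, hJ.le⟩
    refine ⟨_, PrecompactForm.sum (Finset.range J) fun j _ =>
      (b.precompactForm_mode hT hβ (hγ.trans_lt hγδ) j).const_mul ((b.lam j ^ α) ^ 2),
      fun p => ?_⟩
    refine (b.norm_compLp_inclPow_sq_le hβ h.le J (HGamma.toFun p)).trans ?_
    exact add_le_add (mul_le_mul hJ (HGamma.norm_toFun_sq_le p) (by positivity) hε.le) le_rfl
  have h2 : PrecompactForm fun p : HGamma T δ (b.incl hβ) => ‖b.toL2 hβ p‖ ^ 2 := by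
    refine (h1.const_mul (‖b.incl hα‖ ^ 2)).of_le (fun p => by positivity) fun p => ?_
    rw [b.toL2_apply, ← b.compLp_incl_inclPow hα h.le, ← mul_pow]
    exact pow_le_pow_left₀ (norm_nonneg _) ((b.incl hα).norm_compLp_le _) 2
  have h3 : PrecompactForm fun p : HGamma T δ (b.incl hβ) =>
      (fourierWeight T γ (b.toL2 hβ p)).toReal := by
    refine .of_forall_le (fun p => ENNReal.toReal_nonneg) fun ε hε => ?_
    obtain ⟨R, hR, hRε⟩ := exists_pos_rpow_sq_le (sub_neg.2 hγδ) hε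
    refine ⟨_, h2.const_mul ((R ^ γ) ^ 2 * (2 * R * (2 * T))), fun p => ?_⟩
    have h4 := fourierWeight_toReal_le hT hγ hγδ.le hR (b.toL2 hβ p)
      (HGamma.fourierWeight_ne_top p)
    have h5 := HGamma.fourierWeight_toReal_le_norm_sq p
    rw [← b.toL2_apply hβ p] at h5
    have h6 := mul_le_mul hRε h5 ENNReal.toReal_nonneg hε.le
    linarith
  refine PrecompactForm.isCompactOperator _ ((h1.add h3).of_le (fun p => by positivity) fun p => ?_)
  exact (b.norm_embedₗ_sq hT hα h.le hγ hγδ.le p).le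

end Spectral

end

section

/-! ### The Poincaré inequality on boxes -/

section Poincare

theorem sq_lintegral_le {X : Type*} [MeasurableSpace X] (μ : Measure X) {f : X → ENNReal}
    (hf : AEMeasurable f μ) : (∫⁻ x, f x ∂μ) ^ 2 ≤ μ univ * ∫⁻ x, f x ^ 2 ∂μ := by
  have h := ENNReal.lintegral_mul_le_Lp_mul_Lq μ (p := 2) (q := 2) Real.HolderConjugate.two_two hf
    (g := fun _ => 1) aemeasurable_const
  simp only [Pi.mul_apply, mul_one, ENNReal.one_rpow, lintegral_one] at h
  calc (∫⁻ x, f x ∂μ) ^ 2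
      ≤ ((∫⁻ x, f x ^ (2 : ℝ) ∂μ) ^ (1 / (2 : ℝ)) * μ univ ^ (1 / (2 : ℝ))) ^ 2 := by gcongr
    _ = μ univ * ∫⁻ x, f x ^ 2 ∂μ := by
      rw [mul_pow, ← ENNReal.rpow_natCast, ← ENNReal.rpow_natCast, ← ENNReal.rpow_mul,
        ← ENNReal.rpow_mul]
      norm_num
      rw [mul_comm]

variable {E F : Type*} [NormedAddCommGroup E] [NormedSpace ℝ E]
  [NormedAddCommGroup F] [NormedSpace ℝ F] [CompleteSpace F]

theorem enorm_sub_sq_le_lintegral {p : E → F} (hp : ContDiff ℝ 1 p) (x z : E) :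
    ‖p x - p (x + z)‖ₑ ^ 2 ≤
      ‖z‖ₑ ^ 2 * ∫⁻ t in Icc (0 : ℝ) 1, ‖fderiv ℝ p (x + t • z)‖ₑ ^ 2 := by
  have hdc : Continuous (fderiv ℝ p) := hp.continuous_fderiv (by simp)
  have hd : ∀ t : ℝ, HasDerivAt (fun t : ℝ => p (x + t • z)) (fderiv ℝ p (x + t • z) z) t := by
    intro t
    have h1 : HasDerivAt (fun t : ℝ => x + t • z) z t := by
      simpa using ((hasDerivAt_id t).smul_const z).const_add x
    exact ((hp.differentiable (by simp)) _).hasFDerivAt.comp_hasDerivAt t h1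
  have hc : Continuous fun t : ℝ => fderiv ℝ p (x + t • z) z := by fun_prop
  have hc' : Continuous fun t : ℝ => fderiv ℝ p (x + t • z) := by fun_prop
  have hftc := intervalIntegral.integral_eq_sub_of_hasDerivAt (a := 0) (b := 1)
    (fun t _ => hd t) (hc.intervalIntegrable _ _)
  simp only [one_smul, zero_smul, add_zero] at hftc
  rw [intervalIntegral.integral_of_le zero_le_one] at hftc
  have h1 : ‖p x - p (x + z)‖ₑ ≤ ‖z‖ₑ * ∫⁻ t in Icc (0 : ℝ) 1, ‖fderiv ℝ p (x + t • z)‖ₑ := by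
    rw [← neg_sub, enorm_neg, ← hftc, ← lintegral_const_mul' _ _ enorm_ne_top,
      ← restrict_Ioc_eq_restrict_Icc]
    refine (enorm_integral_le_lintegral_enorm _).trans (lintegral_mono fun t => ?_)
    rw [mul_comm]
    exact (fderiv ℝ p (x + t • z)).le_opENorm z
  calc ‖p x - p (x + z)‖ₑ ^ 2
      ≤ (‖z‖ₑ * ∫⁻ t in Icc (0 : ℝ) 1, ‖fderiv ℝ p (x + t • z)‖ₑ) ^ 2 := by gcongr
    _ ≤ _ := by
      rw [mul_pow]
      gcongr
      have := sq_lintegral_le (volume.restrict (Icc (0 : ℝ) 1))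
        (f := fun t => ‖fderiv ℝ p (x + t • z)‖ₑ) (by
          exact hc'.enorm.measurable.aemeasurable)
      simpa using this

/-- The half-open box with corner `a` and side `h`. -/
def box (a : Fin 3 → ℝ) (h : ℝ) : Set E3 := {x | ∀ i, x i ∈ Ico (a i) (a i + h)}

theorem box_eq_preimage (a : Fin 3 → ℝ) (h : ℝ) :
    box a h = (WithLp.ofLp : E3 → Fin 3 → ℝ) ⁻¹' (univ.pi fun i => Ico (a i) (a i + h)) := by
  ext x; simp [box]

theorem measurableSet_box (a : Fin 3 → ℝ) (h : ℝ) : MeasurableSet (box a h) := by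
  rw [box_eq_preimage]
  exact (MeasurableSet.univ_pi fun _ => measurableSet_Ico).preimage
    (PiLp.volume_preserving_ofLp (Fin 3)).measurable

theorem volume_box (a : Fin 3 → ℝ) (h : ℝ) : volume (box a h) = ENNReal.ofReal h ^ 3 := by
  rw [box_eq_preimage, (PiLp.volume_preserving_ofLp (Fin 3)).measure_preimage
    (MeasurableSet.univ_pi fun _ => measurableSet_Ico).nullMeasurableSet, Real.volume_pi_Ico]
  simp

theorem convex_box (a : Fin 3 → ℝ) (h : ℝ) : Convex ℝ (box a h) := by
  intro x hx y hy s t hs ht hst i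
  have := (convex_Ico (a i) (a i + h)) (hx i) (hy i) hs ht hst
  simpa using this

theorem norm_le_of_abs_le {z : E3} {h : ℝ} (hh : 0 ≤ h) (hz : ∀ i, |z i| ≤ h) :
    ‖z‖ ≤ 2 * h := by
  rw [EuclideanSpace.norm_eq]
  refine Real.sqrt_le_iff.2 ⟨by positivity, ?_⟩
  have : ∀ i, ‖z i‖ ^ 2 ≤ h ^ 2 := fun i => by
    rw [Real.norm_eq_abs]; exact pow_le_pow_left₀ (abs_nonneg _) (hz i) 2
  calc ∑ i, ‖z i‖ ^ 2 ≤ ∑ _i : Fin 3, h ^ 2 := Finset.sum_le_sum fun i _ => this i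
    _ ≤ (2 * h) ^ 2 := by simp; nlinarith

theorem isBounded_box (a : Fin 3 → ℝ) (h : ℝ) : Bornology.IsBounded (box a h) := by
  have : box a h ⊆ (fun y => WithLp.toLp 2 a + y) '' Metric.closedBall (0 : E3) (2 * |h|) := by
    intro x hx
    refine ⟨x - WithLp.toLp 2 a, ?_, by simp⟩
    rw [mem_closedBall_zero_iff]
    refine norm_le_of_abs_le (abs_nonneg h) fun i => ?_
    have h1 := (hx i).1
    have h2 := (hx i).2
    have h3 : (x - WithLp.toLp 2 a) i = x i - a i := by simp
    rw [h3, abs_of_nonneg (by linarith)]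
    exact (by linarith : x i - a i ≤ h).trans (le_abs_self h)
  refine Bornology.IsBounded.subset ?_ this
  exact ((isCompact_closedBall (0 : E3) (2 * |h|)).image (by fun_prop)).isBounded

theorem lintegral_box_sub_le {p : E3 → E3} (hp : ContDiff ℝ 1 p) (a : Fin 3 → ℝ) {h : ℝ}
    (hh : 0 < h) :
    ∫⁻ x in box a h, ∫⁻ y in box a h, ‖p x - p y‖ₑ ^ 2 ≤
      8 * ENNReal.ofReal h ^ 3 * (ENNReal.ofReal (2 * h) ^ 2 *
        ∫⁻ x in box a h, ‖fderiv ℝ p x‖ₑ ^ 2) := by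
  set Q := box a h with hQ
  have hQm : MeasurableSet Q := measurableSet_box a h
  set B := box (fun _ => -h) (2 * h) with hB
  have hBm : MeasurableSet B := measurableSet_box _ _
  set d := ENNReal.ofReal (2 * h) with hd
  set G : E3 → ENNReal := Q.indicator fun x => ‖fderiv ℝ p x‖ₑ ^ 2 with hG
  have hdc : Continuous (fderiv ℝ p) := hp.continuous_fderiv (by simp)
  have hGm : Measurable G := (hdc.enorm.measurable.pow_const 2).indicator hQm
  have hvB : volume B = 8 * ENNReal.ofReal h ^ 3 := by
    rw [hB, volume_box, ENNReal.ofReal_mul (by norm_num), mul_pow]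
    norm_num
  have hpt : ∀ x ∈ Q, ∫⁻ y in Q, ‖p x - p y‖ₑ ^ 2 ≤
      ∫⁻ z in B, d ^ 2 * ∫⁻ t in Icc (0 : ℝ) 1, G (x + t • z) := by
    intro x hx
    rw [← lintegral_indicator hQm, ← lintegral_indicator hBm,
      ← lintegral_add_left_eq_self _ x]
    refine lintegral_mono fun z => ?_
    by_cases hz : x + z ∈ Q
    · have hzh : ∀ i, -h < z i ∧ z i < h := fun i => by
        have h1 := hx i
        have h2 := hz i
        rw [PiLp.add_apply] at h2
        exact ⟨by linarith [h1.2, h2.1], by linarith [h1.1, h2.2]⟩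
      have hzB : z ∈ B := fun i => ⟨(hzh i).1.le, by linarith [(hzh i).2]⟩
      rw [indicator_of_mem hz, indicator_of_mem hzB]
      refine (enorm_sub_sq_le_lintegral hp x z).trans ?_
      have hzd : ‖z‖ₑ ≤ d := by
        rw [hd, ← ofReal_norm]
        exact ENNReal.ofReal_le_ofReal (norm_le_of_abs_le hh.le fun i =>
          abs_le.2 ⟨(hzh i).1.le, (hzh i).2.le⟩)
      refine mul_le_mul' (pow_le_pow_left' hzd 2) ?_
      refine setLIntegral_mono' measurableSet_Icc fun t ht => ?_
      have : x + t • z ∈ Q := by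
        have := (convex_box a h).add_smul_sub_mem hx hz ht
        simpa using this
      rw [hG, indicator_of_mem this]
    · rw [indicator_of_notMem hz]
      exact zero_le
  have hmeas : Measurable fun q : (E3 × E3) × ℝ => G (q.1.1 + q.2 • q.1.2) :=
    hGm.comp (by fun_prop)
  calc ∫⁻ x in Q, ∫⁻ y in Q, ‖p x - p y‖ₑ ^ 2
      ≤ ∫⁻ x in Q, ∫⁻ z in B, d ^ 2 * ∫⁻ t in Icc (0 : ℝ) 1, G (x + t • z) :=
        setLIntegral_mono' hQm hpt
    _ ≤ ∫⁻ x, ∫⁻ z in B, d ^ 2 * ∫⁻ t in Icc (0 : ℝ) 1, G (x + t • z) :=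
        setLIntegral_le_lintegral _ _
    _ = ∫⁻ z in B, ∫⁻ x, d ^ 2 * ∫⁻ t in Icc (0 : ℝ) 1, G (x + t • z) := by
        refine lintegral_lintegral_swap ?_
        exact (hmeas.lintegral_prod_right'.const_mul _).aemeasurable
    _ = ∫⁻ _z in B, d ^ 2 * ∫⁻ x, G x := by
        refine lintegral_congr fun z => ?_
        rw [lintegral_const_mul _ (by
          exact (hmeas.lintegral_prod_right').comp (measurable_id.prodMk measurable_const)),
          lintegral_lintegral_swap (by
            exact (hGm.comp (by fun_prop : Measurable fun q : E3 × ℝ => q.1 + q.2 • z)).aemeasurable)]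
        congr 1
        have : ∀ t : ℝ, ∫⁻ x, G (x + t • z) = ∫⁻ x, G x := fun t =>
          lintegral_add_right_eq_self G (t • z)
        simp [this]
    _ = _ := by
        rw [lintegral_const, Measure.restrict_apply_univ, hvB, hG, lintegral_indicator hQm, mul_comm]

theorem lintegral_box_le {p : E3 → E3} (hp : ContDiff ℝ 1 p) (a : Fin 3 → ℝ) {h : ℝ}
    (hh : 0 < h) :
    ∫⁻ x in box a h, ‖p x‖ₑ ^ 2 ≤
      16 * (ENNReal.ofReal (2 * h) ^ 2 * ∫⁻ x in box a h, ‖fderiv ℝ p x‖ₑ ^ 2) +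
        2 * (ENNReal.ofReal h ^ 3)⁻¹ * ‖∫ x in box a h, p x‖ₑ ^ 2 := by
  have hsub := lintegral_box_sub_le hp a hh
  set Q := box a h with hQ
  set m := ENNReal.ofReal h ^ 3 with hm
  set W := ENNReal.ofReal (2 * h) ^ 2 * ∫⁻ x in Q, ‖fderiv ℝ p x‖ₑ ^ 2 with hW
  have hvQ : volume Q = m := volume_box a h
  have hm0 : m ≠ 0 := by simp [hm, hh]
  have hmt : m ≠ ⊤ := by simp [hm]
  have hpi : IntegrableOn p Q := by
    exact (hp.continuous.locallyIntegrable.integrableOn_isCompact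
      (isBounded_box a h).isCompact_closure).mono_set subset_closure
  have hpt : ∀ x, m ^ 2 * ‖p x‖ₑ ^ 2 ≤
      2 * (m * ∫⁻ y in Q, ‖p x - p y‖ₑ ^ 2) + 2 * ‖∫ y in Q, p y‖ₑ ^ 2 := by
    intro x
    have h1 : ∫ y in Q, (p x - p y) = m.toReal • p x - ∫ y in Q, p y := by
      rw [integral_sub (integrable_const_iff.2 (Or.inr ⟨by simp [hvQ, hmt.lt_top]⟩)) hpi]
      simp [Measure.real, hvQ]
    have h2 : m.toReal • p x = (∫ y in Q, (p x - p y)) + ∫ y in Q, p y := by rw [h1]; abel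
    have h3 : m * ‖p x‖ₑ ≤ (∫⁻ y in Q, ‖p x - p y‖ₑ) + ‖∫ y in Q, p y‖ₑ := by
      have : m * ‖p x‖ₑ = ‖m.toReal • p x‖ₑ := by
        rw [enorm_smul, Real.enorm_of_nonneg ENNReal.toReal_nonneg, ENNReal.ofReal_toReal hmt]
      rw [this, h2]
      exact (enorm_add_le _ _).trans (add_le_add_left (enorm_integral_le_lintegral_enorm _) _)
    have h4 := sq_lintegral_le (volume.restrict Q) (f := fun y => ‖p x - p y‖ₑ) (by
      exact (continuous_const.sub hp.continuous).enorm.measurable.aemeasurable)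
    rw [Measure.restrict_apply_univ, hvQ] at h4
    calc m ^ 2 * ‖p x‖ₑ ^ 2 = (m * ‖p x‖ₑ) ^ 2 := by ring
      _ ≤ ((∫⁻ y in Q, ‖p x - p y‖ₑ) + ‖∫ y in Q, p y‖ₑ) ^ 2 := by gcongr
      _ ≤ 2 * ((∫⁻ y in Q, ‖p x - p y‖ₑ) ^ 2 + ‖∫ y in Q, p y‖ₑ ^ 2) := by
        have := ENNReal.rpow_add_le_mul_rpow_add_rpow (∫⁻ y in Q, ‖p x - p y‖ₑ)
          ‖∫ y in Q, p y‖ₑ (p := 2) (by norm_num)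
        norm_num at this
        exact_mod_cast this
      _ ≤ _ := by
        rw [mul_add]
        gcongr
  have hint : m ^ 2 * ∫⁻ x in Q, ‖p x‖ₑ ^ 2 ≤
      m ^ 2 * (16 * W + 2 * m⁻¹ * ‖∫ y in Q, p y‖ₑ ^ 2) := by
    rw [← lintegral_const_mul' _ _ (by simp [hmt])]
    have hmi : m ^ 2 * m⁻¹ = m := by
      rw [pow_two, mul_assoc, ENNReal.mul_inv_cancel hm0 hmt, mul_one]
    calc ∫⁻ x in Q, m ^ 2 * ‖p x‖ₑ ^ 2
        ≤ ∫⁻ x in Q, (2 * (m * ∫⁻ y in Q, ‖p x - p y‖ₑ ^ 2) + 2 * ‖∫ y in Q, p y‖ₑ ^ 2) :=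
          lintegral_mono hpt
      _ = 2 * (m * ∫⁻ x in Q, ∫⁻ y in Q, ‖p x - p y‖ₑ ^ 2) + m * (2 * ‖∫ y in Q, p y‖ₑ ^ 2) := by
          rw [lintegral_add_right _ measurable_const, lintegral_const_mul' _ _ (by simp),
            lintegral_const_mul' _ _ hmt, lintegral_const, Measure.restrict_apply_univ, hvQ,
            mul_comm (2 * _) m]
      _ ≤ 2 * (m * (8 * m * W)) + m * (2 * ‖∫ y in Q, p y‖ₑ ^ 2) := by gcongr
      _ = m ^ 2 * (16 * W) + (m ^ 2 * m⁻¹) * (2 * ‖∫ y in Q, p y‖ₑ ^ 2) := by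
          rw [hmi]; ring
      _ = _ := by ring
  exact (ENNReal.mul_le_mul_iff_right (by simp [hm0]) (by simp [hmt])).1 hint

end Poincare

end

section

/-! ### Classical fields are dense in `V` -/

section Classical

variable {Ω : Set E3}

theorem IsClassicalPair.add {w z : H1Pair Ω} {p q : E3 → E3} (hw : IsClassicalPair w p)
    (hz : IsClassicalPair z q) (hp : Differentiable ℝ p) (hq : Differentiable ℝ q) :
    IsClassicalPair (w + z) (p + q) := by
  refine ⟨?_, fun j => ?_⟩
  · rw [WithLp.add_fst]
    filter_upwards [Lp.coeFn_add w.fst z.fst, hw.1, hz.1] with x h1 h2 h3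
    rw [h1, Pi.add_apply, h2, h3, Pi.add_apply]
  · rw [WithLp.add_snd, PiLp.add_apply]
    filter_upwards [Lp.coeFn_add (w.snd j) (z.snd j), hw.2 j, hz.2 j] with x h1 h2 h3
    rw [h1, Pi.add_apply, h2, h3, fderiv_add (hp x) (hq x), add_apply]

theorem IsClassicalPair.smul {w : H1Pair Ω} {p : E3 → E3} (hw : IsClassicalPair w p)
    (hp : Differentiable ℝ p) (c : ℝ) : IsClassicalPair (c • w) (c • p) := by
  refine ⟨?_, fun j => ?_⟩
  · rw [WithLp.smul_fst]
    filter_upwards [Lp.coeFn_smul c w.fst, hw.1] with x h1 h2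
    rw [h1, Pi.smul_apply, h2, Pi.smul_apply]
  · rw [WithLp.smul_snd, PiLp.smul_apply]
    filter_upwards [Lp.coeFn_smul c (w.snd j), hw.2 j] with x h1 h2
    rw [h1, Pi.smul_apply, h2, fderiv_const_smul (hp x), smul_apply]

theorem IsClassicalPair.zero : IsClassicalPair (0 : H1Pair Ω) 0 := by
  refine ⟨?_, fun j => ?_⟩
  · exact Lp.coeFn_zero E3 2 (volume.restrict Ω)
  · filter_upwards [Lp.coeFn_zero E3 2 (volume.restrict Ω)] with x h1
    rw [fderiv_zero]
    exact h1

theorem exists_classical_of_mem_span {M : Submodule ℝ (E3 → E3)}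
    (hM : ∀ p ∈ M, Differentiable ℝ p) {A : Set (H1Pair Ω)}
    (hA : ∀ w ∈ A, ∃ p ∈ M, IsClassicalPair w p) {w : H1Pair Ω}
    (hw : w ∈ Submodule.span ℝ A) : ∃ p ∈ M, IsClassicalPair w p := by
  induction hw using Submodule.span_induction with
  | mem w hw => exact hA w hw
  | zero => exact ⟨0, zero_mem _, .zero⟩
  | add w z _ _ h1 h2 =>
    obtain ⟨p, hp, hp'⟩ := h1
    obtain ⟨q, hq, hq'⟩ := h2
    exact ⟨p + q, add_mem hp hq, hp'.add hq' (hM p hp) (hM q hq)⟩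
  | smul c w _ h1 =>
    obtain ⟨p, hp, hp'⟩ := h1
    exact ⟨c • p, Submodule.smul_mem _ c hp, hp'.smul (hM p hp) c⟩

/-- The smooth fields with compact support in `Ω`. -/
def testFields (Ω : Set E3) : Submodule ℝ (E3 → E3) where
  carrier := {p | ContDiff ℝ ∞ p ∧ HasCompactSupport p ∧ tsupport p ⊆ Ω}
  add_mem' := fun ⟨h1, h2, h3⟩ ⟨h4, h5, h6⟩ =>
    ⟨h1.add h4, h2.add h5, (tsupport_add _ _).trans (union_subset h3 h6)⟩
  zero_mem' := ⟨contDiff_const, .zero, by simp [tsupport]⟩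
  smul_mem' := fun c p ⟨h1, h2, h3⟩ => by
    refine ⟨h1.const_smul c, h2.smul_left (f := fun _ => c), ?_⟩
    exact (tsupport_smul_subset_right (fun _ => c) p).trans h3

theorem contDiff_of_mem_trigPoly {L : ℝ} {p : E3 → E3} (hp : p ∈ trigPoly L) :
    ContDiff ℝ ∞ p := by
  have hphase : ∀ k, ContDiff ℝ ∞ (phase L k) := fun k => by
    unfold phase
    fun_prop
  induction hp using Submodule.span_induction with
  | mem p hp =>
    obtain ⟨k, a, rfl | rfl⟩ := hp
    · exact (Real.contDiff_cos.comp (hphase k)).smul contDiff_const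
    · exact (Real.contDiff_sin.comp (hphase k)).smul contDiff_const
  | zero => exact contDiff_const
  | add p q _ _ h1 h2 => exact h1.add h2
  | smul c p _ h1 => exact h1.const_smul c

theorem mem_closure_of_mem_periodicV {L : ℝ} {w : H1Pair (cube L)} (hw : w ∈ periodicV L) :
    w ∈ closure {w : H1Pair (cube L) | ∃ p ∈ trigPoly L, IsClassicalPair w p} := by
  refine closure_mono ?_ hw
  exact fun w hw => exists_classical_of_mem_span (M := trigPoly L)
    (fun p hp => (contDiff_of_mem_trigPoly hp).differentiable (by simp))
    (by rintro w ⟨p, hp, h⟩; exact ⟨p, hp.1, h⟩) hw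

theorem mem_closure_of_mem_noSlipV {w : H1Pair Ω} (hw : w ∈ noSlipV Ω) :
    w ∈ closure {w : H1Pair Ω | ∃ p ∈ testFields Ω, IsClassicalPair w p} := by
  refine closure_mono ?_ hw.1
  exact fun w hw => exists_classical_of_mem_span (M := testFields Ω)
    (fun p hp => hp.1.differentiable (by simp))
    (by rintro w ⟨p, h1, h2, h3, h4⟩; exact ⟨p, ⟨h1, h2, h3⟩, h4⟩) hw

theorem sum_norm_sq_le_norm_sq (w : H1Pair Ω) : ∑ j, ‖w.snd j‖ ^ 2 ≤ ‖w‖ ^ 2 := by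
  rw [WithLp.prod_norm_sq_eq_of_L2, ← PiLp.norm_sq_eq_of_L2]
  exact le_add_of_nonneg_left (sq_nonneg _)

theorem norm_fst_le (w : H1Pair Ω) : ‖w.fst‖ ≤ ‖w‖ := by
  refine abs_le_of_sq_le_sq' ?_ (norm_nonneg _) |>.2
  rw [WithLp.prod_norm_sq_eq_of_L2 w]
  exact le_add_of_nonneg_right (sq_nonneg _)

theorem norm_clm_sq_le (A : E3 →L[ℝ] E3) : ‖A‖ ^ 2 ≤ ∑ j, ‖A (e j)‖ ^ 2 := by
  have h : ‖A‖ ≤ √(∑ j, ‖A (e j)‖ ^ 2) := by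
    refine A.opNorm_le_bound (Real.sqrt_nonneg _) fun x => ?_
    have hx : x = ∑ j, x j • e j := by
      ext i; simp [Finset.sum_apply, Pi.single_apply]
    calc ‖A x‖ = ‖∑ j, x j • A (e j)‖ := by
          conv_lhs => rw [hx, map_sum]
          simp
      _ ≤ ∑ j, ‖x j‖ * ‖A (e j)‖ := (norm_sum_le _ _).trans_eq (by simp [norm_smul])
      _ ≤ √(∑ j, ‖x j‖ ^ 2) * √(∑ j, ‖A (e j)‖ ^ 2) :=
          Real.sum_mul_le_sqrt_mul_sqrt _ _ _
      _ = √(∑ j, ‖A (e j)‖ ^ 2) * ‖x‖ := by rw [EuclideanSpace.norm_eq, mul_comm]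
  calc ‖A‖ ^ 2 ≤ √(∑ j, ‖A (e j)‖ ^ 2) ^ 2 := pow_le_pow_left₀ (norm_nonneg _) h 2
    _ = _ := Real.sq_sqrt (by positivity)

theorem lintegral_enorm_sq_eq {X Y : Type*} [MeasurableSpace X] {μ : Measure X}
    [NormedAddCommGroup Y] (u : Lp Y 2 μ) {p : X → Y} (h : u =ᵐ[μ] p) :
    ∫⁻ x, ‖p x‖ₑ ^ 2 ∂μ = ‖u‖ₑ ^ 2 := by
  rw [Lp.enorm_def, eLpNorm_congr_ae h, eLpNorm_eq_lintegral_rpow_enorm_toReal (by simp) (by simp),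
    ← ENNReal.rpow_natCast, ← ENNReal.rpow_mul]
  simp

theorem IsClassicalPair.lintegral_fderiv_le {w : H1Pair Ω} {p : E3 → E3}
    (hw : IsClassicalPair w p) (hp : ContDiff ℝ 1 p) :
    ∫⁻ x in Ω, ‖fderiv ℝ p x‖ₑ ^ 2 ≤ ENNReal.ofReal (‖w‖ ^ 2) := by
  have hc : ∀ j, Measurable fun x => ‖fderiv ℝ p x (e j)‖ₑ ^ 2 := fun j => by
    have : Continuous (fderiv ℝ p) := hp.continuous_fderiv (by simp)
    exact (by fun_prop : Continuous fun x => fderiv ℝ p x (e j)).enorm.measurable.pow_const 2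
  calc ∫⁻ x in Ω, ‖fderiv ℝ p x‖ₑ ^ 2
      ≤ ∫⁻ x in Ω, ∑ j, ‖fderiv ℝ p x (e j)‖ₑ ^ 2 := by
        refine lintegral_mono fun x => ?_
        simp only [← ofReal_norm, ← ENNReal.ofReal_pow (norm_nonneg _)]
        rw [← ENNReal.ofReal_sum_of_nonneg fun j _ => sq_nonneg _]
        exact ENNReal.ofReal_le_ofReal (norm_clm_sq_le _)
    _ = ∑ j, ‖w.snd j‖ₑ ^ 2 := by
        rw [lintegral_finsetSum _ fun j _ => hc j]
        exact Finset.sum_congr rfl fun j _ => lintegral_enorm_sq_eq (w.snd j) (hw.2 j)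
    _ ≤ _ := by
        simp only [← ofReal_norm, ← ENNReal.ofReal_pow (norm_nonneg _)]
        rw [← ENNReal.ofReal_sum_of_nonneg fun j _ => sq_nonneg _]
        exact ENNReal.ofReal_le_ofReal (sum_norm_sq_le_norm_sq w)

end Classical

/-! ### Compactness of the embedding of `V` into `L²` -/

section Rellich

/-- The corners of the `N³` boxes of side `ℓ / N` into which `box a ℓ` is divided. -/
def corner (a : Fin 3 → ℝ) (ℓ : ℝ) (N : ℕ) (m : Fin 3 → Fin N) : Fin 3 → ℝ :=
  fun i => a i + (m i : ℕ) * (ℓ / N)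

theorem iUnion_box_corner (a : Fin 3 → ℝ) {ℓ : ℝ} (hℓ : 0 < ℓ) {N : ℕ} (hN : 0 < N) :
    ⋃ m, box (corner a ℓ N m) (ℓ / N) = box a ℓ := by
  have hN' : (0 : ℝ) < N := by exact_mod_cast hN
  have hh : 0 < ℓ / N := by positivity
  have hNh : (N : ℝ) * (ℓ / N) = ℓ := by field_simp
  ext x
  simp only [mem_iUnion, box, corner, mem_ofPred_eq, mem_Ico]
  constructor
  · rintro ⟨m, hm⟩ i
    have h1 : ((m i : ℕ) : ℝ) + 1 ≤ N := by exact_mod_cast (m i).2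
    have h2 : (0 : ℝ) ≤ (m i : ℕ) * (ℓ / N) := by positivity
    have h3 : (((m i : ℕ) : ℝ) + 1) * (ℓ / N) ≤ N * (ℓ / N) := by gcongr
    exact ⟨by linarith [(hm i).1], by linarith [(hm i).2]⟩
  · intro hx
    have hlt : ∀ i, ⌊(x i - a i) / (ℓ / N)⌋₊ < N := fun i => by
      rw [Nat.floor_lt (div_nonneg (by linarith [(hx i).1]) hh.le), div_lt_iff₀ hh, hNh]
      linarith [(hx i).2]
    refine ⟨fun i => ⟨_, hlt i⟩, fun i => ?_⟩
    have h0 : 0 ≤ (x i - a i) / (ℓ / N) := div_nonneg (by linarith [(hx i).1]) hh.le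
    have h1 := Nat.floor_le h0
    have h2 := Nat.lt_floor_add_one ((x i - a i) / (ℓ / N))
    rw [le_div_iff₀ hh] at h1
    rw [div_lt_iff₀ hh] at h2
    exact ⟨by linarith, by linarith⟩

theorem pairwise_disjoint_box_corner (a : Fin 3 → ℝ) {ℓ : ℝ} (hℓ : 0 < ℓ) {N : ℕ} (hN : 0 < N) :
    Pairwise (Function.onFun Disjoint fun m => box (corner a ℓ N m) (ℓ / N)) := by
  have hN' : (0 : ℝ) < N := by exact_mod_cast hN
  have hh : 0 < ℓ / N := by positivity
  intro m m' hmm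
  refine Set.disjoint_left.2 fun x hx hx' => hmm (funext fun i => Fin.ext ?_)
  have h1 := hx i
  have h2 := hx' i
  simp only [corner, mem_Ico] at h1 h2
  have h3 : ((m i : ℕ) : ℝ) * (ℓ / N) < ((m' i : ℕ) + 1) * (ℓ / N) := by linarith
  have h4 : ((m' i : ℕ) : ℝ) * (ℓ / N) < ((m i : ℕ) + 1) * (ℓ / N) := by linarith
  have h5 := lt_of_mul_lt_mul_right h3 hh.le
  have h6 := lt_of_mul_lt_mul_right h4 hh.le
  have h7 : (m i : ℕ) < (m' i : ℕ) + 1 := by exact_mod_cast h5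
  have h8 : (m' i : ℕ) < (m i : ℕ) + 1 := by exact_mod_cast h6
  omega

theorem lintegral_box_le_sum {p : E3 → E3} (hp : ContDiff ℝ 1 p) (a : Fin 3 → ℝ) {ℓ : ℝ}
    (hℓ : 0 < ℓ) {N : ℕ} (hN : 0 < N) :
    ∫⁻ x in box a ℓ, ‖p x‖ₑ ^ 2 ≤
      16 * (ENNReal.ofReal (2 * (ℓ / N)) ^ 2 * ∫⁻ x in box a ℓ, ‖fderiv ℝ p x‖ₑ ^ 2) +
        ∑ m, 2 * (ENNReal.ofReal (ℓ / N) ^ 3)⁻¹ *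
          ‖∫ x in box (corner a ℓ N m) (ℓ / N), p x‖ₑ ^ 2 := by
  have hN' : (0 : ℝ) < N := by exact_mod_cast hN
  have key : ∀ f : E3 → ENNReal, ∫⁻ x in box a ℓ, f x =
      ∑ m, ∫⁻ x in box (corner a ℓ N m) (ℓ / N), f x := fun f => by
    rw [← iUnion_box_corner a hℓ hN, lintegral_iUnion (fun m => measurableSet_box _ _)
      (pairwise_disjoint_box_corner a hℓ hN), tsum_fintype]
  rw [key, key, Finset.mul_sum, Finset.mul_sum, ← Finset.sum_add_distrib]
  exact Finset.sum_le_sum fun m _ => lintegral_box_le hp _ (by positivity)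

variable {Ω : Set E3}

/-- The square of the integral of `u` over `Q`, as a sum of squares of functionals. -/
theorem sum_inner_indicatorConstLp_sq {Q : Set E3} (hQ : MeasurableSet Q)
    (hQ' : (volume.restrict Ω) Q ≠ ⊤) (u : L2 Ω) :
    ∑ i, inner ℝ (indicatorConstLp 2 hQ hQ' (e i)) u ^ 2 =
      ‖∫ x in Q, u x ∂volume.restrict Ω‖ ^ 2 := by
  rw [EuclideanSpace.norm_sq_eq]
  refine Finset.sum_congr rfl fun i _ => ?_
  rw [L2.inner_indicatorConstLp_eq_inner_setIntegral, EuclideanSpace.inner_single_left]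
  simp

theorem exists_norm_sq_le {a : Fin 3 → ℝ} {ℓ : ℝ} (hℓ : 0 < ℓ) (hΩm : MeasurableSet Ω)
    (hΩ : volume (Ω \ box a ℓ) = 0) {ε : ℝ} (hε : 0 < ε) :
    ∃ (ι : Type) (_ : Fintype ι) (c : ι → ℝ) (g : ι → L2 Ω),
      ∀ w : H1Pair Ω, w ∈ closure {w : H1Pair Ω | ∃ p, ContDiff ℝ 1 p ∧
        (∀ x ∈ box a ℓ \ Ω, p x = 0 ∧ fderiv ℝ p x = 0) ∧ IsClassicalPair w p} →
      ‖w.fst‖ ^ 2 ≤ ε * ‖w‖ ^ 2 + ∑ i, c i * inner ℝ (g i) w.fst ^ 2 := by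
  obtain ⟨N, hN, hNε⟩ : ∃ N : ℕ, 0 < N ∧ 64 * (ℓ / N) ^ 2 ≤ ε := by
    have h0 : Tendsto (fun N : ℕ => 64 * (ℓ / N) ^ 2) atTop (𝓝 (64 * 0 ^ 2)) :=
      ((tendsto_const_div_atTop_nhds_zero_nat ℓ).pow 2).const_mul 64
    norm_num at h0
    obtain ⟨N, h1, h2⟩ := ((h0.eventually_le_const hε).and (eventually_gt_atTop 0)).exists
    exact ⟨N, h2, h1⟩
  have hN' : (0 : ℝ) < N := by exact_mod_cast hN
  set h := ℓ / N with hh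
  have hh0 : 0 < h := by positivity
  have hfin : ∀ m, (volume.restrict Ω) (box (corner a ℓ N m) h) ≠ ⊤ := fun m =>
    ((Measure.restrict_apply_le _ _).trans_lt (by rw [volume_box]; simp)).ne
  refine ⟨(Fin 3 → Fin N) × Fin 3, inferInstance, fun _ => 2 * (h ^ 3)⁻¹,
    fun q => indicatorConstLp 2 (measurableSet_box (corner a ℓ N q.1) h) (hfin q.1) (e q.2), ?_⟩
  intro w hw
  have hfst : Continuous fun w : H1Pair Ω => w.fst :=
    (WithLp.prod_continuous_ofLp 2 (L2 Ω) (PiLp 2 (fun _ : Fin 3 => L2 Ω))).fst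
  refine closure_minimal (t := {w : H1Pair Ω | ‖w.fst‖ ^ 2 ≤ ε * ‖w‖ ^ 2 + ∑ i : (Fin 3 → Fin N) × Fin 3,
    2 * (h ^ 3)⁻¹ * inner ℝ (indicatorConstLp 2 (measurableSet_box (corner a ℓ N i.1) h)
      (hfin i.1) (e i.2)) w.fst ^ 2}) ?_ ?_ hw
  swap
  · exact isClosed_le (by fun_prop) (by fun_prop)
  rintro w ⟨p, hp, hp0, hwp⟩
  rw [mem_ofPred_eq]
  have hboxm := measurableSet_box a ℓ
  have hmain := lintegral_box_le_sum hp a hℓ hN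
  rw [← hh] at hmain
  have hL : ‖w.fst‖ₑ ^ 2 ≤ ∫⁻ x in box a ℓ, ‖p x‖ₑ ^ 2 := by
    rw [← lintegral_enorm_sq_eq w.fst hwp.1]
    refine lintegral_mono' ?_ le_rfl
    exact Measure.restrict_mono' (by
      rw [ae_le_set]; exact hΩ) le_rfl
  have hR : ∫⁻ x in box a ℓ, ‖fderiv ℝ p x‖ₑ ^ 2 ≤ ENNReal.ofReal (‖w‖ ^ 2) := by
    refine le_trans ?_ (hwp.lintegral_fderiv_le hp)
    rw [← lintegral_indicator hboxm, ← lintegral_indicator hΩm]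
    refine lintegral_mono fun x => ?_
    by_cases hx : x ∈ Ω
    · rw [indicator_of_mem hx]
      exact indicator_le_self _ _ _
    · by_cases hxb : x ∈ box a ℓ
      · have h0 : ‖fderiv ℝ p x‖ₑ = 0 := by
          rw [← ofReal_norm, (hp0 x ⟨hxb, hx⟩).2]
          simp
        rw [indicator_of_mem hxb, h0]
        simp
      · rw [indicator_of_notMem hxb]; exact zero_le
  have hI : ∀ m, ∫ x in box (corner a ℓ N m) h, p x =
      ∫ x in box (corner a ℓ N m) h, w.fst x ∂volume.restrict Ω := by
    intro m
    have hsub : box (corner a ℓ N m) h ⊆ box a ℓ := by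
      rw [← iUnion_box_corner a hℓ hN]
      exact subset_iUnion (fun m => box (corner a ℓ N m) h) m
    rw [integral_congr_ae (ae_restrict_of_ae hwp.1), Measure.restrict_restrict (measurableSet_box _ _)]
    refine setIntegral_eq_of_subset_of_forall_sdiff_eq_zero (measurableSet_box _ _)
      inter_subset_left fun x hx => ?_
    exact (hp0 x ⟨hsub hx.1, fun h => hx.2 ⟨hx.1, h⟩⟩).1
  have hS : ∑ m, 2 * (ENNReal.ofReal h ^ 3)⁻¹ * ‖∫ x in box (corner a ℓ N m) h, p x‖ₑ ^ 2 =
      ENNReal.ofReal (∑ i : (Fin 3 → Fin N) × Fin 3,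
        2 * (h ^ 3)⁻¹ * inner ℝ (indicatorConstLp 2 (measurableSet_box (corner a ℓ N i.1) h)
        (hfin i.1) (e i.2)) w.fst ^ 2) := by
    rw [Fintype.sum_prod_type]
    simp only [← Finset.mul_sum]
    rw [Finset.sum_congr rfl fun m _ => sum_inner_indicatorConstLp_sq
      (measurableSet_box (corner a ℓ N m) h) (hfin m) w.fst, ENNReal.ofReal_mul (by positivity), ENNReal.ofReal_sum_of_nonneg fun _ _ => sq_nonneg _]
    congr 1
    · rw [ENNReal.ofReal_mul (by norm_num), ENNReal.ofReal_inv_of_pos (by positivity),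
        ENNReal.ofReal_pow hh0.le]
      simp
    · refine Finset.sum_congr rfl fun m _ => ?_
      rw [hI, ← ofReal_norm, ENNReal.ofReal_pow (norm_nonneg _)]
  rw [hS] at hmain
  have hfinal : ENNReal.ofReal (‖w.fst‖ ^ 2) ≤ ENNReal.ofReal (ε * ‖w‖ ^ 2) + ENNReal.ofReal
      (∑ i : (Fin 3 → Fin N) × Fin 3,
        2 * (h ^ 3)⁻¹ * inner ℝ (indicatorConstLp 2 (measurableSet_box (corner a ℓ N i.1) h)
        (hfin i.1) (e i.2)) w.fst ^ 2) := by
    rw [ENNReal.ofReal_pow (norm_nonneg _), ofReal_norm]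
    refine (hL.trans hmain).trans (add_le_add ?_ le_rfl)
    calc 16 * (ENNReal.ofReal (2 * h) ^ 2 * ∫⁻ x in box a ℓ, ‖fderiv ℝ p x‖ₑ ^ 2)
        ≤ ENNReal.ofReal 16 * (ENNReal.ofReal ((2 * h) ^ 2) * ENNReal.ofReal (‖w‖ ^ 2)) := by
          rw [ENNReal.ofReal_pow (by positivity)]
          gcongr
          simp
      _ = ENNReal.ofReal (64 * h ^ 2 * ‖w‖ ^ 2) := by
          rw [← ENNReal.ofReal_mul (by positivity), ← ENNReal.ofReal_mul (by positivity)]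
          congr 1; ring
      _ ≤ _ := ENNReal.ofReal_le_ofReal (by gcongr)
  rw [← ENNReal.ofReal_add (by positivity)
    (Finset.sum_nonneg fun _ _ => mul_nonneg (by positivity) (sq_nonneg _))] at hfinal
  exact (ENNReal.ofReal_le_ofReal_iff (add_nonneg (by positivity)
    (Finset.sum_nonneg fun _ _ => mul_nonneg (by positivity) (sq_nonneg _)))).1 hfinal

end Rellich

end

section

/-! ### The eigenvalues tend to infinity -/

theorem isClosed_cube (L : ℝ) : IsClosed (cube L) := by
  have : cube L = ⋂ i, {x : E3 | x i ∈ Icc 0 L} := by ext x; simp [cube]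
  rw [this]
  exact isClosed_iInter fun i => isClosed_Icc.preimage (by fun_prop)

theorem volume_cube_diff_box (L : ℝ) : volume (cube L \ box 0 L) = 0 := by
  have h1 : cube L \ box 0 L = (WithLp.ofLp : E3 → Fin 3 → ℝ) ⁻¹'
      (Icc (fun _ => 0) (fun _ => L) \ univ.pi fun _ => Ico 0 L) := by
    ext x
    simp [cube, box, Pi.le_def, forall_and]
  rw [h1, (PiLp.volume_preserving_ofLp (Fin 3)).measure_preimage
    (measurableSet_Icc.diff (MeasurableSet.univ_pi fun _ => measurableSet_Ico)).nullMeasurableSet]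
  exact ae_le_set.1 (Measure.univ_pi_Ico_ae_eq_Icc (μ := fun _ : Fin 3 => (volume : Measure ℝ))
    (f := fun _ => (0 : ℝ)) (g := fun _ => L)).symm.le

theorem PrecompactForm.exists_lt {E : Type*} [NormedAddCommGroup E] {q : E → ℝ}
    [NormedSpace ℝ E] (h : PrecompactForm q) {x : ℕ → E} (hx : ∀ j, ‖x j‖ ≤ 1) {δ : ℝ}
    (hδ : 0 < δ) : ∃ i j, i ≠ j ∧ q (x i - x j) < δ := by
  have hlim := h ((hyperfilter ℕ).map x) (by
    rw [Ultrafilter.mem_map]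
    exact Filter.univ_mem' fun j => by simpa using hx j)
  rw [Ultrafilter.coe_map, prod_map_map_eq] at hlim
  have hev := hlim.eventually_lt_const hδ
  rw [eventually_map] at hev
  obtain ⟨i, hi⟩ := hev.curry.exists
  have hne : ∀ᶠ j in (hyperfilter ℕ : Filter ℕ), j ≠ i :=
    hyperfilter_le_cofinite (finite_singleton i).compl_mem_cofinite
  obtain ⟨j, hj, hij⟩ := (hi.and hne).exists
  exact ⟨i, j, hij.symm, hj⟩

variable {S : FlowSpaces}

theorem FlowSpaces.IsPeriodicOrNoSlip.exists_box (hS : S.IsPeriodicOrNoSlip) :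
    ∃ (a : Fin 3 → ℝ) (ℓ : ℝ), 0 < ℓ ∧ MeasurableSet S.Ω ∧ volume (S.Ω \ box a ℓ) = 0 ∧
      ∀ w ∈ S.V, w ∈ closure {w : H1Pair S.Ω | ∃ p, ContDiff ℝ 1 p ∧
        (∀ x ∈ box a ℓ \ S.Ω, p x = 0 ∧ fderiv ℝ p x = 0) ∧ IsClassicalPair w p} := by
  rcases hS with ⟨L, hL, rfl⟩ | ⟨Ω, hΩ, -, hb, -, rfl⟩
  · refine ⟨0, L, hL, (isClosed_cube L).measurableSet, volume_cube_diff_box L, fun w hw => ?_⟩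
    refine closure_mono ?_ (mem_closure_of_mem_periodicV hw)
    rintro w ⟨p, hp, hwp⟩
    refine ⟨p, (contDiff_of_mem_trigPoly hp).of_le (by simp), fun x hx => ?_, hwp⟩
    refine absurd (fun i => ?_) hx.2
    have := hx.1 i
    simp only [Pi.zero_apply, zero_add] at this
    exact Ico_subset_Icc_self this
  · obtain ⟨R, hR, hΩR⟩ := hb.subset_closedBall_lt 0 0
    refine ⟨fun _ => -R, 3 * R, by positivity, hΩ.measurableSet, ?_, fun w hw => ?_⟩
    · have : Ω ⊆ box (fun _ => -R) (3 * R) := fun x hx i => by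
        have h1 : ‖x‖ ≤ R := by simpa using hΩR hx
        have h2 := abs_le.1 ((PiLp.norm_apply_le x i).trans h1)
        exact ⟨h2.1, by linarith [h2.2]⟩
      change volume (Ω \ _) = 0
      rw [sdiff_eq_empty.2 this, measure_empty]
    · refine closure_mono ?_ (mem_closure_of_mem_noSlipV hw)
      rintro w ⟨p, hp, hwp⟩
      refine ⟨p, hp.1.of_le (by simp), fun x hx => ?_, hwp⟩
      have hx' : x ∉ tsupport p := fun h => hx.2 (hp.2.2 h)
      exact ⟨image_eq_zero_of_notMem_tsupport hx', image_eq_zero_of_notMem_tsupport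
        fun h => hx' (tsupport_fderiv_subset ℝ h)⟩

theorem precompactForm_toH (hS : S.IsPeriodicOrNoSlip) :
    PrecompactForm fun w : S.V => ‖S.toH w‖ ^ 2 := by
  obtain ⟨a, ℓ, hℓ, hΩm, hΩ, hcl⟩ := hS.exists_box
  refine .of_forall_le (fun w => sq_nonneg _) fun ε hε => ?_
  obtain ⟨ι, _, c, g, hg⟩ := exists_norm_sq_le hℓ hΩm hΩ hε
  let F : S.V →L[ℝ] L2 S.Ω :=
    (WithLp.fstL 2 ℝ (L2 S.Ω) (PiLp 2 (fun _ : Fin 3 => L2 S.Ω))).comp S.V.subtypeL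
  refine ⟨fun w => ∑ i, c i * ((innerSL ℝ (g i)).comp F) w ^ 2,
    .sum _ fun i _ => (PrecompactForm.functional_sq _).const_mul _, fun w => ?_⟩
  exact hg w.1 (hcl w.1 w.2)

theorem norm_sq_eq_add_dirichlet (w : S.V) :
    ‖w‖ ^ 2 = ‖S.toH w‖ ^ 2 + FlowSpaces.dirichlet w w := by
  have h1 : ‖w‖ ^ 2 = ‖w.1.fst‖ ^ 2 + ‖w.1.snd‖ ^ 2 := WithLp.prod_norm_sq_eq_of_L2 w.1
  rw [h1, PiLp.norm_sq_eq_of_L2]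
  simp only [FlowSpaces.dirichlet, real_inner_self_eq_norm_sq]
  rfl

namespace StokesBasis

variable (b : StokesBasis S)

theorem inner_basis (i j : ℕ) : inner ℝ (b.basis i) (b.basis j) = if i = j then (1 : ℝ) else 0 :=
  (orthonormal_iff_ite.1 b.basis.orthonormal) i j

theorem dirichlet_vec (i j : ℕ) :
    FlowSpaces.dirichlet (b.vec i) (b.vec j) = if i = j then b.lam i else 0 := by
  rw [b.eigen, b.toH_vec, b.inner_basis]
  split_ifs <;> simp

theorem norm_vec_sq (j : ℕ) : ‖b.vec j‖ ^ 2 = 1 + b.lam j := by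
  rw [norm_sq_eq_add_dirichlet, b.toH_vec, b.dirichlet_vec, if_pos rfl,
    b.basis.orthonormal.1, one_pow]

theorem tendsto_lam (hS : S.IsPeriodicOrNoSlip) : Tendsto b.lam atTop atTop := by
  rcases tendsto_atTop_of_monotone b.lam_mono with h | ⟨l, hl⟩
  · exact h
  exfalso
  have hle : ∀ j, b.lam j ≤ l := fun j => b.lam_mono.ge_of_tendsto hl j
  have hl0 : 0 < 1 + l := by linarith [b.lam_pos 0, hle 0]
  set c : ℝ := (√(1 + l))⁻¹ with hc
  have hc2 : c ^ 2 = (1 + l)⁻¹ := by rw [hc, inv_pow, Real.sq_sqrt hl0.le]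
  let x : ℕ → S.V := fun j => c • b.vec j
  have hx : ∀ j, ‖x j‖ ≤ 1 := fun j => by
    refine abs_le_of_sq_le_sq' ?_ zero_le_one |>.2
    rw [norm_smul, mul_pow, b.norm_vec_sq, Real.norm_eq_abs, sq_abs, hc2, inv_mul_eq_div, one_pow,
      div_le_one hl0]
    linarith [hle j]
  have hq : ∀ i j, i ≠ j → ‖S.toH (x i - x j)‖ ^ 2 = 2 * (1 + l)⁻¹ := fun i j hij => by
    have : S.toH (x i - x j) = c • (b.basis i - b.basis j) := by
      simp only [x, map_sub, map_smul, b.toH_vec, smul_sub]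
    rw [this, norm_smul, mul_pow, Real.norm_eq_abs, sq_abs, hc2, norm_sub_sq_real,
      b.basis.orthonormal.1, b.basis.orthonormal.1, b.inner_basis, if_neg hij]
    ring
  obtain ⟨i, j, hij, hlt⟩ := (precompactForm_toH hS).exists_lt hx
    (show (0 : ℝ) < 2 * (1 + l)⁻¹ by positivity)
  exact hlt.ne (hq i j hij)

end StokesBasis

end

section

/-! ### The embedding of `V` into `L⁴` -/

section Sobolev

variable {Ω : Set E3}

theorem exists_eLpNorm_four_le_lintegral_fderiv (R : ℝ) :
    ∃ C : NNReal, ∀ g : E3 → E3, ContDiff ℝ 1 g → Function.support g ⊆ Metric.closedBall 0 R →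
      eLpNorm g 4 volume ≤ C * (∫⁻ x, ‖fderiv ℝ g x‖ₑ ^ 2) ^ (1 / 2 : ℝ) := by
  refine ⟨eLpNormLESNormFDerivOfLeConst E3 (volume : Measure E3) (Metric.closedBall 0 R) 2 4,
    fun g hg hgs => ?_⟩
  have h := eLpNorm_le_eLpNorm_fderiv_of_le (volume : Measure E3) hg hgs (p := 2) (q := 4)
    (by norm_num) (by rw [finrank_euclideanSpace_fin]; norm_num)
    (by rw [finrank_euclideanSpace_fin]; norm_num) Metric.isBounded_closedBall
  have h2 : eLpNorm (fderiv ℝ g) 2 volume = (∫⁻ x, ‖fderiv ℝ g x‖ₑ ^ 2) ^ (1 / 2 : ℝ) := by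
    rw [eLpNorm_eq_lintegral_rpow_enorm_toReal (by simp) (by simp)]
    simp
  rw [← h2]
  exact_mod_cast h

theorem eLpNorm_four_le_of_mem_closure {A : Set (H1Pair Ω)} {C : NNReal}
    (hA : ∀ w ∈ A, eLpNorm w.fst 4 (volume.restrict Ω) ≤ C * ‖w‖ₑ) {w : H1Pair Ω}
    (hw : w ∈ closure A) : eLpNorm w.fst 4 (volume.restrict Ω) ≤ C * ‖w‖ₑ := by
  obtain ⟨x, hxA, hx⟩ := mem_closure_iff_seq_limit.1 hw
  have hfst : Continuous fun w : H1Pair Ω => w.fst :=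
    (WithLp.prod_continuous_ofLp 2 (L2 Ω) (PiLp 2 (fun _ : Fin 3 => L2 Ω))).fst
  have h1 : Tendsto (fun n => (x n).fst) atTop (𝓝 w.fst) := (hfst.tendsto w).comp hx
  obtain ⟨s, hs, hae⟩ := (tendstoInMeasure_of_tendsto_Lp h1).exists_seq_tendsto_ae
  refine (Lp.eLpNorm_lim_le_liminf_eLpNorm (fun n => Lp.aestronglyMeasurable (x (s n)).fst) _
    hae).trans ?_
  have h2 : Tendsto (fun n => (C : ENNReal) * ‖x (s n)‖ₑ) atTop (𝓝 (C * ‖w‖ₑ)) :=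
    ENNReal.Tendsto.const_mul ((continuous_enorm.tendsto w).comp (hx.comp hs.tendsto_atTop))
      (Or.inr (by simp))
  rw [← h2.liminf_eq]
  exact liminf_le_liminf (.of_forall fun n => hA _ (hxA _))

theorem exists_eLpNorm_four_le_of_extension {A : Set (H1Pair Ω)} {R : ℝ} {K : NNReal}
    (hA : ∀ w ∈ A, ∃ g : E3 → E3, ContDiff ℝ 1 g ∧ Function.support g ⊆ Metric.closedBall 0 R ∧
      w.fst =ᵐ[volume.restrict Ω] g ∧ ∫⁻ x, ‖fderiv ℝ g x‖ₑ ^ 2 ≤ (K * ‖w‖ₑ) ^ 2) :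
    ∃ C : NNReal, ∀ w ∈ closure A, eLpNorm w.fst 4 (volume.restrict Ω) ≤ C * ‖w‖ₑ := by
  obtain ⟨C, hC⟩ := exists_eLpNorm_four_le_lintegral_fderiv R
  refine ⟨C * K, fun w hw => eLpNorm_four_le_of_mem_closure (fun w hw => ?_) hw⟩
  obtain ⟨g, hg, hgs, hwg, hgi⟩ := hA w hw
  rw [eLpNorm_congr_ae hwg]
  calc eLpNorm g 4 (volume.restrict Ω) ≤ eLpNorm g 4 volume :=
        eLpNorm_mono_measure _ Measure.restrict_le_self
    _ ≤ C * (∫⁻ x, ‖fderiv ℝ g x‖ₑ ^ 2) ^ (1 / 2 : ℝ) := hC g hg hgs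
    _ ≤ C * ((K * ‖w‖ₑ) ^ 2) ^ (1 / 2 : ℝ) := by gcongr
    _ = (C * K : NNReal) * ‖w‖ₑ := by
        rw [← ENNReal.rpow_natCast, ← ENNReal.rpow_mul]
        norm_num [mul_assoc]

theorem exists_eLpNorm_four_le_noSlip (hb : Bornology.IsBounded Ω) (hΩm : MeasurableSet Ω) :
    ∃ C : NNReal, ∀ w ∈ noSlipV Ω, eLpNorm w.fst 4 (volume.restrict Ω) ≤ C * ‖w‖ₑ := by
  obtain ⟨R, hR, hΩR⟩ := hb.subset_closedBall_lt 0 0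
  obtain ⟨C, hC⟩ := exists_eLpNorm_four_le_of_extension (Ω := Ω) (R := R) (K := 1)
    (A := {w : H1Pair Ω | ∃ p ∈ testFields Ω, IsClassicalPair w p}) (by
      rintro w ⟨p, hp, hwp⟩
      have hp1 : ContDiff ℝ 1 p := hp.1.of_le (by simp)
      refine ⟨p, hp1, ((subset_tsupport p).trans hp.2.2).trans hΩR, hwp.1, ?_⟩
      have h1 : ∫⁻ x, ‖fderiv ℝ p x‖ₑ ^ 2 = ∫⁻ x in Ω, ‖fderiv ℝ p x‖ₑ ^ 2 := by
        rw [← lintegral_indicator hΩm]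
        refine lintegral_congr fun x => ?_
        by_cases hx : x ∈ Ω
        · rw [indicator_of_mem hx]
        · have h0 : fderiv ℝ p x = 0 := image_eq_zero_of_notMem_tsupport
            fun h => hx (hp.2.2 (tsupport_fderiv_subset ℝ h))
          have h0' : ‖fderiv ℝ p x‖ₑ = 0 := by rw [← ofReal_norm, h0]; simp
          rw [indicator_of_notMem hx, h0']
          simp
      rw [h1]
      refine (hwp.lintegral_fderiv_le hp1).trans_eq ?_
      rw [ENNReal.ofReal_pow (norm_nonneg _), ofReal_norm]
      simp)
  exact ⟨C, fun w hw => hC w (mem_closure_of_mem_noSlipV hw)⟩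

/-- The vector `L m` of the lattice of periods. -/
def latticeVec (L : ℝ) (m : Fin 3 → ℤ) : E3 := WithLp.toLp 2 fun i => L * m i

theorem phase_add_latticeVec {L : ℝ} (hL : L ≠ 0) (k m : Fin 3 → ℤ) (x : E3) :
    phase L k (x + latticeVec L m) = phase L k x + ((∑ i, k i * m i : ℤ) : ℝ) * (2 * Real.pi) := by
  simp only [phase, latticeVec, PiLp.add_apply, mul_add, Finset.sum_add_distrib]
  push_cast
  rw [Finset.sum_mul, Finset.mul_sum, Finset.mul_sum]
  congr 1
  refine Finset.sum_congr rfl fun i _ => ?_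
  field_simp

theorem trigPoly_add_latticeVec {L : ℝ} (hL : L ≠ 0) {p : E3 → E3} (hp : p ∈ trigPoly L)
    (m : Fin 3 → ℤ) (x : E3) : p (x + latticeVec L m) = p x := by
  induction hp using Submodule.span_induction with
  | mem p hp =>
    obtain ⟨k, a, rfl | rfl⟩ := hp
    · simp only [phase_add_latticeVec hL, Real.cos_add_int_mul_two_pi]
    · simp only [phase_add_latticeVec hL, Real.sin_add_int_mul_two_pi]
  | zero => rfl
  | add p q _ _ h1 h2 => rw [Pi.add_apply, Pi.add_apply, h1, h2]
  | smul c p _ h1 => rw [Pi.smul_apply, Pi.smul_apply, h1]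

theorem lintegral_box_latticeVec {L : ℝ} {f : E3 → ENNReal}
    (hf : ∀ (m : Fin 3 → ℤ) x, f (x + latticeVec L m) = f x) (m : Fin 3 → ℤ) :
    ∫⁻ x in box (fun i => L * m i) L, f x = ∫⁻ x in box 0 L, f x := by
  rw [← lintegral_indicator (measurableSet_box _ _), ← lintegral_indicator (measurableSet_box _ _),
    ← lintegral_add_right_eq_self _ (latticeVec L m)]
  refine lintegral_congr fun x => ?_
  have hiff : x + latticeVec L m ∈ box (fun i => L * m i) L ↔ x ∈ box 0 L := by
    simp only [box, mem_ofPred_eq, mem_Ico, PiLp.add_apply, latticeVec, Pi.zero_apply, zero_add]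
    refine forall_congr' fun i => ?_
    constructor <;> rintro ⟨h1, h2⟩ <;> constructor <;> linarith
  by_cases hx : x ∈ box 0 L
  · rw [indicator_of_mem hx, indicator_of_mem (hiff.2 hx), hf]
  · rw [indicator_of_notMem hx, indicator_of_notMem fun h => hx (hiff.1 h)]

theorem lintegral_large_box {L : ℝ} (hL : 0 < L) {f : E3 → ENNReal}
    (hf : ∀ (m : Fin 3 → ℤ) x, f (x + latticeVec L m) = f x) :
    ∫⁻ x in box (fun _ => -(3 * L)) (6 * L), f x ≤ 216 * ∫⁻ x in cube L, f x := by
  have hL6 : 6 * L / (6 : ℕ) = L := by push_cast; field_simp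
  rw [← iUnion_box_corner (fun _ => -(3 * L)) (by positivity : 0 < 6 * L) (N := 6) (by norm_num),
    lintegral_iUnion (fun m => measurableSet_box _ _)
      (pairwise_disjoint_box_corner _ (by positivity) (by norm_num)), tsum_fintype, hL6]
  have h1 : ∀ m : Fin 3 → Fin 6, ∫⁻ x in box (corner (fun _ => -(3 * L)) (6 * L) 6 m) L, f x =
      ∫⁻ x in box 0 L, f x := fun m => by
    rw [← lintegral_box_latticeVec hf fun i => ((m i : ℕ) : ℤ) - 3]
    congr 3
    ext i
    rw [corner, hL6]
    push_cast
    ring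
  rw [Finset.sum_congr rfl fun m _ => h1 m, Finset.sum_const, nsmul_eq_mul]
  have hc : ((Finset.univ : Finset (Fin 3 → Fin 6)).card : ENNReal) = 216 := by simp
  rw [hc]
  gcongr
  intro x hx i
  have := hx i
  simp only [Pi.zero_apply, zero_add] at this
  exact Ico_subset_Icc_self this

theorem exists_eLpNorm_four_le_periodic {L : ℝ} (hL : 0 < L) :
    ∃ C : NNReal, ∀ w ∈ periodicV L, eLpNorm w.fst 4 (volume.restrict (cube L)) ≤ C * ‖w‖ₑ := by
  let χ : ContDiffBump (0 : E3) := ⟨2 * L, 3 * L, by positivity, by linarith⟩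
  have hχ : ContDiff ℝ 1 χ := χ.contDiff
  have hχd : Continuous (fderiv ℝ χ) := hχ.continuous_fderiv (by simp)
  obtain ⟨M, hM⟩ := hχd.bounded_above_of_compact_support (χ.hasCompactSupport.fderiv ℝ)
  have hM0 : 0 ≤ M := (norm_nonneg _).trans (hM 0)
  set N : NNReal := ⟨1 + M, by linarith⟩ with hN
  have hNr : (N : ℝ) = 1 + M := rfl
  obtain ⟨C, hC⟩ := exists_eLpNorm_four_le_of_extension (Ω := cube L) (R := 3 * L) (K := 30 * N)
    (A := {w : H1Pair (cube L) | ∃ p ∈ trigPoly L, IsClassicalPair w p}) (by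
      rintro w ⟨p, hp, hwp⟩
      have hp1 : ContDiff ℝ 1 p := (contDiff_of_mem_trigPoly hp).of_le (by simp)
      have hpd : Differentiable ℝ p := hp1.differentiable (by simp)
      have hdc : Continuous (fderiv ℝ p) := hp1.continuous_fderiv (by simp)
      have hsupp : ∀ x, x ∉ box (fun _ => -(3 * L)) (6 * L) → x ∉ Metric.ball (0 : E3) (3 * L) := by
        intro x hx hxb
        refine hx fun i => ?_
        have h1 : ‖x‖ < 3 * L := by simpa using hxb
        have h2 := abs_lt.1 ((PiLp.norm_apply_le x i).trans_lt h1)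
        exact ⟨h2.1.le, by linarith [h2.2]⟩
      refine ⟨fun x => χ x • p x, hχ.smul hp1, ?_, ?_, ?_⟩
      · refine fun x hx => Metric.ball_subset_closedBall (χ.support_eq ▸ fun h0 => hx ?_)
        change χ x • p x = 0
        rw [h0, zero_smul]
      · filter_upwards [hwp.1, ae_restrict_mem (isClosed_cube L).measurableSet] with x h1 h2
        rw [h1, χ.one_of_mem_closedBall, one_smul]
        rw [mem_closedBall_zero_iff]
        exact norm_le_of_abs_le hL.le fun i => abs_le.2 ⟨by linarith [(h2 i).1], (h2 i).2⟩
      · have hpt : ∀ x, ‖fderiv ℝ (fun x => χ x • p x) x‖ₑ ^ 2 ≤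
            (box (fun _ => -(3 * L)) (6 * L)).indicator
              (fun x => 2 * (N : ENNReal) ^ 2 * (‖p x‖ₑ ^ 2 + ‖fderiv ℝ p x‖ₑ ^ 2)) x := by
          intro x
          have hfd : fderiv ℝ (fun x => χ x • p x) x =
              χ x • fderiv ℝ p x + (fderiv ℝ χ x).smulRight (p x) :=
            fderiv_smul (hχ.differentiable (by simp) x) (hpd x)
          by_cases hx : x ∈ box (fun _ => -(3 * L)) (6 * L)
          · rw [indicator_of_mem hx]
            have hn : ‖fderiv ℝ (fun x => χ x • p x) x‖ ≤
                (1 + M) * (‖p x‖ + ‖fderiv ℝ p x‖) := by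
              rw [hfd]
              refine (norm_add_le _ _).trans ?_
              rw [norm_smul, ContinuousLinearMap.norm_smulRight_apply,
                Real.norm_of_nonneg χ.nonneg]
              have h1 : (χ x : ℝ) ≤ 1 := χ.le_one
              have h2 := hM x
              have h3 := norm_nonneg (p x)
              have h4 := norm_nonneg (fderiv ℝ p x)
              nlinarith [mul_le_mul_of_nonneg_right h1 h4, mul_le_mul_of_nonneg_right h2 h3]
            have hsq : ‖fderiv ℝ (fun x => χ x • p x) x‖ ^ 2 ≤
                2 * (1 + M) ^ 2 * (‖p x‖ ^ 2 + ‖fderiv ℝ p x‖ ^ 2) := by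
              refine (pow_le_pow_left₀ (norm_nonneg _) hn 2).trans ?_
              rw [mul_pow]
              nlinarith [sq_nonneg (‖p x‖ - ‖fderiv ℝ p x‖), sq_nonneg (1 + M),
                mul_nonneg (sq_nonneg (1 + M)) (sq_nonneg (‖p x‖ - ‖fderiv ℝ p x‖))]
            have hN' : (N : ENNReal) = ENNReal.ofReal (1 + M) := by
              rw [← hNr, ENNReal.ofReal_coe_nnreal]
            rw [hN']
            simp only [← ofReal_norm]
            rw [← ENNReal.ofReal_pow (norm_nonneg _), ← ENNReal.ofReal_pow (norm_nonneg _),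
              ← ENNReal.ofReal_pow (norm_nonneg _), ← ENNReal.ofReal_pow (by linarith),
              ← ENNReal.ofReal_add (sq_nonneg _) (sq_nonneg _),
              mul_assoc, ← ENNReal.ofReal_mul (by positivity)]
            refine (ENNReal.ofReal_le_ofReal (hsq.trans_eq (mul_assoc _ _ _))).trans_eq ?_
            rw [ENNReal.ofReal_mul zero_le_two, ENNReal.ofReal_ofNat]
          · have hz : χ x = 0 := χ.zero_of_le_dist (by simpa using hsupp x hx)
            have hmin : IsLocalMin χ x := Filter.Eventually.of_forall fun y => by
              rw [hz]
              exact χ.nonneg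
            have h0 : fderiv ℝ (fun x => χ x • p x) x = 0 := by
              rw [hfd, hmin.fderiv_eq_zero, hz]
              ext
              simp
            have h0' : ‖fderiv ℝ (fun x => χ x • p x) x‖ₑ = 0 := by rw [← ofReal_norm, h0]; simp
            rw [h0']
            simp
        refine (lintegral_mono hpt).trans ?_
        rw [lintegral_indicator (measurableSet_box _ _),
          lintegral_const_mul' _ _ (by finiteness)]
        have hper : ∀ (m : Fin 3 → ℤ) x, ‖p (x + latticeVec L m)‖ₑ ^ 2 +
            ‖fderiv ℝ p (x + latticeVec L m)‖ₑ ^ 2 = ‖p x‖ₑ ^ 2 + ‖fderiv ℝ p x‖ₑ ^ 2 := by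
          intro m x
          have h1 : (fun x => p (x + latticeVec L m)) = p :=
            funext fun x => trigPoly_add_latticeVec hL.ne' hp m x
          rw [trigPoly_add_latticeVec hL.ne' hp, ← fderiv_comp_add_right, h1]
        have hbox := lintegral_large_box hL (f := fun x => ‖p x‖ₑ ^ 2 + ‖fderiv ℝ p x‖ₑ ^ 2) hper
        have hcube : ∫⁻ x in cube L, (‖p x‖ₑ ^ 2 + ‖fderiv ℝ p x‖ₑ ^ 2) ≤ 2 * ‖w‖ₑ ^ 2 := by
          rw [lintegral_add_left (hp1.continuous.enorm.measurable.pow_const 2),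
            lintegral_enorm_sq_eq w.fst hwp.1, two_mul]
          refine add_le_add ?_ ?_
          · gcongr
            rw [← ofReal_norm, ← ofReal_norm]
            exact ENNReal.ofReal_le_ofReal (norm_fst_le w)
          · refine (hwp.lintegral_fderiv_le hp1).trans_eq ?_
            rw [ENNReal.ofReal_pow (norm_nonneg _), ofReal_norm]
        calc 2 * (N : ENNReal) ^ 2 * ∫⁻ x in box (fun _ => -(3 * L)) (6 * L),
              (‖p x‖ₑ ^ 2 + ‖fderiv ℝ p x‖ₑ ^ 2)
            ≤ 2 * (N : ENNReal) ^ 2 * (216 * (2 * ‖w‖ₑ ^ 2)) := by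
              gcongr
              exact hbox.trans (by gcongr)
          _ = 864 * ((N : ENNReal) ^ 2 * ‖w‖ₑ ^ 2) := by ring
          _ ≤ 900 * ((N : ENNReal) ^ 2 * ‖w‖ₑ ^ 2) := by gcongr; norm_num
          _ = ((30 * N : NNReal) * ‖w‖ₑ) ^ 2 := by push_cast; ring)
  exact ⟨C, fun w hw => hC w (mem_closure_of_mem_periodicV hw)⟩

theorem FlowSpaces.IsPeriodicOrNoSlip.exists_eLpNorm_four_le {S : FlowSpaces}
    (hS : S.IsPeriodicOrNoSlip) :
    ∃ C : NNReal, ∀ w : S.V, eLpNorm w.1.fst 4 (volume.restrict S.Ω) ≤ C * ‖w‖ₑ := by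
  rcases hS with ⟨L, hL, rfl⟩ | ⟨Ω, hΩ, -, hb, -, rfl⟩
  · obtain ⟨C, hC⟩ := exists_eLpNorm_four_le_periodic hL
    exact ⟨C, fun w => hC w.1 w.2⟩
  · obtain ⟨C, hC⟩ := exists_eLpNorm_four_le_noSlip hb hΩ.measurableSet
    exact ⟨C, fun w => hC w.1 w.2⟩

end Sobolev

end

section

/-! ### The trilinear form is continuous -/

section Trilinear

theorem holderTriple_four : ENNReal.HolderTriple 4 4 2 where
  inv_add_inv_eq_inv := by
    have h4 : (4 : ENNReal) = 2 * 2 := by norm_num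
    rw [h4, ENNReal.mul_inv (by simp) (by simp), ← mul_add, ENNReal.inv_two_add_inv_two, mul_one]

variable {X : Type*} [MeasurableSpace X] {μ : Measure X}
  {V : Type*} [NormedAddCommGroup V] [NormedSpace ℝ V]

theorem aestronglyMeasurable_coord (u : Lp E3 2 μ) (j : Fin 3) :
    AEStronglyMeasurable (fun x => u x j) μ :=
  (by fun_prop : Continuous fun y : E3 => y j).comp_aestronglyMeasurable
    (Lp.aestronglyMeasurable u)

/-- If `V` embeds into `L⁴`, the products `u_j w` for `u, w ∈ V` are in `L²`. -/
theorem exists_product_map (F : V →L[ℝ] Lp E3 2 μ) {C : NNReal}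
    (hC : ∀ w, eLpNorm (F w) 4 μ ≤ C * ‖w‖ₑ) (j : Fin 3) :
    ∃ P : V →L[ℝ] V →L[ℝ] Lp E3 2 μ, ∀ u w : V,
      P u w =ᵐ[μ] fun x => F u x j • F w x := by
  have hle : ∀ u w : V, eLpNorm (fun x => F u x j • F w x) 2 μ ≤
      (C * ‖u‖ₑ) * (C * ‖w‖ₑ) := fun u w => by
    have := holderTriple_four
    refine (eLpNorm_smul_le_mul_eLpNorm (p := 4) (q := 4) (r := 2)
      (Lp.aestronglyMeasurable (F w)) (aestronglyMeasurable_coord (F u) j)).trans ?_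
    exact mul_le_mul' ((eLpNorm_mono fun x => PiLp.norm_apply_le (F u x) j).trans (hC u)) (hC w)
  have hmem : ∀ u w : V, MemLp (fun x => F u x j • F w x) 2 μ := fun u w =>
    ⟨(aestronglyMeasurable_coord (F u) j).smul (Lp.aestronglyMeasurable (F w)),
      (hle u w).trans_lt (by finiteness)⟩
  have hadd : ∀ u v : V, F (u + v) =ᵐ[μ] F u + F v :=
    fun u v => by rw [map_add]; exact Lp.coeFn_add (F u) (F v)
  have hsmul : ∀ (c : ℝ) (u : V), F (c • u) =ᵐ[μ] c • ⇑(F u) :=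
    fun c u => by rw [map_smul]; exact Lp.coeFn_smul c (F u)
  let P₀ : V →ₗ[ℝ] V →ₗ[ℝ] Lp E3 2 μ := LinearMap.mk₂ ℝ (fun u w => (hmem u w).toLp _)
    (fun u v w => by
      rw [← MemLp.toLp_add]
      refine MemLp.toLp_congr _ _ ?_
      filter_upwards [hadd u v] with x hx
      rw [hx, Pi.add_apply, Pi.add_apply, PiLp.add_apply, add_smul])
    (fun c u w => by
      rw [← MemLp.toLp_const_smul]
      refine MemLp.toLp_congr _ _ ?_
      filter_upwards [hsmul c u] with x hx
      rw [hx, Pi.smul_apply, Pi.smul_apply, PiLp.smul_apply, smul_assoc])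
    (fun u v w => by
      rw [← MemLp.toLp_add]
      refine MemLp.toLp_congr _ _ ?_
      filter_upwards [hadd v w] with x hx
      rw [hx, Pi.add_apply, Pi.add_apply, smul_add])
    (fun c u w => by
      rw [← MemLp.toLp_const_smul]
      refine MemLp.toLp_congr _ _ ?_
      filter_upwards [hsmul c w] with x hx
      rw [hx, Pi.smul_apply, Pi.smul_apply, smul_comm])
  refine ⟨P₀.mkContinuous₂ (C * C) fun u w => ?_, fun u w => (hmem u w).coeFn_toLp⟩
  change ‖(hmem u w).toLp _‖ ≤ _
  rw [Lp.norm_toLp]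
  refine ENNReal.toReal_le_of_le_ofReal (by positivity) ((hle u w).trans_eq ?_)
  rw [ENNReal.ofReal_mul (by positivity), ENNReal.ofReal_mul (by positivity),
    ENNReal.ofReal_mul (by positivity), ofReal_norm, ofReal_norm, ENNReal.ofReal_coe_nnreal]
  ring

set_option maxSynthPendingDepth 3 in
set_option synthInstance.maxHeartbeats 100000 in
theorem exists_trilinear_map (F : V →L[ℝ] Lp E3 2 μ) (D : Fin 3 → V →L[ℝ] Lp E3 2 μ) {C : NNReal}
    (hC : ∀ w, eLpNorm (F w) 4 μ ≤ C * ‖w‖ₑ) :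
    ∃ B : V →L[ℝ] V →L[ℝ] V →L[ℝ] ℝ, ∀ u v w,
      ∫ x, ∑ j, F u x j * inner ℝ (D j v x) (F w x) ∂μ = B v u w := by
  choose P hP using exists_product_map F hC
  refine ⟨∑ j, (ContinuousLinearMap.compL ℝ V (Lp E3 2 μ) ℝ).bilinearComp
    ((innerSL ℝ).comp (D j)) (P j), fun u v w => ?_⟩
  have h1 : (∑ j, (ContinuousLinearMap.compL ℝ V (Lp E3 2 μ) ℝ).bilinearComp
      ((innerSL ℝ).comp (D j)) (P j)) v u w = ∑ j, inner ℝ (D j v) (P j u w) := by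
    simp only [sum_apply]
    rfl
  rw [h1]
  have h2 : ∀ j, inner ℝ (D j v) (P j u w) =
      ∫ x, F u x j * inner ℝ (D j v x) (F w x) ∂μ := fun j => by
    rw [L2.inner_def]
    refine integral_congr_ae ?_
    filter_upwards [hP j u w] with x hx
    rw [hx, inner_smul_right]
  have h3 : ∀ j, Integrable (fun x => F u x j * inner ℝ (D j v x) (F w x)) μ := fun j => by
    refine (L2.integrable_inner (𝕜 := ℝ) (D j v) (P j u w)).congr ?_
    filter_upwards [hP j u w] with x hx
    rw [hx, inner_smul_right]
  rw [Finset.sum_congr rfl fun j _ => h2 j, ← integral_finsetSum _ fun j _ => h3 j]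

set_option maxSynthPendingDepth 3 in
set_option synthInstance.maxHeartbeats 100000 in
theorem exists_bound_of_eLpNorm_four_le (F : V →L[ℝ] Lp E3 2 μ) (D : Fin 3 → V →L[ℝ] Lp E3 2 μ)
    {C : NNReal} (hC : ∀ w, eLpNorm (F w) 4 μ ≤ C * ‖w‖ₑ) :
    ∃ M : ℝ, 0 ≤ M ∧
      (∀ u w : V, |∫ x, ∑ j, F u x j * inner ℝ (D j u x) (F w x) ∂μ| ≤ M * ‖u‖ ^ 2 * ‖w‖) ∧
      (∀ u : V, IsLinearMap ℝ fun w => ∫ x, ∑ j, F u x j * inner ℝ (D j u x) (F w x) ∂μ) ∧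
      ∀ w : V, Continuous fun u : V => ∫ x, ∑ j, F u x j * inner ℝ (D j u x) (F w x) ∂μ := by
  obtain ⟨B, hB⟩ := exists_trilinear_map F D hC
  refine ⟨‖B‖, norm_nonneg _, fun u w => ?_, fun u => ?_, fun w => ?_⟩
  · rw [hB, ← Real.norm_eq_abs, pow_two, ← mul_assoc]
    exact ((B u u).le_opNorm w).trans (mul_le_mul_of_nonneg_right (B.le_opNorm₂ u u)
      (norm_nonneg _))
  · simp only [hB]
    exact (B u u).toLinearMap.isLinear
  · simp only [hB]
    fun_prop

end Trilinear

variable {S : FlowSpaces}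

/-- The values of a field in `V`. -/
def valueL (S : FlowSpaces) : S.V →L[ℝ] L2 S.Ω :=
  (WithLp.fstL 2 ℝ (L2 S.Ω) (PiLp 2 (fun _ : Fin 3 => L2 S.Ω))).comp S.V.subtypeL

/-- The gradient components as continuous maps on `V`. -/
def gradL (S : FlowSpaces) (j : Fin 3) : S.V →L[ℝ] L2 S.Ω :=
  (PiLp.proj 2 (fun _ : Fin 3 => L2 S.Ω) j).comp
    ((WithLp.sndL 2 ℝ (L2 S.Ω) (PiLp 2 (fun _ : Fin 3 => L2 S.Ω))).comp S.V.subtypeL)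

theorem exists_trilinear_bound (hS : S.IsPeriodicOrNoSlip) :
    ∃ M : ℝ, 0 ≤ M ∧ (∀ u w : S.V, |FlowSpaces.trilinear u u w| ≤ M * ‖u‖ ^ 2 * ‖w‖) ∧
      (∀ u : S.V, IsLinearMap ℝ (FlowSpaces.trilinear u u)) ∧
      ∀ w : S.V, Continuous fun u : S.V => FlowSpaces.trilinear u u w := by
  obtain ⟨C, hC⟩ := hS.exists_eLpNorm_four_le
  exact exists_bound_of_eLpNorm_four_le (valueL S) (gradL S) (C := C) hC

theorem dirichlet_eq_sum (u v : S.V) :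
    FlowSpaces.dirichlet u v = ∑ j, inner ℝ (gradL S j u) (gradL S j v) := rfl

theorem continuous_dirichlet (v : S.V) : Continuous fun u : S.V => FlowSpaces.dirichlet u v := by
  simp only [dirichlet_eq_sum]
  fun_prop

theorem isLinearMap_dirichlet (u : S.V) : IsLinearMap ℝ (FlowSpaces.dirichlet u) := by
  constructor
  · intro v w
    simp only [dirichlet_eq_sum, map_add, inner_add_right, Finset.sum_add_distrib]
  · intro c v
    simp only [dirichlet_eq_sum, map_smul, inner_smul_right, Finset.mul_sum, smul_eq_mul]

theorem abs_dirichlet_le (u v : S.V) : |FlowSpaces.dirichlet u v| ≤ ‖u‖ * ‖v‖ := by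
  have h : ∀ w : S.V, ∑ j, ‖gradL S j w‖ ^ 2 ≤ ‖w‖ ^ 2 := fun w => sum_norm_sq_le_norm_sq w.1
  rw [dirichlet_eq_sum]
  calc |∑ j, inner ℝ (gradL S j u) (gradL S j v)|
      ≤ ∑ j, ‖gradL S j u‖ * ‖gradL S j v‖ :=
        (Finset.abs_sum_le_sum_abs _ _).trans
          (Finset.sum_le_sum fun j _ => abs_real_inner_le_norm _ _)
    _ ≤ √(∑ j, ‖gradL S j u‖ ^ 2) * √(∑ j, ‖gradL S j v‖ ^ 2) :=
        Real.sum_mul_le_sqrt_mul_sqrt _ _ _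
    _ ≤ ‖u‖ * ‖v‖ := by
        refine mul_le_mul ?_ ?_ (Real.sqrt_nonneg _) (norm_nonneg _)
        · exact Real.sqrt_le_iff.2 ⟨norm_nonneg _, h u⟩
        · exact Real.sqrt_le_iff.2 ⟨norm_nonneg _, h v⟩

end

section

/-! ### Expansion in eigenvectors -/

/-- A space `V` with a map `i` into `H`, and lifts `vec j` to `V` of the basis vectors of `H` which
are orthogonal in `V`, with `‖vec j‖² = 1 + λ_j`. -/
structure EigenLift (V H : Type*) [NormedAddCommGroup V] [InnerProductSpace ℝ V]
    [NormedAddCommGroup H] [InnerProductSpace ℝ H] extends Spectral H where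
  i : V →L[ℝ] H
  vec : ℕ → V
  i_vec : ∀ j, i (vec j) = basis j
  inner_vec : ∀ j w, inner ℝ (vec j) w = (1 + lam j) * inner ℝ (basis j) (i w)

namespace EigenLift

variable {V H : Type*} [NormedAddCommGroup V] [InnerProductSpace ℝ V]
    [NormedAddCommGroup H] [InnerProductSpace ℝ H] (b : EigenLift V H)

theorem inner_basis (i j : ℕ) : inner ℝ (b.basis i) (b.basis j) = if i = j then (1 : ℝ) else 0 :=
  (orthonormal_iff_ite.1 b.basis.orthonormal) i j

/-- The field `∑_{j < N} a_j φ_j` in `V`. -/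
def comb (N : ℕ) (a : ℕ → ℝ) : V := ∑ j ∈ Finset.range N, a j • b.vec j

theorem inner_comb (N : ℕ) (a : ℕ → ℝ) (w : V) : inner ℝ (b.comb N a) w =
    ∑ j ∈ Finset.range N, (1 + b.lam j) * (a j * inner ℝ (b.basis j) (b.i w)) := by
  rw [comb, sum_inner]
  refine Finset.sum_congr rfl fun j _ => ?_
  rw [real_inner_smul_left, b.inner_vec]
  ring

theorem i_comb (N : ℕ) (a : ℕ → ℝ) :
    b.i (b.comb N a) = ∑ j ∈ Finset.range N, a j • b.basis j := by
  simp only [comb, map_sum, map_smul, b.i_vec]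

theorem inner_basis_i_comb {N : ℕ} (a : ℕ → ℝ) {j : ℕ} (hj : j ∈ Finset.range N) :
    inner ℝ (b.basis j) (b.i (b.comb N a)) = a j := by
  rw [b.i_comb, inner_sum]
  simp only [real_inner_smul_right, b.inner_basis]
  simp only [mul_ite, mul_one, mul_zero, Finset.sum_ite_eq, if_pos hj]

theorem norm_comb_sq (N : ℕ) (a : ℕ → ℝ) :
    ‖b.comb N a‖ ^ 2 = ∑ j ∈ Finset.range N, (1 + b.lam j) * a j ^ 2 := by
  rw [← real_inner_self_eq_norm_sq, b.inner_comb]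
  refine Finset.sum_congr rfl fun j hj => ?_
  rw [b.inner_basis_i_comb a hj]
  ring

theorem norm_i_comb_sq (N : ℕ) (a : ℕ → ℝ) :
    ‖b.i (b.comb N a)‖ ^ 2 = ∑ j ∈ Finset.range N, a j ^ 2 := by
  rw [← real_inner_self_eq_norm_sq]
  nth_rw 1 [b.i_comb]
  rw [sum_inner]
  refine Finset.sum_congr rfl fun j hj => ?_
  rw [real_inner_smul_left, b.inner_basis_i_comb a hj]
  ring

theorem eq_comb_of_mem_span {N : ℕ} {x : V} (hx : x ∈ Submodule.span ℝ (b.vec '' Iio N)) :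
    x = b.comb N fun j => inner ℝ (b.basis j) (b.i x) := by
  induction hx using Submodule.span_induction with
  | mem x hx =>
    obtain ⟨i, hi, rfl⟩ := hx
    simp only [comb, b.i_vec, b.inner_basis, ite_smul, one_smul, zero_smul]
    rw [Finset.sum_ite_eq', if_pos (Finset.mem_range.2 hi)]
  | zero => simp [comb]
  | add x y _ _ hx hy =>
    conv_lhs => rw [hx, hy]
    simp only [comb, map_add, inner_add_right, add_smul, Finset.sum_add_distrib]
  | smul c x _ hx =>
    conv_lhs => rw [hx]
    simp only [comb, map_smul, real_inner_smul_right, mul_smul, Finset.smul_sum]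

/-- Bessel's inequality in `V`. -/
theorem sum_le_norm_sq (N : ℕ) (w : V) :
    ∑ j ∈ Finset.range N, (1 + b.lam j) * inner ℝ (b.basis j) (b.i w) ^ 2 ≤ ‖w‖ ^ 2 := by
  have h0 := sq_nonneg ‖w - b.comb N fun j => inner ℝ (b.basis j) (b.i w)‖
  rw [norm_sub_sq_real, real_inner_comm, b.inner_comb, b.norm_comb_sq] at h0
  simp only [pow_two] at h0 ⊢
  linarith

theorem rpow_sq_le {α : ℝ} (h0 : 0 ≤ α) (h : α ≤ 1 / 2) (j : ℕ) : (b.lam j ^ α) ^ 2 ≤ 1 + b.lam j := by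
  have hl := b.lam_pos j
  rw [← Real.rpow_natCast, ← Real.rpow_mul hl.le]
  push_cast
  rcases le_total (b.lam j) 1 with h1 | h1
  · linarith [Real.rpow_le_one hl.le h1 (by linarith : 0 ≤ α * 2)]
  · have := Real.rpow_le_rpow_of_exponent_le h1 (by linarith : α * 2 ≤ 1)
    rw [Real.rpow_one] at this
    linarith

theorem sum_rpow_le {α : ℝ} (h0 : 0 ≤ α) (h : α ≤ 1 / 2) (w : V) (N : ℕ) :
    ∑ j ∈ Finset.range N, (b.lam j ^ α) ^ 2 * b.basis.repr (b.i w) j ^ 2 ≤ ‖w‖ ^ 2 := by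
  refine (Finset.sum_le_sum fun j _ => ?_).trans (b.sum_le_norm_sq N w)
  rw [b.basis.repr_apply_apply]
  exact mul_le_mul_of_nonneg_right (b.rpow_sq_le h0 h j) (sq_nonneg _)

theorem i_mem_domPow {α : ℝ} (h0 : 0 ≤ α) (h : α ≤ 1 / 2) (w : V) :
    b.i.toLinearMap w ∈ b.domPow α := by
  rw [b.mem_domPow_iff]
  exact summable_of_sum_range_le (fun j => by positivity) (b.sum_rpow_le h0 h w)

theorem norm_lift_le {α : ℝ} (h0 : 0 ≤ α) (h : α ≤ 1 / 2) (w : V) :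
    ‖b.liftₗ b.i.toLinearMap (b.i_mem_domPow h0 h) w‖ ≤ 1 * ‖w‖ := by
  refine abs_le_of_sq_le_sq' ?_ (by positivity) |>.2
  rw [one_mul]
  have h1 := b.hasSum_norm_sq (b.liftₗ b.i.toLinearMap (b.i_mem_domPow h0 h) w)
  rw [b.coe_liftₗ] at h1
  rw [← h1.tsum_eq]
  exact Real.tsum_le_of_sum_range_le (fun j => by positivity) (b.sum_rpow_le h0 h w)

/-- The embedding of `V` into `D(A^α)` for `α ≤ 1/2`. -/
def toDPow {α : ℝ} (h0 : 0 ≤ α) (h : α ≤ 1 / 2) : V →L[ℝ] b.DPow α :=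
  (b.liftₗ b.i.toLinearMap (b.i_mem_domPow h0 h)).mkContinuous 1 (b.norm_lift_le h0 h)

theorem incl_toDPow {α : ℝ} (h0 : 0 ≤ α) (h : α ≤ 1 / 2) (w : V) :
    b.incl h0 (b.toDPow h0 h w) = b.i w := rfl

theorem compLp_incl_toDPow {T α : ℝ} (h0 : 0 ≤ α) (h : α ≤ 1 / 2) (v : TimeL2 T V) :
    (b.incl h0).compLp ((b.toDPow h0 h).compLp v) = b.i.compLp v := by
  refine Lp.ext ?_
  filter_upwards [(b.incl h0).coeFn_compLp ((b.toDPow h0 h).compLp v),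
    (b.toDPow h0 h).coeFn_compLp v, b.i.coeFn_compLp v] with t h1 h2 h3
  rw [h1, h2, h3, b.incl_toDPow]

end EigenLift

variable {S : FlowSpaces}

theorem inner_eq_add_dirichlet (u w : S.V) :
    inner ℝ u w = inner ℝ (S.toH u) (S.toH w) + FlowSpaces.dirichlet u w := by
  have h : inner ℝ u w = inner ℝ u.1.fst w.1.fst + inner ℝ u.1.snd w.1.snd :=
    WithLp.prod_inner_apply u.1 w.1
  rw [h, PiLp.inner_apply]
  rfl

theorem StokesBasis.inner_vec (b : StokesBasis S) (j : ℕ) (w : S.V) :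
    inner ℝ (b.vec j) w = (1 + b.lam j) * inner ℝ (b.basis j) (S.toH w) := by
  rw [inner_eq_add_dirichlet, b.toH_vec, b.eigen]
  ring

/-- The Stokes eigenfunctions as lifts to `V` of the basis of `H`. -/
def StokesBasis.toEigenLift (b : StokesBasis S) : EigenLift S.V S.H where
  toSpectral := b.toSpectral
  i := S.toH
  vec := b.vec
  i_vec := b.toH_vec
  inner_vec := b.inner_vec

end

section

/-! ### Oscillatory integrals of absolutely continuous functions -/

section Kernel

variable {T : ℝ}

theorem integral_mul_primitive {k g : ℝ → ℝ} (hk : Continuous k)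
    (hg : Integrable g (timeMeasure T)) :
    ∫ t, k t * (∫ s in 0..t, g s) ∂timeMeasure T =
      ∫ s, (∫ t in s..T, k t) * g s ∂timeMeasure T := by
  have hμ : timeMeasure T = volume.restrict (Ioc 0 T) := restrict_Ioc_eq_restrict_Icc.symm
  rw [hμ] at hg ⊢
  set μ := volume.restrict (Ioc (0 : ℝ) T)
  have hki : Integrable k μ := hk.integrableOn_Ioc
  have hF : Integrable (fun q : ℝ × ℝ => k q.1 * (Iic q.1).indicator g q.2) (μ.prod μ) := by
    have h1 := (hki.mul_prod hg).indicator (measurableSet_le measurable_snd measurable_fst)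
    refine h1.congr (ae_of_all _ fun q => ?_)
    by_cases hq : q.2 ≤ q.1
    · simp [indicator, hq]
    · simp [indicator, hq]
  have hL : ∫ t, k t * (∫ s in 0..t, g s) ∂μ = ∫ t, ∫ s, k t * (Iic t).indicator g s ∂μ ∂μ := by
    refine integral_congr_ae ?_
    filter_upwards [ae_restrict_mem measurableSet_Ioc] with t ht
    rw [integral_const_mul, integral_indicator measurableSet_Iic,
      Measure.restrict_restrict measurableSet_Iic, intervalIntegral.integral_of_le ht.1.le]
    congr 3
    ext s
    simp only [mem_Ioc, mem_inter_iff, mem_Iic]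
    exact ⟨fun h => ⟨h.2, h.1, h.2.trans ht.2⟩, fun h => ⟨h.2.1, h.1⟩⟩
  have hR : ∫ s, (∫ t in s..T, k t) * g s ∂μ = ∫ s, ∫ t, k t * (Iic t).indicator g s ∂μ ∂μ := by
    refine integral_congr_ae ?_
    filter_upwards [ae_restrict_mem measurableSet_Ioc] with s hs
    have h1 : ∀ t, k t * (Iic t).indicator g s = (Ici s).indicator k t * g s := fun t => by
      by_cases hst : s ≤ t
      · simp [indicator, hst]
      · simp [indicator, hst]
    simp only [h1]
    rw [integral_mul_const, integral_indicator measurableSet_Ici,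
      Measure.restrict_restrict measurableSet_Ici, intervalIntegral.integral_of_le hs.2,
      ← integral_Icc_eq_integral_Ioc]
    congr 4
    ext t
    simp only [mem_Icc, mem_inter_iff, mem_Ici, mem_Ioc]
    exact ⟨fun h => ⟨h.1, hs.1.trans_le h.1, h.2⟩, fun h => ⟨h.1, h.2.2⟩⟩
  rw [hL, hR, integral_integral_swap hF]

theorem abs_integral_mul_le (hT : 0 < T) {k g c : ℝ → ℝ} (hk : Continuous k)
    (hg : Integrable g (timeMeasure T)) {c₀ δ : ℝ} (hK : ∀ s, |∫ t in s..T, k t| ≤ δ)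
    (hc : ∀ t ∈ Icc 0 T, c t = c₀ + ∫ s in 0..t, g s) :
    |∫ t, k t * c t ∂timeMeasure T| ≤ δ * (|c₀| + ∫ s, |g s| ∂timeMeasure T) := by
  have hki : Integrable k (timeMeasure T) := hk.integrableOn_Icc
  have hcg : ContinuousOn (fun t => ∫ s in 0..t, g s) (Icc 0 T) :=
    intervalIntegral.continuousOn_primitive_interval
      (by rw [uIcc_of_le hT.le]; exact hg) |>.mono (by rw [uIcc_of_le hT.le])
  have h1 : ∫ t, k t * c t ∂timeMeasure T =
      (∫ t in 0..T, k t) * c₀ + ∫ s, (∫ t in s..T, k t) * g s ∂timeMeasure T := by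
    rw [← integral_mul_primitive hk hg, intervalIntegral.integral_of_le hT.le,
      ← integral_Icc_eq_integral_Ioc, ← integral_mul_const, ← integral_add (hki.mul_const _)]
    · refine integral_congr_ae ?_
      filter_upwards [ae_restrict_mem measurableSet_Icc] with t ht
      rw [hc t ht, mul_add]
    · exact (hk.continuousOn.mul hcg).integrableOn_Icc
  rw [h1]
  refine (abs_add_le _ _).trans ?_
  rw [mul_add, abs_mul]
  refine add_le_add (mul_le_mul_of_nonneg_right (hK 0) (abs_nonneg _)) ?_
  rw [← integral_const_mul, ← Real.norm_eq_abs]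
  refine norm_integral_le_of_norm_le (hg.abs.const_mul δ) (ae_of_all _ fun s => ?_)
  rw [Real.norm_eq_abs, abs_mul]
  exact mul_le_mul_of_nonneg_right (hK s) (abs_nonneg _)

theorem abs_integral_cos_le {τ : ℝ} (hτ : τ ≠ 0) (s : ℝ) :
    |∫ t in s..T, Real.cos (2 * Real.pi * τ * t)| ≤ |τ|⁻¹ := by
  have h0 : 2 * Real.pi * τ ≠ 0 := by have := Real.pi_pos; positivity
  rw [intervalIntegral.integral_comp_mul_left _ h0, integral_cos, smul_eq_mul, abs_mul, abs_inv,
    abs_mul, abs_of_pos Real.two_pi_pos, mul_inv, mul_right_comm]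
  have h1 := abs_sub (Real.sin (2 * Real.pi * τ * T)) (Real.sin (2 * Real.pi * τ * s))
  have h2 := Real.abs_sin_le_one (2 * Real.pi * τ * T)
  have h3 := Real.abs_sin_le_one (2 * Real.pi * τ * s)
  refine mul_le_of_le_one_left (by positivity) ?_
  rw [inv_mul_le_iff₀ Real.two_pi_pos]
  linarith [Real.pi_gt_three]

theorem abs_integral_sin_le {τ : ℝ} (hτ : τ ≠ 0) (s : ℝ) :
    |∫ t in s..T, Real.sin (2 * Real.pi * τ * t)| ≤ |τ|⁻¹ := by
  have h0 : 2 * Real.pi * τ ≠ 0 := by have := Real.pi_pos; positivity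
  rw [intervalIntegral.integral_comp_mul_left _ h0, integral_sin, smul_eq_mul, abs_mul, abs_inv,
    abs_mul, abs_of_pos Real.two_pi_pos, mul_inv, mul_right_comm]
  have h1 := abs_sub (Real.cos (2 * Real.pi * τ * s)) (Real.cos (2 * Real.pi * τ * T))
  have h2 := Real.abs_cos_le_one (2 * Real.pi * τ * T)
  have h3 := Real.abs_cos_le_one (2 * Real.pi * τ * s)
  refine mul_le_of_le_one_left (by positivity) ?_
  rw [inv_mul_le_iff₀ Real.two_pi_pos]
  linarith [Real.pi_gt_three]

end Kernel

/-! ### Fractional time regularity of Galerkin solutions -/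

/-- The integrated Galerkin system with `N` modes, for a nonlinear term `Φ`. -/
structure IsGalerkinCurve {V H : Type*} [NormedAddCommGroup V] [InnerProductSpace ℝ V]
    [NormedAddCommGroup H] [InnerProductSpace ℝ H] (b : EigenLift V H) (Φ : V → V → ℝ) (T : ℝ)
    (u₀ : H) (f : TimeL2 T H) (N : ℕ) (U : ℝ → V) : Prop where
  mem : ∀ t ∈ Icc 0 T, U t ∈ Submodule.span ℝ (b.vec '' Iio N)
  cont : ContinuousOn U (Icc 0 T)
  eqn : ∀ t ∈ Icc 0 T, ∀ j < N, inner ℝ (b.i (U t)) (b.basis j) = inner ℝ u₀ (b.basis j) +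
    ∫ s in 0..t, (inner ℝ (f s) (b.basis j) - Φ (U s) (b.vec j))

/-- A form that is linear in the second argument and grows at most quadratically in the first. -/
structure IsQuadraticForm {V : Type*} [NormedAddCommGroup V] [NormedSpace ℝ V] (Φ : V → V → ℝ)
    (κ M : ℝ) : Prop where
  linear : ∀ u, IsLinearMap ℝ (Φ u)
  bound : ∀ u w, |Φ u w| ≤ (κ * ‖u‖ + M * ‖u‖ ^ 2) * ‖w‖
  cont : ∀ w, Continuous fun u => Φ u w

namespace IsGalerkinCurve

variable {V H : Type*} [NormedAddCommGroup V] [InnerProductSpace ℝ V]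
    [NormedAddCommGroup H] [InnerProductSpace ℝ H] {b : EigenLift V H} {Φ : V → V → ℝ} {T κ M : ℝ}
    {u₀ : H} {f : TimeL2 T H} {N : ℕ} {U : ℝ → V} {v : TimeL2 T V}

theorem integrable_rhs (h : IsGalerkinCurve b Φ T u₀ f N U) (hΦ : IsQuadraticForm Φ κ M) (y : V) :
    Integrable (fun s => inner ℝ (f s) (b.i y) - Φ (U s) y) (timeMeasure T) := by
  have hf : Integrable f (timeMeasure T) := (Lp.memLp f).integrable (by norm_num)
  refine (hf.inner_const (b.i y)).sub ?_
  exact ((hΦ.cont y).comp_continuousOn h.cont).integrableOn_Icc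

theorem eqn_comb (h : IsGalerkinCurve b Φ T u₀ f N U) (hΦ : IsQuadraticForm Φ κ M)
    (a : ℕ → ℝ) {t : ℝ} (ht : t ∈ Icc 0 T) :
    ∑ j ∈ Finset.range N, a j * inner ℝ (b.basis j) (b.i (U t)) =
      inner ℝ u₀ (b.i (b.comb N a)) +
        ∫ s in 0..t, (inner ℝ (f s) (b.i (b.comb N a)) - Φ (U s) (b.comb N a)) := by
  have hii : ∀ y : V, IntervalIntegrable (fun s => inner ℝ (f s) (b.i y) - Φ (U s) y) volume 0 t :=
    fun y => (intervalIntegrable_iff_integrableOn_Icc_of_le ht.1).2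
      ((h.integrable_rhs hΦ y).mono_measure (Measure.restrict_mono (Icc_subset_Icc_right ht.2) le_rfl))
  have hG : ∀ s, inner ℝ (f s) (b.i (b.comb N a)) - Φ (U s) (b.comb N a) =
      ∑ j ∈ Finset.range N, a j * (inner ℝ (f s) (b.i (b.vec j)) - Φ (U s) (b.vec j)) := fun s => by
    have h1 : Φ (U s) (b.comb N a) = ∑ j ∈ Finset.range N, a j * Φ (U s) (b.vec j) := by
      have := map_sum (hΦ.linear (U s)).mk' (fun j => a j • b.vec j) (Finset.range N)
      simp only [map_smul, IsLinearMap.mk'_apply, smul_eq_mul] at this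
      exact this
    rw [h1, EigenLift.comb, map_sum, inner_sum, ← Finset.sum_sub_distrib]
    refine Finset.sum_congr rfl fun j _ => ?_
    rw [map_smul, real_inner_smul_right]
    ring
  have h2 : inner ℝ u₀ (b.i (b.comb N a)) = ∑ j ∈ Finset.range N, a j * inner ℝ u₀ (b.basis j) := by
    rw [b.i_comb, inner_sum]
    exact Finset.sum_congr rfl fun j _ => real_inner_smul_right _ _ _
  simp only [hG]
  rw [intervalIntegral.integral_finsetSum fun j _ => (hii (b.vec j)).const_mul (a j), h2,
    ← Finset.sum_add_distrib]
  refine Finset.sum_congr rfl fun j hj => ?_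
  rw [real_inner_comm, h.eqn t ht j (Finset.mem_range.1 hj), intervalIntegral.integral_const_mul,
    mul_add]
  simp only [b.i_vec]

/-- The constant that controls the Galerkin system in the dual of `V`. -/
def dualBound (T κ M : ℝ) (u₀ : H) (f : TimeL2 T H) (r : ℝ) : ℝ :=
  ‖u₀‖ + (√T * ‖f‖ + (κ * (√T * r) + M * r ^ 2))

theorem norm_i_comb_le (a : ℕ → ℝ) : ‖b.i (b.comb N a)‖ ≤ ‖b.comb N a‖ := by
  refine abs_le_of_sq_le_sq' ?_ (norm_nonneg _) |>.2
  rw [b.norm_i_comb_sq, b.norm_comb_sq]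
  refine Finset.sum_le_sum fun j _ => ?_
  nlinarith [b.lam_pos j, sq_nonneg (a j)]

theorem integral_rhs_le (h : IsGalerkinCurve b Φ T u₀ f N U) (hΦ : IsQuadraticForm Φ κ M)
    (hT : 0 < T) (hκ : 0 ≤ κ) (hv : v =ᵐ[timeMeasure T] U) (a : ℕ → ℝ) :
    |inner ℝ u₀ (b.i (b.comb N a))| + ∫ s, |inner ℝ (f s) (b.i (b.comb N a)) -
        Φ (U s) (b.comb N a)| ∂timeMeasure T ≤
      dualBound T κ M u₀ f ‖v‖ * ‖b.comb N a‖ := by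
  set y := b.comb N a with hy
  have hiy : ‖b.i y‖ ≤ ‖y‖ := norm_i_comb_le a
  have hf : Integrable f (timeMeasure T) := (Lp.memLp f).integrable (by norm_num)
  have hvi : Integrable v (timeMeasure T) := (Lp.memLp v).integrable (by norm_num)
  have h1 : |inner ℝ u₀ (b.i y)| ≤ ‖u₀‖ * ‖y‖ :=
    (abs_real_inner_le_norm _ _).trans (mul_le_mul_of_nonneg_left hiy (norm_nonneg _))
  have h2 : ∫ s, |inner ℝ (f s) (b.i y) - Φ (U s) y| ∂timeMeasure T ≤
      ∫ s, (‖f s‖ + (κ * ‖v s‖ + M * ‖v s‖ ^ 2)) * ‖y‖ ∂timeMeasure T := by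
    refine integral_mono_ae (h.integrable_rhs hΦ y).abs
      ((hf.norm.add ((hvi.norm.const_mul κ).add ((integrable_norm_sq v).const_mul M))).mul_const _) ?_
    filter_upwards [hv] with s hs
    rw [hs]
    have h3 := (abs_real_inner_le_norm (f s) (b.i y)).trans
      (mul_le_mul_of_nonneg_left hiy (norm_nonneg _))
    have h4 := hΦ.bound (U s) y
    have h5 := abs_sub (inner ℝ (f s) (b.i y)) (Φ (U s) y)
    linarith
  have hi : Integrable (fun s => κ * ‖v s‖ + M * ‖v s‖ ^ 2) (timeMeasure T) :=
    (hvi.norm.const_mul κ).add ((integrable_norm_sq v).const_mul M)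
  rw [integral_mul_const, integral_add hf.norm hi,
    integral_add (hvi.norm.const_mul κ) ((integrable_norm_sq v).const_mul M),
    integral_const_mul, integral_const_mul, ← norm_sq_eq_integral] at h2
  have h6 := integral_norm_le_sqrt_mul hT f
  have h7 := mul_le_mul_of_nonneg_left (integral_norm_le_sqrt_mul hT v) hκ
  rw [dualBound, add_mul]
  refine add_le_add h1 (h2.trans (mul_le_mul_of_nonneg_right ?_ (norm_nonneg _)))
  linarith

/-- Testing the Galerkin system with the transform of its own solution. -/
theorem sum_sq_le (h : IsGalerkinCurve b Φ T u₀ f N U) (hΦ : IsQuadraticForm Φ κ M)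
    (hT : 0 < T) (hκ : 0 ≤ κ) (hv : v =ᵐ[timeMeasure T] U) {k : ℝ → ℝ} (hk : Continuous k)
    {δ : ℝ} (hK : ∀ s, |∫ t in s..T, k t| ≤ δ) {a : ℕ → ℝ}
    (ha : ∀ j, a j = ∫ t, k t * inner ℝ (b.basis j) (b.i (U t)) ∂timeMeasure T) :
    ∑ j ∈ Finset.range N, a j ^ 2 ≤
      δ * (dualBound T κ M u₀ f ‖v‖ * √(∑ j ∈ Finset.range N, (1 + b.lam j) * a j ^ 2)) := by
  have hδ : 0 ≤ δ := (abs_nonneg _).trans (hK 0)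
  have hcj : ∀ j, ContinuousOn (fun t => inner ℝ (b.basis j) (b.i (U t))) (Icc 0 T) := fun j =>
    continuousOn_const.inner (b.i.continuous.comp_continuousOn h.cont)
  have h1 := abs_integral_mul_le hT hk (h.integrable_rhs hΦ (b.comb N a)) hK
    (c := fun t => ∑ j ∈ Finset.range N, a j * inner ℝ (b.basis j) (b.i (U t)))
    (fun t ht => h.eqn_comb hΦ a ht)
  have h2 : ∫ t, k t * ∑ j ∈ Finset.range N, a j * inner ℝ (b.basis j) (b.i (U t)) ∂timeMeasure T =
      ∑ j ∈ Finset.range N, a j ^ 2 := by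
    have : ∀ t, k t * ∑ j ∈ Finset.range N, a j * inner ℝ (b.basis j) (b.i (U t)) =
        ∑ j ∈ Finset.range N, a j * (k t * inner ℝ (b.basis j) (b.i (U t))) := fun t => by
      rw [Finset.mul_sum]
      exact Finset.sum_congr rfl fun j _ => by ring
    simp only [this]
    rw [integral_finsetSum _ fun j _ => ?_]
    · refine Finset.sum_congr rfl fun j _ => ?_
      rw [integral_const_mul, ← ha, pow_two]
    · exact (hk.continuousOn.mul (hcj j)).integrableOn_Icc.const_mul _
  rw [h2] at h1
  refine (le_abs_self _).trans (h1.trans (mul_le_mul_of_nonneg_left ?_ hδ))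
  rw [← b.norm_comb_sq, Real.sqrt_sq (norm_nonneg _)]
  exact h.integral_rhs_le hΦ hT hκ hv a

end IsGalerkinCurve

end

section

theorem weight_mul_le {γ x F E A : ℝ} (hx : x ≠ 0) (hγ : 0 ≤ γ) (hγ' : γ ≤ 1 / 2) (hA : 0 ≤ A)
    (hF : 0 ≤ F) (hFE : F ≤ E) (hFA : F ≤ 2 * (|x|⁻¹ * (A * √E))) :
    (|x| ^ γ) ^ 2 * F ≤ (1 + A) * E + 4 * A * (1 + ‖x‖) ^ (-(2 - 4 * γ)) := by
  have hE : 0 ≤ E := hF.trans hFE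
  have hx0 : 0 < |x| := abs_pos.2 hx
  have hp : 0 ≤ (1 + ‖x‖) ^ (-(2 - 4 * γ)) := by positivity
  rcases le_total |x| 1 with h1 | h1
  · have h2 : (|x| ^ γ) ^ 2 ≤ 1 := pow_le_one₀ (by positivity) (Real.rpow_le_one hx0.le h1 hγ)
    have h3 : (|x| ^ γ) ^ 2 * F ≤ F := mul_le_of_le_one_left hF h2
    have h4 : 0 ≤ A * E := mul_nonneg hA hE
    have h5 : 0 ≤ 4 * A * (1 + ‖x‖) ^ (-(2 - 4 * γ)) := by positivity
    linarith
  · set ξ := (|x| ^ γ) ^ 2 * |x|⁻¹ with hξ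
    have h2 : (|x| ^ γ) ^ 2 * F ≤ A * (2 * ξ * √E) := by
      calc (|x| ^ γ) ^ 2 * F ≤ (|x| ^ γ) ^ 2 * (2 * (|x|⁻¹ * (A * √E))) :=
            mul_le_mul_of_nonneg_left hFA (sq_nonneg _)
        _ = A * (2 * ξ * √E) := by rw [hξ]; ring
    have h3 : 2 * ξ * √E ≤ ξ ^ 2 + E := by
      have := two_mul_le_add_sq ξ (√E)
      rwa [Real.sq_sqrt hE] at this
    have h4 : ξ ^ 2 = |x| ^ (-(2 - 4 * γ)) := by
      rw [hξ, mul_pow, ← pow_mul, ← Real.rpow_natCast, ← Real.rpow_natCast (|x|⁻¹),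
        Real.inv_rpow hx0.le, ← Real.rpow_neg hx0.le, ← Real.rpow_mul hx0.le,
        ← Real.rpow_add hx0]
      congr 1
      push_cast
      ring
    have h5 : |x| ^ (-(2 - 4 * γ)) ≤ 4 * (1 + ‖x‖) ^ (-(2 - 4 * γ)) := by
      have h6 : |x| ^ (-(2 - 4 * γ)) ≤ ((1 + ‖x‖) / 2) ^ (-(2 - 4 * γ)) := by
        refine Real.rpow_le_rpow_of_nonpos (by positivity) ?_ (by linarith)
        rw [Real.norm_eq_abs]
        linarith
      refine h6.trans ?_
      rw [Real.div_rpow (by positivity) (by norm_num), div_eq_mul_inv, mul_comm,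
        ← Real.rpow_neg (by norm_num), neg_neg]
      refine mul_le_mul_of_nonneg_right ?_ hp
      calc (2 : ℝ) ^ (2 - 4 * γ) ≤ 2 ^ (2 : ℝ) :=
            Real.rpow_le_rpow_of_exponent_le (by norm_num) (by linarith)
        _ = 4 := by norm_num
    rw [h4] at h3
    have h7 : A * (2 * ξ * √E) ≤ A * (4 * (1 + ‖x‖) ^ (-(2 - 4 * γ)) + E) :=
      mul_le_mul_of_nonneg_left (by linarith) hA
    linarith

namespace IsGalerkinCurve

variable {V H : Type*} [NormedAddCommGroup V] [InnerProductSpace ℝ V]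
    [NormedAddCommGroup H] [InnerProductSpace ℝ H] {b : EigenLift V H} {Φ : V → V → ℝ} {T κ M : ℝ}
    {u₀ : H} {f : TimeL2 T H} {N : ℕ} {U : ℝ → V} {v : TimeL2 T V}

theorem integral_smul_eq_comb (h : IsGalerkinCurve b Φ T u₀ f N U) {k : ℝ → ℝ} (hk : Continuous k) :
    ∫ t, k t • b.i (U t) ∂timeMeasure T =
      b.i (b.comb N fun j => ∫ t, k t * inner ℝ (b.basis j) (b.i (U t)) ∂timeMeasure T) := by
  have := b.completeSpace
  have hcj : ∀ j, ContinuousOn (fun t => inner ℝ (b.basis j) (b.i (U t))) (Icc 0 T) := fun j =>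
    continuousOn_const.inner (b.i.continuous.comp_continuousOn h.cont)
  have h1 : ∫ t, k t • b.i (U t) ∂timeMeasure T = ∫ t, ∑ j ∈ Finset.range N,
      (k t * inner ℝ (b.basis j) (b.i (U t))) • b.basis j ∂timeMeasure T := by
    refine integral_congr_ae ?_
    filter_upwards [ae_restrict_mem measurableSet_Icc] with t ht
    have h2 := congrArg b.i (b.eq_comb_of_mem_span (h.mem t ht))
    rw [b.i_comb] at h2
    conv_lhs => rw [h2]
    simp only [Finset.smul_sum, mul_smul]
  rw [h1, integral_finsetSum, b.i_comb]
  · exact Finset.sum_congr rfl fun j _ => integral_smul_const _ _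
  · intro j _
    have h3 : Integrable (fun t => k t * inner ℝ (b.basis j) (b.i (U t))) (timeMeasure T) :=
      (hk.continuousOn.mul (hcj j)).integrableOn_Icc
    exact h3.smul_const _

theorem compLp_ae_eq (hv : v =ᵐ[timeMeasure T] U) :
    b.i.compLp v =ᵐ[timeMeasure T] fun t => b.i (U t) := by
  filter_upwards [b.i.coeFn_compLp v, hv] with t h1 h2
  rw [h1, h2]

/-- The energy density in frequency of the coefficients of `U`. -/
def freqEnergy (b : EigenLift V H) (T : ℝ) (N : ℕ) (U : ℝ → V) (τ : ℝ) : ℝ :=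
  ∑ j ∈ Finset.range N, (1 + b.lam j) *
    (cosT T (fun t => inner ℝ (b.basis j) (b.i (U t))) τ ^ 2 +
      sinT T (fun t => inner ℝ (b.basis j) (b.i (U t))) τ ^ 2)

theorem lintegral_freqEnergy (h : IsGalerkinCurve b Φ T u₀ f N U) (hT : 0 < T)
    (hv : v =ᵐ[timeMeasure T] U) :
    ∫⁻ τ, ENNReal.ofReal (freqEnergy b T N U τ) = ENNReal.ofReal (‖v‖ ^ 2) := by
  have hcj : ∀ j, ContinuousOn (fun t => inner ℝ (b.basis j) (b.i (U t))) (Icc 0 T) := fun j =>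
    continuousOn_const.inner (b.i.continuous.comp_continuousOn h.cont)
  have hsq : ∀ j, Integrable (fun t => inner ℝ (b.basis j) (b.i (U t)) ^ 2) (timeMeasure T) :=
    fun j => ((hcj j).pow 2).integrableOn_Icc
  have hmem : ∀ j, MemLp (fun t => inner ℝ (b.basis j) (b.i (U t))) 2 (timeMeasure T) := fun j =>
    (memLp_two_iff_integrable_sq ((hcj j).aestronglyMeasurable measurableSet_Icc)).2 (hsq j)
  have hpos : ∀ j, 0 ≤ 1 + b.lam j := fun j => by linarith [b.lam_pos j]
  have hmeas : ∀ j, Measurable fun τ => ENNReal.ofReal ((1 + b.lam j) *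
      (cosT T (fun t => inner ℝ (b.basis j) (b.i (U t))) τ ^ 2 +
      sinT T (fun t => inner ℝ (b.basis j) (b.i (U t))) τ ^ 2)) := fun j => by
    have e1 : cosT T (fun t => inner ℝ (b.basis j) (b.i (U t))) = cosT T ((hmem j).toLp _) :=
      cosT_congr (hmem j).coeFn_toLp.symm
    have e2 : sinT T (fun t => inner ℝ (b.basis j) (b.i (U t))) = sinT T ((hmem j).toLp _) :=
      sinT_congr (hmem j).coeFn_toLp.symm
    rw [e1, e2]
    have c1 := continuous_cosT hT ((hmem j).toLp _)
    have c2 := continuous_sinT hT ((hmem j).toLp _)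
    exact (continuous_const.mul ((c1.pow 2).add (c2.pow 2))).measurable.ennreal_ofReal
  simp only [freqEnergy]
  have h1 : ∀ τ, ENNReal.ofReal (∑ j ∈ Finset.range N, (1 + b.lam j) *
      (cosT T (fun t => inner ℝ (b.basis j) (b.i (U t))) τ ^ 2 +
      sinT T (fun t => inner ℝ (b.basis j) (b.i (U t))) τ ^ 2)) =
      ∑ j ∈ Finset.range N, ENNReal.ofReal ((1 + b.lam j) *
      (cosT T (fun t => inner ℝ (b.basis j) (b.i (U t))) τ ^ 2 +
      sinT T (fun t => inner ℝ (b.basis j) (b.i (U t))) τ ^ 2)) := fun τ =>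
    ENNReal.ofReal_sum_of_nonneg fun j _ => mul_nonneg (hpos j) (by positivity)
  simp only [h1]
  rw [lintegral_finsetSum _ fun j _ => hmeas j]
  have h2 : ∀ j, ∫⁻ τ, ENNReal.ofReal ((1 + b.lam j) *
      (cosT T (fun t => inner ℝ (b.basis j) (b.i (U t))) τ ^ 2 +
      sinT T (fun t => inner ℝ (b.basis j) (b.i (U t))) τ ^ 2)) =
      ENNReal.ofReal ((1 + b.lam j) *
        ∫ t, inner ℝ (b.basis j) (b.i (U t)) ^ 2 ∂timeMeasure T) := fun j => by
    simp only [ENNReal.ofReal_mul (hpos j)]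
    rw [lintegral_const_mul' _ _ ENNReal.ofReal_ne_top, lintegral_fourier_sq hT (hmem j)]
  rw [Finset.sum_congr rfl fun j _ => h2 j, ← ENNReal.ofReal_sum_of_nonneg fun j _ =>
    mul_nonneg (hpos j) (integral_nonneg fun t => sq_nonneg _)]
  congr 1
  simp only [← integral_const_mul]
  rw [← integral_finsetSum _ fun j _ => (hsq j).const_mul _, norm_sq_eq_integral]
  refine integral_congr_ae ?_
  filter_upwards [hv, ae_restrict_mem measurableSet_Icc] with t h3 ht
  rw [h3]
  conv_rhs => rw [b.eq_comb_of_mem_span (h.mem t ht)]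
  rw [b.norm_comb_sq]

theorem fourierWeight_le (h : IsGalerkinCurve b Φ T u₀ f N U) (hΦ : IsQuadraticForm Φ κ M)
    (hT : 0 < T) (hκ : 0 ≤ κ) (hM : 0 ≤ M) (hv : v =ᵐ[timeMeasure T] U) {γ : ℝ} (hγ : 0 ≤ γ)
    (hγ' : γ < 1 / 4) :
    fourierWeight T γ (b.i.compLp v) ≤ ENNReal.ofReal ((1 + dualBound T κ M u₀ f ‖v‖) * ‖v‖ ^ 2 +
      4 * dualBound T κ M u₀ f ‖v‖ * ∫ τ : ℝ, (1 + ‖τ‖) ^ (-(2 - 4 * γ))) := by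
  set A := dualBound T κ M u₀ f ‖v‖ with hA
  have hA0 : 0 ≤ A := by rw [hA, dualBound]; positivity
  have hw : Integrable fun τ : ℝ => (1 + ‖τ‖) ^ (-(2 - 4 * γ)) :=
    integrable_one_add_norm (by simp; linarith)
  rw [fourierWeight_congr (compLp_ae_eq hv)]
  have hpt : ∀ᵐ τ : ℝ, ENNReal.ofReal ((|τ| ^ γ) ^ 2 * ‖fhat T (fun t => b.i (U t)) τ‖ ^ 2) ≤
      ENNReal.ofReal (1 + A) * ENNReal.ofReal (freqEnergy b T N U τ) +
        ENNReal.ofReal (4 * A * (1 + ‖τ‖) ^ (-(2 - 4 * γ))) := by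
    filter_upwards [Measure.ae_ne volume (0 : ℝ)] with τ hτ
    set C : ℕ → ℝ := fun j => cosT T (fun t => inner ℝ (b.basis j) (b.i (U t))) τ with hC
    set D : ℕ → ℝ := fun j => sinT T (fun t => inner ℝ (b.basis j) (b.i (U t))) τ with hD
    have hl := fun j => b.lam_pos j
    have hE : freqEnergy b T N U τ = ∑ j ∈ Finset.range N, (1 + b.lam j) * C j ^ 2 +
        ∑ j ∈ Finset.range N, (1 + b.lam j) * D j ^ 2 := by
      rw [freqEnergy, ← Finset.sum_add_distrib]
      exact Finset.sum_congr rfl fun j _ => mul_add _ _ _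
    have hnn : ∀ a : ℕ → ℝ, 0 ≤ ∑ j ∈ Finset.range N, (1 + b.lam j) * a j ^ 2 := fun a =>
      Finset.sum_nonneg fun j _ => mul_nonneg (by linarith [hl j]) (sq_nonneg _)
    have hle : ∀ a : ℕ → ℝ, ∑ j ∈ Finset.range N, a j ^ 2 ≤
        ∑ j ∈ Finset.range N, (1 + b.lam j) * a j ^ 2 := fun a =>
      Finset.sum_le_sum fun j _ => by nlinarith [hl j, sq_nonneg (a j)]
    have hF : ‖fhat T (fun t => b.i (U t)) τ‖ ^ 2 =
        ∑ j ∈ Finset.range N, C j ^ 2 + ∑ j ∈ Finset.range N, D j ^ 2 := by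
      rw [norm_fhat_sq, cosT, sinT, h.integral_smul_eq_comb (by fun_prop),
        h.integral_smul_eq_comb (by fun_prop), b.norm_i_comb_sq, b.norm_i_comb_sq]
      rfl
    have hCle := h.sum_sq_le hΦ hT hκ hv (k := fun t => Real.cos (2 * Real.pi * τ * t))
      (by fun_prop) (abs_integral_cos_le hτ) (a := C) fun j => rfl
    have hDle := h.sum_sq_le hΦ hT hκ hv (k := fun t => Real.sin (2 * Real.pi * τ * t))
      (by fun_prop) (abs_integral_sin_le hτ) (a := D) fun j => rfl
    have hs1 : √(∑ j ∈ Finset.range N, (1 + b.lam j) * C j ^ 2) ≤ √(freqEnergy b T N U τ) :=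
      Real.sqrt_le_sqrt (by rw [hE]; linarith [hnn D])
    have hs2 : √(∑ j ∈ Finset.range N, (1 + b.lam j) * D j ^ 2) ≤ √(freqEnergy b T N U τ) :=
      Real.sqrt_le_sqrt (by rw [hE]; linarith [hnn C])
    have hE0 : 0 ≤ freqEnergy b T N U τ := by rw [hE]; exact add_nonneg (hnn C) (hnn D)
    have hτ0 : 0 ≤ |τ|⁻¹ := by positivity
    have hFA : ‖fhat T (fun t => b.i (U t)) τ‖ ^ 2 ≤
        2 * (|τ|⁻¹ * (A * √(freqEnergy b T N U τ))) := by
      have h1 := mul_le_mul_of_nonneg_left (mul_le_mul_of_nonneg_left hs1 hA0) hτ0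
      have h2 := mul_le_mul_of_nonneg_left (mul_le_mul_of_nonneg_left hs2 hA0) hτ0
      rw [hF]
      linarith
    rw [← ENNReal.ofReal_mul (by linarith), ← ENNReal.ofReal_add (by positivity) (by positivity)]
    refine ENNReal.ofReal_le_ofReal (weight_mul_le hτ hγ (by linarith) hA0 (sq_nonneg _) ?_ hFA)
    rw [hF, hE]
    exact add_le_add (hle C) (hle D)
  refine (lintegral_mono_ae hpt).trans_eq ?_
  rw [lintegral_add_right _ (by fun_prop), lintegral_const_mul' _ _ ENNReal.ofReal_ne_top,
    h.lintegral_freqEnergy hT hv, ← ENNReal.ofReal_mul (by linarith),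
    ← ofReal_integral_eq_lintegral_ofReal (hw.const_mul _) (ae_of_all _ fun τ => by positivity),
    integral_const_mul, ← ENNReal.ofReal_add (by positivity) (by positivity)]

end IsGalerkinCurve

end

section

/-! ### Expansions of bounded sequences in time-fractional spaces -/

/-- A weakly convergent sequence is bounded. -/
theorem exists_norm_le_of_tendsto_dual {E : Type*} [NormedAddCommGroup E] [NormedSpace ℝ E]
    {x : ℕ → E} {a : E} (h : ∀ ℓ : StrongDual ℝ E, Tendsto (fun n => ℓ (x n)) atTop (𝓝 (ℓ a))) :
    ∃ R, ∀ n, ‖x n‖ ≤ R := by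
  obtain ⟨R, hR⟩ := banach_steinhaus (g := fun n => NormedSpace.inclusionInDoubleDualLi ℝ (x n))
    (fun ℓ => by
      obtain ⟨C, hC⟩ := (h ℓ).norm.bddAbove_range
      exact ⟨C, fun n => hC ⟨n, rfl⟩⟩)
  exact ⟨R, fun n => by simpa only [LinearIsometry.norm_map] using hR n⟩

theorem exists_norm_le_of_weak_timeL2 {V : Type*} [NormedAddCommGroup V] [NormedSpace ℝ V] {T : ℝ}
    {v : ℕ → TimeL2 T V} {u : TimeL2 T V}
    (h : ∀ ℓ : StrongDual ℝ (TimeL2 T V), Tendsto (fun n => ℓ (v n)) atTop (𝓝 (ℓ u))) :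
    ∃ R, ∀ n, ‖v n‖ ≤ R := exists_norm_le_of_tendsto_dual h

/-- A sequence that decreases strictly from `(a + c) / 2` to `a`. -/
def interp (a c : ℝ) (k : ℕ) : ℝ := a + (c - a) / (k + 2)

theorem le_interp {a c : ℝ} (h : a ≤ c) (k : ℕ) : a ≤ interp a c k := by
  have : 0 ≤ (c - a) / ((k : ℝ) + 2) := div_nonneg (by linarith) (by positivity)
  rw [interp]
  linarith

theorem interp_succ_lt {a c : ℝ} (h : a < c) (k : ℕ) : interp a c (k + 1) < interp a c k := by
  rw [interp, interp]
  have : (c - a) / (((k + 1 : ℕ) : ℝ) + 2) < (c - a) / ((k : ℝ) + 2) := by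
    refine div_lt_div_of_pos_left (by linarith) (by positivity) ?_
    push_cast
    linarith
  linarith

theorem interp_zero_lt {a c : ℝ} (h : a < c) : interp a c 0 < c := by
  rw [interp]
  push_cast
  linarith

namespace Spectral

variable {H : Type*} [NormedAddCommGroup H] [InnerProductSpace ℝ H] (b : Spectral H)
  {T α β γ δ : ℝ}

theorem embed_injective (hT : 0 < T) (hα : 0 ≤ α) (h : α ≤ β) (hγ : 0 ≤ γ) (hγδ : γ ≤ δ) :
    Function.Injective (b.embed hT hα h hγ hγδ) := fun p q hpq => by
  refine b.toL2_injective (hα.trans h) ?_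
  rw [← b.toL2_embed hT hα h hγ hγδ, ← b.toL2_embed hT hα h hγ hγδ, hpq]

theorem embed_embed {α' γ' : ℝ} (hT : 0 < T) (hα : 0 ≤ α) (h : α ≤ α') (h' : α' ≤ β) (hγ : 0 ≤ γ)
    (hγγ' : γ ≤ γ') (hγδ : γ' ≤ δ) (p : HGamma T δ (b.incl (hα.trans (h.trans h')))) :
    b.embed hT hα h hγ hγγ' (b.embed hT (hα.trans h) h' (hγ.trans hγγ') hγδ p) =
      b.embed hT hα (h.trans h') hγ (hγγ'.trans hγδ) p := by
  refine b.toL2_injective hα ?_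
  rw [b.toL2_embed, b.toL2_embed, b.toL2_embed]

/-- A sequence that is bounded in `𝓗^δ(0, T; D(A^β), H)` and converges in `L²(0, T; H)` has a
subsequence with a relaxed expansion in `𝓗^γ(0, T; D(A^α), H)`, for `α < β` and `γ < δ`. -/
theorem exists_relaxedExpansion_of_bounded (hlam : Tendsto b.lam atTop atTop) (hT : 0 < T)
    (hα : 0 ≤ α) (hαβ : α < β) (hγ : 0 ≤ γ) (hγδ : γ < δ)
    (z : ℕ → HGamma T δ (b.incl (hα.trans hαβ.le))) {R : ℝ} (hz : ∀ n, ‖z n‖ ≤ R)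
    {a₀ : TimeL2 T H}
    (ha₀ : Tendsto (fun n => b.toL2 (hα.trans hαβ.le) (z n)) atTop (𝓝 a₀)) :
    ∃ s : ℕ → ℕ, StrictMono s ∧ ∃ a : HGamma T γ (b.incl hα), b.toL2 hα a = a₀ ∧
      ∃ K Γ w r, IsRelaxedExpansion (fun n => b.embed hT hα hαβ.le hγ hγδ.le (z (s n))) a K Γ w r := by
  have hA := fun k => le_interp hαβ.le k
  have hA0 : ∀ k, 0 ≤ interp α β k := fun k => hα.trans (hA k)
  have hA' := interp_zero_lt hαβ
  have hG := fun k => le_interp hγδ.le k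
  have hG0 : ∀ k, 0 ≤ interp γ δ k := fun k => hγ.trans (hG k)
  have hG' := interp_zero_lt hγδ
  let E : HGamma T δ (b.incl (hα.trans hαβ.le)) →L[ℝ]
      HGamma T (interp γ δ 0) (b.incl (hA0 0)) := b.embed hT (hA0 0) hA'.le (hG0 0) hG'.le
  have hE : IsCompactOperator E := b.isCompactOperator_embed hlam hT (hA0 0) hA' (hG0 0) hG'
  have hcpt := IsCompactOperator.isCompact_closure_image_closedBall
    (f := (E : HGamma T δ (b.incl (hα.trans hαβ.le)) →ₗ[ℝ]
      HGamma T (interp γ δ 0) (b.incl (hA0 0)))) hE R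
  obtain ⟨a', -, s₁, hs₁, hlim⟩ := hcpt.tendsto_subseq (x := fun n => E (z n))
    fun n => subset_closure ⟨z n, by simpa using hz n, rfl⟩
  obtain ⟨s₂, hs₂, K, Γ, w, r, hexp⟩ := exists_relaxedExpansion
    (Z := fun k => HGamma T (interp γ δ k) (b.incl (hA0 k)))
    (Y := HGamma T γ (b.incl hα))
    (fun k => b.embed hT (hA0 (k + 1)) (interp_succ_lt hαβ k).le (hG0 (k + 1))
      (interp_succ_lt hγδ k).le)
    (fun k => b.isCompactOperator_embed hlam hT (hA0 (k + 1)) (interp_succ_lt hαβ k)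
      (hG0 (k + 1)) (interp_succ_lt hγδ k))
    (fun k => b.embed hT hα (hA k) hγ (hG k))
    (fun k p => b.embed_embed hT hα (hA (k + 1)) (interp_succ_lt hαβ k).le hγ (hG (k + 1))
      (interp_succ_lt hγδ k).le p)
    (fun k => b.embed_injective hT hα (hA k) hγ (hG k))
    (fun n => E (z (s₁ n))) a' hlim
  refine ⟨s₁ ∘ s₂, hs₁.comp hs₂, b.embed hT hα (hA 0) hγ (hG 0) a', ?_, K, Γ, w, r, ?_⟩
  · rw [b.toL2_embed]
    have h1 := ((b.toL2 (hA0 0)).continuous.tendsto a').comp hlim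
    refine tendsto_nhds_unique h1 ((ha₀.comp hs₁.tendsto_atTop).congr fun n => ?_)
    exact (b.toL2_embed hT (hA0 0) hA'.le (hG0 0) hG'.le (z (s₁ n))).symm
  · have h2 : ∀ n, b.embed hT hα hαβ.le hγ hγδ.le (z ((s₁ ∘ s₂) n)) =
        b.embed hT hα (hA 0) hγ (hG 0) (E (z (s₁ (s₂ n)))) := fun n =>
      (b.embed_embed hT hα (hA 0) hA'.le hγ (hG 0) hG'.le (z (s₁ (s₂ n)))).symm
    simp only [h2]
    exact hexp

end Spectral

theorem IsGalerkinCurve.dualBound_mono {H : Type*} [NormedAddCommGroup H] [InnerProductSpace ℝ H]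
    {T κ M : ℝ} (hκ : 0 ≤ κ) (hM : 0 ≤ M) (u₀ : H) (f : TimeL2 T H) {r R : ℝ} (hr : 0 ≤ r)
    (h : r ≤ R) : dualBound T κ M u₀ f r ≤ dualBound T κ M u₀ f R := by
  unfold dualBound
  gcongr

namespace EigenLift

variable {V H : Type*} [NormedAddCommGroup V] [InnerProductSpace ℝ V]
    [NormedAddCommGroup H] [InnerProductSpace ℝ H] (b : EigenLift V H) {Φ : V → V → ℝ} {T κ M : ℝ}
    {u₀ : H} {f : TimeL2 T H}

/-- Galerkin solutions that are bounded in `L²(0, T; V)` are bounded in `𝓗^δ(0, T; D(A^β), H)` for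
`β ≤ 1/2` and `δ < 1/4`. -/
theorem exists_bounded_lift (hΦ : IsQuadraticForm Φ κ M) (hT : 0 < T) (hκ : 0 ≤ κ) (hM : 0 ≤ M)
    {N : ℕ → ℕ} {U : ℕ → ℝ → V} (hU : ∀ n, IsGalerkinCurve b Φ T u₀ f (N n) (U n))
    {v : ℕ → TimeL2 T V} (hv : ∀ n, v n =ᵐ[timeMeasure T] U n) {R : ℝ} (hR : ∀ n, ‖v n‖ ≤ R)
    {β δ : ℝ} (hβ : 0 ≤ β) (hβ' : β ≤ 1 / 2) (hδ : 0 ≤ δ) (hδ' : δ < 1 / 4) :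
    ∃ z : ℕ → HGamma T δ (b.incl hβ), (∀ n, b.toL2 hβ (z n) = b.i.compLp (v n)) ∧
      ∃ C, ∀ n, ‖z n‖ ≤ C := by
  have hfw := fun n => (hU n).fourierWeight_le hΦ hT hκ hM (hv n) hδ hδ'
  have hex : ∀ n, ∃ p : HGamma T δ (b.incl hβ), HGamma.toFun p = (b.toDPow hβ hβ').compLp (v n) :=
    fun n => HGamma.exists_toFun_eq hT _ (by
      rw [b.compLp_incl_toDPow]
      exact ne_top_of_le_ne_top ENNReal.ofReal_ne_top (hfw n))
  choose z hz using hex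
  refine ⟨z, fun n => ?_, ?_⟩
  · rw [b.toL2_apply, hz, b.compLp_incl_toDPow]
  set A := IsGalerkinCurve.dualBound T κ M u₀ f R with hA
  set I := ∫ τ : ℝ, (1 + ‖τ‖) ^ (-(2 - 4 * δ)) with hI
  have hI0 : 0 ≤ I := integral_nonneg fun τ => by positivity
  refine ⟨√((‖b.toDPow hβ hβ'‖ * R) ^ 2 + ((1 + A) * R ^ 2 + 4 * A * I)), fun n => ?_⟩
  refine Real.le_sqrt_of_sq_le ?_
  have hR0 : 0 ≤ R := (norm_nonneg _).trans (hR n)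
  have hA0 : 0 ≤ A := by rw [hA, IsGalerkinCurve.dualBound]; positivity
  rw [HGamma.norm_sq, hz, b.compLp_incl_toDPow]
  refine add_le_add ?_ ?_
  · refine pow_le_pow_left₀ (norm_nonneg _) (((b.toDPow hβ hβ').norm_compLp_le _).trans ?_) 2
    exact mul_le_mul_of_nonneg_left (hR n) (norm_nonneg _)
  · refine ENNReal.toReal_le_of_le_ofReal (by positivity) ((hfw n).trans ?_)
    refine ENNReal.ofReal_le_ofReal ?_
    have hm := IsGalerkinCurve.dualBound_mono hκ hM u₀ f (norm_nonneg (v n)) (hR n)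
    rw [← hA] at hm
    have h1 := hR n
    gcongr

theorem exists_expansions {b₀ : Spectral H} (hb : b.toSpectral = b₀) {i₀ : V →L[ℝ] H} (hi : b.i = i₀)
    (hlam : Tendsto b₀.lam atTop atTop) (hΦ : IsQuadraticForm Φ κ M)
    (hT : 0 < T) (hκ : 0 ≤ κ) (hM : 0 ≤ M)
    {N : ℕ → ℕ} {U : ℕ → ℝ → V} (hU : ∀ n, IsGalerkinCurve b Φ T u₀ f (N n) (U n))
    {v : ℕ → TimeL2 T V} (hv : ∀ n, v n =ᵐ[timeMeasure T] U n) {R : ℝ} (hR : ∀ n, ‖v n‖ ≤ R)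
    {a₀ : TimeL2 T H} (hstrong : Tendsto (fun n => i₀.compLp (v n)) atTop (𝓝 a₀))
    {α γ : ℝ} (hα : 0 ≤ α) (hα' : α < 1 / 2) (hγ : 0 ≤ γ) (hγ' : γ < 1 / 4) :
    ∃ s : ℕ → ℕ, StrictMono s ∧ ∃ K : ℕ∞,
      (∃ (z : ℕ → HGamma T γ (b₀.incl hα)) (a : HGamma T γ (b₀.incl hα)),
        (∀ n, (b₀.incl hα).compLp (HGamma.toFun (z n)) = i₀.compLp (v (s n))) ∧
        (b₀.incl hα).compLp (HGamma.toFun a) = a₀ ∧ HasExpansion z a K) ∧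
      (∃ (z : ℕ → TimeL2 T (b₀.DPow α)) (a : TimeL2 T (b₀.DPow α)),
        (∀ n, (b₀.incl hα).compLp (z n) = i₀.compLp (v (s n))) ∧
        (b₀.incl hα).compLp a = a₀ ∧ HasExpansion z a K) ∧
      HasExpansion (fun n => i₀.compLp (v (s n))) a₀ K := by
  subst hb hi
  obtain ⟨δ, hγδ, hδ⟩ := exists_between hγ'
  obtain ⟨z, hz, C, hC⟩ := b.exists_bounded_lift hΦ hT hκ hM hU hv hR (hα.trans hα'.le) le_rfl
    (hγ.trans hγδ.le) hδ
  obtain ⟨s, hs, a, ha, K, Γ, w, r, hexp⟩ := b.exists_relaxedExpansion_of_bounded hlam hT hα hα' hγ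
    hγδ z hC (a₀ := a₀) (by simpa only [hz] using hstrong)
  set y : ℕ → HGamma T γ (b.incl hα) := fun n => b.embed hT hα hα'.le hγ hγδ.le (z (s n)) with hy
  have hyz : ∀ n, b.toL2 hα (y n) = b.i.compLp (v (s n)) := fun n => by
    rw [hy, b.toL2_embed, hz]
  have h1 := hexp.map HGamma.toFunL HGamma.toFun_injective
  have h2 := hexp.map (b.toL2 hα) (b.toL2_injective hα)
  refine ⟨s, hs, reducedLength K fun k => w k ≠ 0, ⟨y, a, hyz, ha, hexp.hasExpansion _ fun k => Iff.rfl⟩,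
    ⟨fun n => HGamma.toFunL (y n), HGamma.toFunL a, hyz, ha, h1.hasExpansion _ fun k => ?_⟩, ?_⟩
  · exact (map_ne_zero_iff (HGamma.toFunL (T := T) (γ := γ) (ι := b.incl hα))
      HGamma.toFun_injective).symm
  · simp only [hyz, ha] at h2
    exact h2.hasExpansion _ fun k => (map_ne_zero_iff (b.toL2 hα) (b.toL2_injective hα)).symm

end EigenLift

/-! ### The Navier–Stokes equations -/

section NavierStokes

variable {S : FlowSpaces}

theorem exists_isQuadraticForm (hS : S.IsPeriodicOrNoSlip) (ν : ℝ) (hν : 0 ≤ ν) :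
    ∃ M : ℝ, 0 ≤ M ∧ IsQuadraticForm (fun u w : S.V =>
      ν * FlowSpaces.dirichlet u w + FlowSpaces.trilinear u u w) ν M := by
  obtain ⟨M, hM, hbd, hlin, hcont⟩ := exists_trilinear_bound hS
  refine ⟨M, hM, fun u => ⟨fun w z => ?_, fun c w => ?_⟩, fun u w => ?_, fun w => ?_⟩
  · rw [(isLinearMap_dirichlet u).map_add, (hlin u).map_add]
    ring
  · rw [(isLinearMap_dirichlet u).map_smul, (hlin u).map_smul]
    simp only [smul_eq_mul]
    ring
  · refine (abs_add_le _ _).trans ?_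
    rw [abs_mul, abs_of_nonneg hν]
    have h1 := mul_le_mul_of_nonneg_left (abs_dirichlet_le u w) hν
    have h2 := hbd u w
    linarith
  · exact (continuous_const.mul (continuous_dirichlet w)).add (hcont w)

theorem IsGalerkinSolution.isGalerkinCurve {b : StokesBasis S} {ν T : ℝ} {u₀ : S.H}
    {f : TimeL2 T S.H} {n : ℕ} {U : ℝ → S.V} (h : IsGalerkinSolution b ν T u₀ f n U) :
    IsGalerkinCurve b.toEigenLift (fun u w : S.V =>
      ν * FlowSpaces.dirichlet u w + FlowSpaces.trilinear u u w) T u₀ f n U where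
  mem := h.mem
  cont := h.cont
  eqn t ht j hj := by
    have := h.eqn t ht j hj
    simp only [sub_sub] at this
    exact this

end NavierStokes

end

end NSE

end

open NSE MeasureTheory Filter Topology in
theorem theorem5p2
    (S : FlowSpaces) (hS : S.IsPeriodicOrNoSlip) (b : StokesBasis S)
    (ν : ℝ) (hν : 0 < ν) (T : ℝ) (hT : 0 < T) (u₀ : S.H) (f : TimeL2 T S.H)
    -- Galerkin solutions; `U n` is the one of order `n + 1`
    (U : ℕ → ℝ → S.V) (hU : ∀ n, IsGalerkinSolution b ν T u₀ f (n + 1) (U n))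
    -- the subsequence `v n = U (σ n)`, in `L²(0, T; V)`
    (σ : ℕ → ℕ) (hσ : StrictMono σ)
    (v : ℕ → TimeL2 T S.V) (hv : ∀ n, v n =ᵐ[timeMeasure T] U (σ n))
    (u : TimeL2 T S.V) (hu : IsWeakSolution S ν T u₀ f u)
    (hweak : ∀ ℓ : StrongDual ℝ (TimeL2 T S.V), Tendsto (fun n => ℓ (v n)) atTop (𝓝 (ℓ u)))
    (hstrong : Tendsto (fun n => S.toH.compLp (v n)) atTop (𝓝 (S.toH.compLp u)))
    (α : ℝ) (hα : 0 < α) (hα' : α < 1 / 2) (γ : ℝ) (hγ : 0 < γ) (hγ' : γ < 1 / 4) :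
    ∃ s : ℕ → ℕ, StrictMono s ∧ ∃ K : ℕ∞,
      -- the expansion in `𝓗^γ(0, T; D(A^α), H)`
      (∃ (z : ℕ → HGamma T γ (b.incl hα.le)) (a : HGamma T γ (b.incl hα.le)),
        (∀ n, (b.incl hα.le).compLp (HGamma.toFun (z n)) = S.toH.compLp (v (s n))) ∧
        (b.incl hα.le).compLp (HGamma.toFun a) = S.toH.compLp u ∧
        HasExpansion z a K) ∧
      -- the expansion in `L²(0, T; D(A^α))`
      (∃ (z : ℕ → TimeL2 T (b.DPow α)) (a : TimeL2 T (b.DPow α)),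
        (∀ n, (b.incl hα.le).compLp (z n) = S.toH.compLp (v (s n))) ∧
        (b.incl hα.le).compLp a = S.toH.compLp u ∧
        HasExpansion z a K) ∧
      -- the expansion in `L²(0, T; H)`
      HasExpansion (fun n => S.toH.compLp (v (s n))) (S.toH.compLp u) K := by
  have h₁ := exists_norm_le_of_weak_timeL2 hweak
  have h₂ := exists_isQuadraticForm hS ν hν.le
  have h₃ := b.tendsto_lam hS
  have h₄ : ∀ n, _ := fun n => (hU (σ n)).isGalerkinCurve
  obtain ⟨R, hR⟩ := h₁
  obtain ⟨M, hM, hΦ⟩ := h₂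
  have h := b.toEigenLift.exists_expansions rfl rfl h₃ hΦ hT hν.le hM h₄ hv hR hstrong
    hα.le hα' hγ.le hγ'
  exact h
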